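/- Let $d\ge 1$, let $s>\frac d2+1$ be real, $a,b>0$, $0<T<\infty$, $M\ge 0$ and $\kappa<\frac a{2b}$. There is a constant $C$, depending only on $d,s,a,b,\kappa,M$ and $T$, such that the following holds. Let $V\in C^2_0(\mathbb R^d)$ be non-negative with support in the closed unit ball $B_1$ and $\int_{\mathbb R^d}V\,dx=2b$ (so that $\|V\|_{L^1}=2b$), and put $V_\varepsilon(x)=\varepsilon^{-d}V(x/\varepsilon)$. Let $u_0\in H^s(\mathbb R^d)$ with $0\le u_0\le\kappa$ almost everywhere. Let $u$ be a weak solution on $(0,T)\times\mathbb R^d$ of the limiting problem $$\partial_t u-\nabla\cdot(a\nabla u-2bu\nabla u)=0,\qquad u(\cdot,0)=u_0,$$ and, for some $\varepsilon>0$, let $u^\varepsilon$ be a weak solution on $(0,T)\times\mathbb R^d$ of the intermediate problem $$\partial_t u^\varepsilon-\nabla\cdot\big(a\nabla u^\varepsilon-u^\varepsilon\,\nabla V_\varepsilon*u^\varepsilon\big)=0,\qquad u^\varepsilon(\cdot,0)=u_0,$$ with the bounds, uniform in $\varepsilon$, $$\|w\|_{L^\infty(0,T;H^s(\mathbb R^d))}\le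 M,\qquad \|w\|_{L^2(0,T;H^{s+1}(\mathbb R^d))}\le M\qquad\text{for } w=u \text{ and } w=u^\varepsilon .$$ Here a weak solution of $\partial_t w-\nabla\cdot J(w)=0$, $w(\cdot,0)=u_0$, is a measurable function $w$ with $\int_0^T\!\int_{\mathbb R^d}\big(w\,\partial_t\varphi-J(w)\cdot\nabla\varphi\big)\,dx\,dt+\int_{\mathbb R^d}u_0\,\varphi(\cdot,0)\,dx=0$ for all $\varphi\in C_c^\infty([0,T)\times\mathbb R^d)$, where gradients of $w$ are weak gradients. Then $u^\varepsilon(\cdot,t)-u(\cdot,t)$ has a weak gradient for almost every $t\in(0,T)$, and $$\|u^\varepsilon-u\|_{L^\infty(0,T;L^2(\mathbb R^d))}+\|\nabla(u^\varepsilon-u)\|_{L^2(0,T;L^2(\mathbb R^d))}\le C\varepsilon .$$ -/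

import Mathlib

open MeasureTheory Set
open scoped ENNReal ContDiff FourierTransform

noncomputable section

namespace DiffusionAggregation

/-- `G` is the weak (distributional) gradient of `f` on `ℝ^d`:
`∫ f ∇φ = - ∫ φ G` for every test function `φ ∈ C_c^∞(ℝ^d)`. -/
def HasWeakGradient {d : ℕ} (f : EuclideanSpace ℝ (Fin d) → ℝ)
    (G : EuclideanSpace ℝ (Fin d) → EuclideanSpace ℝ (Fin d)) : Prop :=
  LocallyIntegrable f volume ∧ LocallyIntegrable G volume ∧
    ∀ φ : EuclideanSpace ℝ (Fin d) → ℝ, ContDiff ℝ ∞ φ → HasCompactSupport φ →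
      ∫ x, f x • gradient φ x = - ∫ x, φ x • G x

open Classical in
/-- The weak gradient of `f`. It is unique up to a null set where it exists; the value is `0`
if `f` has no weak gradient. -/
def weakGrad {d : ℕ} (f : EuclideanSpace ℝ (Fin d) → ℝ) :
    EuclideanSpace ℝ (Fin d) → EuclideanSpace ℝ (Fin d) :=
  if h : ∃ G, HasWeakGradient f G then h.choose else 0

open Classical in
/-- The `H^s(ℝ^d)` norm, for real `s ≥ 0`, of a real function `f`: the `L²` norm of
`(1 + |ξ|²)^(s/2) f̂(ξ)`, with `f̂` the `L²` Fourier transform; `∞` if `f` is not in `L²`.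
The weight is the one of Mathlib's Bessel potential; the Fourier transform carries a factor
`2π` in the exponent, which replaces the norm by an equivalent one. -/
def sobolevENorm {d : ℕ} (s : ℝ) (f : EuclideanSpace ℝ (Fin d) → ℝ) : ℝ≥0∞ :=
  if h : MemLp (fun x => (f x : ℂ)) 2 volume then
    eLpNorm (fun ξ => (((1 + ‖ξ‖ ^ 2) ^ (s / 2) : ℝ) : ℂ) *
      (𝓕 (h.toLp (fun x => (f x : ℂ))) : Lp ℂ 2 (volume : Measure (EuclideanSpace ℝ (Fin d)))) ξ)
      2 volume
  else ∞

/-- The norm of `L^p(0,T;X)`, where `N` is the (extended) norm of the space `X`. -/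
def timeENorm {d : ℕ} (p : ℝ≥0∞) (T : ℝ) (N : (EuclideanSpace ℝ (Fin d) → ℝ) → ℝ≥0∞)
    (u : ℝ → EuclideanSpace ℝ (Fin d) → ℝ) : ℝ≥0∞ :=
  eLpNorm (fun t => N (u t)) p (volume.restrict (Ioo 0 T))

/-- The rescaled potential `V_ε(x) = ε^{-d} V(x/ε)`. -/
def scaledPotential {d : ℕ} (V : EuclideanSpace ℝ (Fin d) → ℝ) (ε : ℝ) :
    EuclideanSpace ℝ (Fin d) → ℝ :=
  fun x => (ε ^ d)⁻¹ * V (ε⁻¹ • x)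

/-- The flux `a ∇u - 2 b u ∇u` of the limiting problem. -/
def limitFlux {d : ℕ} (a b : ℝ) (f : EuclideanSpace ℝ (Fin d) → ℝ) :
    EuclideanSpace ℝ (Fin d) → EuclideanSpace ℝ (Fin d) :=
  fun x => a • weakGrad f x - (2 * b * f x) • weakGrad f x

/-- The flux `a ∇u - u (∇W * u)` of the non-local problem with potential `W`. -/
def nonlocalFlux {d : ℕ} (a : ℝ) (W f : EuclideanSpace ℝ (Fin d) → ℝ) :
    EuclideanSpace ℝ (Fin d) → EuclideanSpace ℝ (Fin d) :=
  fun x => a • weakGrad f x -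
    f x • convolution f (gradient W) (ContinuousLinearMap.lsmul ℝ ℝ) volume x

/-- `u` is a weak solution on `(0,T) × ℝ^d` of `∂_t u - ∇ · J(u) = 0`, `u(0) = u₀`:
for every test function `φ ∈ C_c^∞([0,T) × ℝ^d)`,
`∫_0^T ∫ (u ∂_t φ - J(u) · ∇φ) dx dt + ∫ u₀ φ(0) dx = 0`. -/
structure IsWeakSolution {d : ℕ} (T : ℝ)
    (J : (EuclideanSpace ℝ (Fin d) → ℝ) → EuclideanSpace ℝ (Fin d) → EuclideanSpace ℝ (Fin d))
    (u₀ : EuclideanSpace ℝ (Fin d) → ℝ) (u : ℝ → EuclideanSpace ℝ (Fin d) → ℝ) : Prop where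
  measurable : AEStronglyMeasurable (fun p : ℝ × EuclideanSpace ℝ (Fin d) => u p.1 p.2)
    ((volume.restrict (Ioo 0 T)).prod volume)
  weak_form : ∀ φ : ℝ × EuclideanSpace ℝ (Fin d) → ℝ, ContDiff ℝ ∞ φ → HasCompactSupport φ →
    tsupport φ ⊆ Iio T ×ˢ univ →
    (∫ t in Ioo 0 T, ∫ x, (u t x * deriv (fun τ => φ (τ, x)) t -
        inner ℝ (J (u t) x) (gradient (fun y => φ (t, y)) x))) +
      ∫ x, u₀ x * φ (0, x) = 0

end DiffusionAggregation

end

/-! The difference w = u^ε − u obeys an energy inequality whose only source is the consistency error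
R = ∇V_ε * u^ε − 2b ∇u^ε. Since V_ε has mass 2b and lives in the ball of radius ε, the mean value
formula gives ‖R‖ ≤ 2bε ‖D²u^ε‖ in L² (`eLpNorm_velocity_sub_le`), and the L²(0,T;H^{s+1}) bound
controls D²u^ε.

Tested against ∇w, the difference of the fluxes yields the dissipation (a − 2bu)|∇w|² and the error
terms u^ε R·∇w + 2b w ∇u^ε·∇w. The splitting is chosen so that the diffusion coefficient is
evaluated at u only: u ≤ κ makes it at least l = a − 2bκ > 0, while of u^ε only sup bounds on itself
and its gradient are used. Young's inequality absorbs the error terms into half of the dissipation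
(`integral_sub_mul_divergence_sub_le`), and Grönwall's inequality concludes, because w starts from 0
(`energy_estimate`, `comparison_estimate`).

The bound u ≤ κ is a maximum principle (`ae_forall_le_of_limit`). The limiting equation is backward
parabolic where u > a/(2b), so the usual truncation (u − κ)₊ has no sign there. It is replaced by
β(u), with β a monotone step that vanishes up to κ and is constant beyond a/(2b). Then β'(u)(a −
2bu) ≥ 0 everywhere, and with Φ' = β the integral of Φ(u), zero at the start, cannot grow.

These computations are justified as follows. As s > d/2 + 1, almost every time slice has a C²
representative, bounded with its gradient, with Hessian in L² (`exists_isRegularRep`). The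
divergence of the flux is then in L², and the weak formulation says that t ↦ u(t) is the primitive
of an integrable L²-valued function (`ae_eq_add_integral_of_weak_deriv`,
`IsWeakSolution.exists_integral_eq`). The chain rule along such curves
(`comp_sub_eq_integral_inner`) gives both the evolution of ‖w‖² and that of ∫ Φ(u). -/

noncomputable section

namespace DiffusionAggregation

/-! ### Gradients, divergences and integration by parts. -/

/-- The Euclidean space `ℝ^d`. -/
abbrev Eucl (d : ℕ) := EuclideanSpace ℝ (Fin d)

variable {d : ℕ}

/-- The classical divergence of a vector field. -/
def divergence (J : Eucl d → Eucl d) (x : Eucl d) : ℝ :=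
  ∑ i, (fderiv ℝ J x (EuclideanSpace.single i 1)) i

lemma inner_gradient_left (φ : Eucl d → ℝ) (x v : Eucl d) :
    inner ℝ (gradient φ x) v = fderiv ℝ φ x v := by
  simp [gradient]

lemma gradient_apply (φ : Eucl d → ℝ) (x : Eucl d) (i : Fin d) :
    gradient φ x i = fderiv ℝ φ x (EuclideanSpace.single i 1) := by
  rw [← inner_gradient_left, EuclideanSpace.inner_single_right]
  simp

lemma norm_gradient (φ : Eucl d → ℝ) (x : Eucl d) : ‖gradient φ x‖ = ‖fderiv ℝ φ x‖ := by
  simp [gradient]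

lemma contDiff_gradient {φ : Eucl d → ℝ} {n m : WithTop ℕ∞} (hφ : ContDiff ℝ n φ)
    (hmn : m + 1 ≤ n) : ContDiff ℝ m (gradient φ) :=
  (InnerProductSpace.toDual ℝ (Eucl d)).symm.contDiff.comp (hφ.fderiv_right hmn)

lemma continuous_gradient {φ : Eucl d → ℝ} (hφ : ContDiff ℝ 1 φ) : Continuous (gradient φ) :=
  (contDiff_gradient (m := 0) hφ (by norm_num)).continuous

lemma hasCompactSupport_gradient {φ : Eucl d → ℝ} (hφ : HasCompactSupport φ) :
    HasCompactSupport (gradient φ) :=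
  (hφ.fderiv ℝ).comp_left (g := (InnerProductSpace.toDual ℝ (Eucl d)).symm) (map_zero _)

lemma fderiv_apply_coord {J : Eucl d → Eucl d} {x : Eucl d} (hJ : DifferentiableAt ℝ J x)
    (v : Eucl d) (i : Fin d) : fderiv ℝ (fun y => J y i) x v = (fderiv ℝ J x v) i := by
  have := ((EuclideanSpace.proj i : Eucl d →L[ℝ] ℝ).hasFDerivAt.comp x hJ.hasFDerivAt).fderiv
  change fderiv ℝ ((EuclideanSpace.proj i : Eucl d →L[ℝ] ℝ) ∘ J) x v = _
  rw [this]
  rfl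

lemma memLp_coord {J : Eucl d → Eucl d} {p : ℝ≥0∞} {μ : Measure (Eucl d)} (hJ : MemLp J p μ)
    (i : Fin d) : MemLp (fun x => J x i) p μ :=
  (EuclideanSpace.proj i : Eucl d →L[ℝ] ℝ).comp_memLp' hJ

lemma memLp_fderiv_coord {J : Eucl d → Eucl d} {p : ℝ≥0∞} {μ : Measure (Eucl d)}
    (hJ : MemLp (fderiv ℝ J) p μ) (v : Eucl d) (i : Fin d) :
    MemLp (fun x => (fderiv ℝ J x v) i) p μ :=
  ((EuclideanSpace.proj i : Eucl d →L[ℝ] ℝ).comp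
    (ContinuousLinearMap.apply ℝ (Eucl d) v)).comp_memLp' hJ

lemma memLp_divergence {J : Eucl d → Eucl d} {p : ℝ≥0∞} {μ : Measure (Eucl d)}
    (hJ : MemLp (fderiv ℝ J) p μ) : MemLp (divergence J) p μ :=
  memLp_finsetSum _ fun i _ => memLp_fderiv_coord hJ _ i

lemma abs_divergence_le (J : Eucl d → Eucl d) (x : Eucl d) :
    ‖divergence J x‖ ≤ d * ‖fderiv ℝ J x‖ := by
  refine (norm_sum_le _ _).trans ?_
  have : ∀ i ∈ (Finset.univ : Finset (Fin d)),
      ‖(fderiv ℝ J x (EuclideanSpace.single i 1)) i‖ ≤ ‖fderiv ℝ J x‖ := fun i _ =>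
    (PiLp.norm_apply_le _ i).trans (((fderiv ℝ J x).le_opNorm _).trans (by simp))
  simpa using Finset.sum_le_sum this

lemma inner_gradient_eq_sum (φ : Eucl d → ℝ) (w x : Eucl d) :
    inner ℝ w (gradient φ x) = ∑ i, fderiv ℝ φ x (EuclideanSpace.single i 1) * w i := by
  rw [PiLp.inner_apply]
  refine Finset.sum_congr rfl fun i _ => ?_
  rw [gradient_apply]
  simp

lemma memLp_fderiv_of_gradient {φ : Eucl d → ℝ} {p : ℝ≥0∞} {μ : Measure (Eucl d)}
    (h : MemLp (gradient φ) p μ) (i : Fin d) :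
    MemLp (fun x => fderiv ℝ φ x (EuclideanSpace.single i 1)) p μ := by
  simpa only [gradient_apply] using memLp_coord h i

/-- Integration by parts for `H¹` functions of class `C¹`. -/
lemma integral_mul_divergence {φ : Eucl d → ℝ} {J : Eucl d → Eucl d}
    (hφ : Differentiable ℝ φ) (hJ : Differentiable ℝ J) (hφ2 : MemLp φ 2)
    (hφ' : MemLp (gradient φ) 2) (hJ2 : MemLp J 2) (hJ' : MemLp (fderiv ℝ J) 2) :
    ∫ x, φ x * divergence J x = -∫ x, inner ℝ (J x) (gradient φ x) := by
  have h1 : ∀ i : Fin d, Integrable fun x =>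
      φ x * (fderiv ℝ J x (EuclideanSpace.single i 1)) i := fun i =>
    hφ2.integrable_mul (memLp_fderiv_coord hJ' _ i)
  have h2 : ∀ i : Fin d, Integrable fun x =>
      fderiv ℝ φ x (EuclideanSpace.single i 1) * J x i := fun i =>
    (memLp_fderiv_of_gradient hφ' i).integrable_mul (memLp_coord hJ2 i)
  simp_rw [inner_gradient_eq_sum, divergence, Finset.mul_sum]
  rw [integral_finsetSum _ fun i _ => h1 i, integral_finsetSum _ fun i _ => h2 i,
    ← Finset.sum_neg_distrib]
  refine Finset.sum_congr rfl fun i _ => ?_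
  have hJi : Differentiable ℝ fun x => J x i := fun x =>
    (EuclideanSpace.proj i : Eucl d →L[ℝ] ℝ).differentiableAt.comp x (hJ x)
  have := integral_mul_fderiv_eq_neg_fderiv_mul_of_integrable (μ := (volume : Measure (Eucl d)))
    (f := φ) (g := fun x => J x i) (v := EuclideanSpace.single i 1) (h2 i)
    (by simpa only [fderiv_apply_coord (hJ _)] using h1 i)
    (hφ2.integrable_mul (memLp_coord hJ2 i)) (fun x _ => hφ x) (fun x _ => hJi x)
  simpa only [fderiv_apply_coord (hJ _)] using this

lemma integrable_inner_of_memLp {J G : Eucl d → Eucl d} (hJ : MemLp J 2) (hG : MemLp G 2) :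
    Integrable fun x => inner ℝ (J x) (G x) := by
  simp_rw [PiLp.inner_apply]
  exact integrable_finsetSum _ fun i _ => (memLp_coord hG i).integrable_mul (memLp_coord hJ i)

lemma memLp_of_continuous_compactSupport {F : Type*} [NormedAddCommGroup F] {φ : Eucl d → F}
    (hφ : Continuous φ) (hc : HasCompactSupport φ) (p : ℝ≥0∞) : MemLp φ p :=
  hφ.memLp_of_hasCompactSupport hc

/-- Integration by parts against a compactly supported function. -/
lemma integral_smul_gradient_eq_neg {h φ : Eucl d → ℝ} (hh : ContDiff ℝ 1 h)
    (hφ : ContDiff ℝ 1 φ) (hc : HasCompactSupport φ) :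
    ∫ x, h x • gradient φ x = -∫ x, φ x • gradient h x := by
  have hgφ := continuous_gradient hφ
  have i1 : Integrable fun x => h x • gradient φ x :=
    (hh.continuous.smul hgφ).integrable_of_hasCompactSupport
      ((hasCompactSupport_gradient hc).smul_left (f := h))
  have i2 : Integrable fun x => φ x • gradient h x :=
    (hφ.continuous.smul (continuous_gradient hh)).integrable_of_hasCompactSupport
      (hc.smul_right (f' := gradient h))
  ext i
  have e1 := (EuclideanSpace.proj i : Eucl d →L[ℝ] ℝ).integral_comp_comm i1
  have e2 := (EuclideanSpace.proj i : Eucl d →L[ℝ] ℝ).integral_comp_comm i2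
  simp only [EuclideanSpace.coe_proj, PiLp.smul_apply, smul_eq_mul] at e1 e2
  rw [PiLp.neg_apply, ← e1, ← e2]
  have j1 : Integrable fun x => h x * gradient φ x i := by
    simpa using (EuclideanSpace.proj i : Eucl d →L[ℝ] ℝ).integrable_comp i1
  have j2 : Integrable fun x => φ x * gradient h x i := by
    simpa using (EuclideanSpace.proj i : Eucl d →L[ℝ] ℝ).integrable_comp i2
  simp only [gradient_apply] at j1 j2 ⊢
  have := integral_mul_fderiv_eq_neg_fderiv_mul_of_integrable (μ := (volume : Measure (Eucl d)))
    (f := h) (g := φ) (v := EuclideanSpace.single i 1) (by simpa only [mul_comm] using j2) j1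
    ((hh.continuous.mul hφ.continuous).integrable_of_hasCompactSupport (hc.mul_left (f := h)))
    (fun x _ => hh.differentiable (by norm_num) x) (fun x _ => hφ.differentiable (by norm_num) x)
  rw [this]
  simp only [mul_comm]

/-- The classical gradient of a `C¹` function is a weak gradient. -/
lemma hasWeakGradient_gradient {h : Eucl d → ℝ} (hh : ContDiff ℝ 1 h) :
    HasWeakGradient h (gradient h) :=
  ⟨hh.continuous.locallyIntegrable, (continuous_gradient hh).locallyIntegrable, fun _ hφ hc =>
    integral_smul_gradient_eq_neg hh (hφ.of_le (by exact_mod_cast le_top)) hc⟩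

lemma HasWeakGradient.unique {f : Eucl d → ℝ} {G G' : Eucl d → Eucl d}
    (h : HasWeakGradient f G) (h' : HasWeakGradient f G') : G =ᵐ[volume] G' := by
  have : ∀ᵐ x, (G - G') x = 0 := by
    refine ae_eq_zero_of_integral_contDiff_smul_eq_zero (h.2.1.sub h'.2.1) fun φ hφ hc => ?_
    have i1 : Integrable fun x => φ x • G x :=
      h.2.1.integrable_smul_left_of_hasCompactSupport hφ.continuous hc
    have i2 : Integrable fun x => φ x • G' x :=
      h'.2.1.integrable_smul_left_of_hasCompactSupport hφ.continuous hc
    simp only [Pi.sub_apply, smul_sub]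
    rw [integral_sub i1 i2]
    have := (h.2.2 φ hφ hc).symm.trans (h'.2.2 φ hφ hc)
    rw [neg_inj.mp this, sub_self]
  filter_upwards [this] with x hx using sub_eq_zero.mp hx

lemma HasWeakGradient.congr {f f' : Eucl d → ℝ} {G : Eucl d → Eucl d}
    (h : HasWeakGradient f G) (hf : f =ᵐ[volume] f') : HasWeakGradient f' G := by
  refine ⟨h.1.congr hf, h.2.1, fun φ hφ hc => ?_⟩
  rw [← h.2.2 φ hφ hc]
  refine integral_congr_ae ?_
  filter_upwards [hf] with x hx
  rw [hx]

/-- `weakGrad` is an arbitrary choice among weak gradients; uniqueness up to null sets allows it to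
be replaced by a classical gradient whenever a C¹ representative is known. -/
lemma weakGrad_ae_eq {f h : Eucl d → ℝ} (hf : f =ᵐ[volume] h) (hh : ContDiff ℝ 1 h) :
    weakGrad f =ᵐ[volume] gradient h := by
  have hG : HasWeakGradient f (gradient h) := (hasWeakGradient_gradient hh).congr hf.symm
  have hex : ∃ G, HasWeakGradient f G := ⟨_, hG⟩
  rw [weakGrad, dif_pos hex]
  exact hex.choose_spec.unique hG

/-! ### L² bounds for averages of translates. -/

lemma eLpNorm_two_sq {α F : Type*} [MeasurableSpace α] [NormedAddCommGroup F] (μ : Measure α)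
    (f : α → F) : eLpNorm f 2 μ ^ 2 = ∫⁻ x, ‖f x‖ₑ ^ 2 ∂μ := by
  have := eLpNorm_nnreal_pow_eq_lintegral (f := f) (μ := μ) (p := 2) (by norm_num)
  simpa using this

/-- Jensen's inequality for averages of translates. -/
lemma lintegral_sq_average_le {Z : Type*} [MeasurableSpace Z] (ν : Measure Z) [SFinite ν]
    {y : Z → Eucl d} (hy : Measurable y) {h : Eucl d → ℝ≥0∞} (hh : Measurable h) :
    ∫⁻ x, (∫⁻ z, h (x - y z) ∂ν) ^ 2 ≤ ν univ ^ 2 * ∫⁻ x, h x ^ 2 := by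
  have cs : ∀ x, (∫⁻ z, h (x - y z) ∂ν) ^ 2 ≤ ν univ * ∫⁻ z, h (x - y z) ^ 2 ∂ν := fun x => by
    have := ENNReal.lintegral_mul_le_Lp_mul_Lq ν Real.HolderConjugate.two_two
      (f := fun z => h (x - y z)) (g := fun _ => 1)
      (hh.comp (measurable_const.sub hy)).aemeasurable aemeasurable_const
    simp only [Pi.mul_apply, mul_one, lintegral_const, ENNReal.rpow_ofNat, one_pow,
      one_mul] at this
    calc (∫⁻ z, h (x - y z) ∂ν) ^ 2
        ≤ ((∫⁻ z, h (x - y z) ^ 2 ∂ν) ^ (1 / 2 : ℝ) * ν univ ^ (1 / 2 : ℝ)) ^ 2 := by gcongr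
      _ = _ := by
        rw [mul_pow, ← ENNReal.rpow_mul_natCast, ← ENNReal.rpow_mul_natCast]
        norm_num [mul_comm]
  calc ∫⁻ x, (∫⁻ z, h (x - y z) ∂ν) ^ 2
      ≤ ∫⁻ x, ν univ * ∫⁻ z, h (x - y z) ^ 2 ∂ν := lintegral_mono cs
    _ = ν univ * ∫⁻ x, ∫⁻ z, h (x - y z) ^ 2 ∂ν := by
        refine lintegral_const_mul _ ?_
        exact Measurable.lintegral_prod_right' (f := fun p : Eucl d × Z => h (p.1 - y p.2) ^ 2)
          (by fun_prop)
    _ = ν univ * ∫⁻ z, (∫⁻ x, h (x - y z) ^ 2) ∂ν := by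
        rw [lintegral_lintegral_swap (f := fun x z => h (x - y z) ^ 2)
          (Measurable.aemeasurable (by fun_prop))]
    _ = _ := by
        have : ∀ z, ∫⁻ x, h (x - y z) ^ 2 = ∫⁻ x, h x ^ 2 := fun z =>
          lintegral_sub_right_eq_self (fun x => h x ^ 2) (y z)
        simp_rw [this, lintegral_const]
        ring

/-- The parameter space `Z` is kept general for two uses: with `Z` the space itself and the identity
shift it gives Young's inequality, and with `Z` the product of space and a time segment, shifted by
`r • z`, it gives the O(ε) consistency bound. -/
lemma eLpNorm_two_le_of_average {Z F F' : Type*} [MeasurableSpace Z] [NormedAddCommGroup F]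
    [NormedAddCommGroup F'] (ν : Measure Z) [SFinite ν]
    {y : Z → Eucl d} (hy : Measurable y) {h : Eucl d → F} (hh : Continuous h) {P : Eucl d → F'}
    (hP : ∀ x, ‖P x‖ₑ ≤ ∫⁻ z, ‖h (x - y z)‖ₑ ∂ν) :
    eLpNorm P 2 ≤ ν univ * eLpNorm h 2 := by
  rw [← ENNReal.pow_le_pow_left_iff two_ne_zero, mul_pow, eLpNorm_two_sq, eLpNorm_two_sq]
  refine le_trans (lintegral_mono fun x => ?_)
    (lintegral_sq_average_le ν hy (h := fun x => ‖h x‖ₑ) hh.enorm.measurable)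
  exact pow_le_pow_left' (hP x) 2

/-! ### Fourier transform on L¹ ∩ L² and the Sobolev embedding. -/

lemma integral_fourierInv_smul_eq {f g : Eucl d → ℂ} (hf : Integrable f) (hg : Integrable g) :
    ∫ x, 𝓕⁻ f x • g x = ∫ x, f x • 𝓕⁻ g x := by
  have := VectorFourier.integral_fourierIntegral_smul_eq_flip (L := -innerₗ (Eucl d))
    (μ := (volume : Measure (Eucl d))) (ν := (volume : Measure (Eucl d)))
    Real.continuous_fourierChar (by simpa using by fun_prop) hf hg
  -- The Fourier kernel is symmetric in its two variables, so exchanging them gives the same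
  -- transform.
  have hflip : (-innerₗ (Eucl d)).flip = -innerₗ (Eucl d) := by
    ext x y
    simp [real_inner_comm]
  rw [hflip] at this
  exact this

/-- The `L²` inverse Fourier transform is given by the integral formula on `L¹ ∩ L²`. -/
lemma coeFn_fourierInv_ae_eq (v : Lp ℂ 2 (volume : Measure (Eucl d))) (hv : Integrable v) :
    (𝓕⁻ v : Lp ℂ 2 (volume : Measure (Eucl d))) =ᵐ[volume] 𝓕⁻ (v : Eucl d → ℂ) := by
  have hcont : Continuous (𝓕⁻ (v : Eucl d → ℂ)) :=
    VectorFourier.fourierIntegral_continuous Real.continuous_fourierChar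
      (by simpa using by fun_prop) hv
  have hloc : LocallyIntegrable (𝓕⁻ v : Lp ℂ 2 (volume : Measure (Eucl d))) :=
    (Lp.memLp (𝓕⁻ v)).locallyIntegrable (by norm_num)
  have : ∀ᵐ x, ((𝓕⁻ v : Lp ℂ 2 (volume : Measure (Eucl d))) : Eucl d → ℂ) x -
      𝓕⁻ (v : Eucl d → ℂ) x = 0 := by
    refine ae_eq_zero_of_integral_contDiff_smul_eq_zero
      (hloc.sub hcont.locallyIntegrable) fun φ hφ hc => ?_
    have hc' : HasCompactSupport (Complex.ofRealCLM ∘ φ) := hc.comp_left rfl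
    have hφ' : ContDiff ℝ ∞ (Complex.ofRealCLM ∘ φ) := by fun_prop
    -- The L² transform agrees with that of tempered distributions, which is defined by duality; the
    -- test function serves as a Schwartz function and the transform is then moved back to `v` by
    -- Fubini.
    have key := congrArg (fun F => F (hc'.toSchwartzMap hφ'))
      (Lp.fourierInv_toTemperedDistribution_eq v)
    simp only [TemperedDistribution.fourierInv_apply, Lp.toTemperedDistribution_apply] at key
    have e1 : ∫ x, (𝓕⁻ (hc'.toSchwartzMap hφ')) x • v x =
        ∫ x, (Complex.ofRealCLM ∘ φ) x • 𝓕⁻ (v : Eucl d → ℂ) x := by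
      rw [← integral_fourierInv_smul_eq
        (hφ'.continuous.integrable_of_hasCompactSupport hc') hv, SchwartzMap.fourierInv_coe]
      rfl
    rw [e1] at key
    have i1 : Integrable fun x => φ x •
        ((𝓕⁻ v : Lp ℂ 2 (volume : Measure (Eucl d))) : Eucl d → ℂ) x :=
      hloc.integrable_smul_left_of_hasCompactSupport hφ.continuous hc
    have i2 : Integrable fun x => φ x • 𝓕⁻ (v : Eucl d → ℂ) x :=
      hcont.locallyIntegrable.integrable_smul_left_of_hasCompactSupport hφ.continuous hc
    simp only [smul_sub]
    rw [integral_sub i1 i2, sub_eq_zero]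
    simpa using key.symm
  filter_upwards [this] with x hx using sub_eq_zero.mp hx

lemma fourierInv_congr_ae {f g : Eucl d → ℂ} (h : f =ᵐ[volume] g) : 𝓕⁻ f = 𝓕⁻ g := by
  ext x
  rw [Real.fourierInv_eq, Real.fourierInv_eq]
  refine integral_congr_ae ?_
  filter_upwards [h] with y hy
  rw [hy]

/-- Plancherel's identity on `L¹ ∩ L²`. -/
lemma eLpNorm_fourier_eq {g : Eucl d → ℂ} (hg : Integrable g) (hg2 : MemLp g 2) :
    MemLp (𝓕 g) 2 ∧ eLpNorm (𝓕 g) 2 = eLpNorm g 2 := by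
  have hmp : MeasurePreserving (fun x : Eucl d => -x) volume volume :=
    Measure.measurePreserving_neg volume
  have hg' : MemLp (fun x => g (-x)) 2 := hg2.comp_measurePreserving hmp
  have hgi : Integrable fun x => g (-x) := hg.comp_neg
  have h1 : eLpNorm (fun x => g (-x)) 2 = eLpNorm g 2 :=
    eLpNorm_comp_measurePreserving hg2.1 hmp
  -- Reflection reduces the forward transform to the inverse one, already identified with its
  -- integral formula.
  have h2 : 𝓕 g = 𝓕⁻ (fun x => g (-x)) := by
    rw [Real.fourierInv_eq_fourier_comp_neg]
    simp
  have h3 := (coeFn_fourierInv_ae_eq (hg'.toLp _) (hgi.congr hg'.coeFn_toLp.symm)).trans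
    (Filter.EventuallyEq.of_eq (fourierInv_congr_ae hg'.coeFn_toLp))
  rw [← h2] at h3
  refine ⟨(memLp_congr_ae h3).mp (Lp.memLp _), ?_⟩
  have h4 : ‖(𝓕⁻ (hg'.toLp _) : Lp ℂ 2 (volume : Measure (Eucl d)))‖ₑ = ‖hg'.toLp _‖ₑ := by
    have := Lp.norm_fourier_eq (𝓕⁻ (hg'.toLp _) : Lp ℂ 2 (volume : Measure (Eucl d)))
    rw [FourierTransform.fourier_fourierInv_eq] at this
    rw [← ofReal_norm, ← ofReal_norm, this]
  rw [Lp.enorm_def, Lp.enorm_def, eLpNorm_congr_ae h3, eLpNorm_congr_ae hg'.coeFn_toLp, h1] at h4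
  exact h4

/-- The Fourier multiplier of `∂_y` under the forward transform. -/
def derivSymbol (y : Eucl d) (g : Eucl d → ℂ) (ξ : Eucl d) : ℂ :=
  -(2 * Real.pi * Complex.I) * ((inner ℝ ξ y : ℝ) * g ξ)

lemma norm_derivSymbol_le (y : Eucl d) (g : Eucl d → ℂ) (ξ : Eucl d) :
    ‖derivSymbol y g ξ‖ ≤ 2 * Real.pi * ‖y‖ * (‖ξ‖ * ‖g ξ‖) := by
  have h := abs_real_inner_le_norm ξ y
  have : ‖derivSymbol y g ξ‖ = 2 * Real.pi * (|inner ℝ ξ y| * ‖g ξ‖) := by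
    simp [derivSymbol, abs_of_pos Real.pi_pos]
  rw [this]
  calc 2 * Real.pi * (|inner ℝ ξ y| * ‖g ξ‖)
      ≤ 2 * Real.pi * ((‖ξ‖ * ‖y‖) * ‖g ξ‖) := by gcongr
    _ = _ := by ring

lemma aestronglyMeasurable_derivSymbol (y : Eucl d) {g : Eucl d → ℂ}
    (hg : AEStronglyMeasurable g) : AEStronglyMeasurable (derivSymbol y g) := by
  unfold derivSymbol
  exact (((by fun_prop : Continuous fun ξ : Eucl d =>
    ((inner ℝ ξ y : ℝ) : ℂ)).aestronglyMeasurable).mul hg).const_mul _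

lemma hasFDerivAt_re_fourier {g : Eucl d → ℂ} (hg : Integrable g)
    (hg' : Integrable fun ξ => ‖ξ‖ * ‖g ξ‖) (x : Eucl d) :
    HasFDerivAt (fun x => (𝓕 g x).re)
      (Complex.reCLM.comp (𝓕 (VectorFourier.fourierSMulRight (innerSL ℝ) g) x)) x :=
  Complex.reCLM.hasFDerivAt.comp x (Real.hasFDerivAt_fourier hg hg' x)

lemma integrable_fourierSMulRight {g : Eucl d → ℂ} (hg : Integrable g)
    (hg' : Integrable fun ξ => ‖ξ‖ * ‖g ξ‖) :
    Integrable (VectorFourier.fourierSMulRight (innerSL ℝ : Eucl d →L[ℝ] Eucl d →L[ℝ] ℝ) g) := by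
  refine (hg'.const_mul (2 * Real.pi)).mono' hg.1.fourierSMulRight ?_
  filter_upwards with ξ
  rw [VectorFourier.norm_fourierSMulRight, innerSL_apply_norm, mul_assoc]

/-- Evaluation in a direction commutes with the transform of the operator-valued symbol. The
directional derivative is thus again the real part of a scalar Fourier transform, and the formula
can be iterated for second derivatives. -/
lemma fderiv_re_fourier_apply {g : Eucl d → ℂ} (hg : Integrable g)
    (hg' : Integrable fun ξ => ‖ξ‖ * ‖g ξ‖) (x y : Eucl d) :
    fderiv ℝ (fun x => (𝓕 g x).re) x y = (𝓕 (derivSymbol y g) x).re := by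
  rw [(hasFDerivAt_re_fourier hg hg' x).fderiv]
  simp only [ContinuousLinearMap.comp_apply, Complex.reCLM_apply]
  rw [Real.fourier_continuousLinearMap_apply (integrable_fourierSMulRight hg hg')]
  rfl

lemma enorm_fourier_le {F : Type*} [NormedAddCommGroup F] [NormedSpace ℂ F]
    (g : Eucl d → F) (x : Eucl d) : ‖𝓕 g x‖ₑ ≤ ∫⁻ ξ, ‖g ξ‖ₑ := by
  rw [Real.fourier_eq]
  refine (enorm_integral_le_lintegral_enorm _).trans (le_of_eq ?_)
  refine lintegral_congr fun ξ => ?_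
  rw [← ofReal_norm, ← ofReal_norm, Circle.norm_smul]

lemma enorm_fderiv_re_fourier_le {g : Eucl d → ℂ} (hg : Integrable g)
    (hg' : Integrable fun ξ => ‖ξ‖ * ‖g ξ‖) (x : Eucl d) :
    ‖fderiv ℝ (fun x => (𝓕 g x).re) x‖ₑ ≤
      ENNReal.ofReal (2 * Real.pi) * ∫⁻ ξ, ‖ξ‖ₑ * ‖g ξ‖ₑ := by
  rw [(hasFDerivAt_re_fourier hg hg' x).fderiv]
  have h1 : ‖Complex.reCLM.comp (𝓕 (VectorFourier.fourierSMulRight (innerSL ℝ) g) x)‖ ≤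
      ‖𝓕 (VectorFourier.fourierSMulRight (innerSL ℝ) g) x‖ := by
    refine (ContinuousLinearMap.opNorm_comp_le _ _).trans ?_
    simp
  refine (enorm_le_iff_norm_le.mpr h1).trans ((enorm_fourier_le _ x).trans (le_of_eq ?_))
  rw [← lintegral_const_mul' _ _ ENNReal.ofReal_ne_top]
  refine lintegral_congr fun ξ => ?_
  rw [← ofReal_norm, VectorFourier.norm_fourierSMulRight, innerSL_apply_norm, 
    ENNReal.ofReal_mul (by positivity), ENNReal.ofReal_mul (by positivity), ofReal_norm,
    ofReal_norm, mul_assoc]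

lemma norm_le_sum_abs_coord (v : Eucl d) : ‖v‖ ≤ ∑ i, ‖v i‖ := by
  conv_lhs => rw [← (EuclideanSpace.basisFun (Fin d) ℝ).sum_repr v]
  refine (norm_sum_le _ _).trans (le_of_eq ?_)
  simp [norm_smul]

lemma norm_le_sum_norm_single {F : Type*} [NormedAddCommGroup F] [NormedSpace ℝ F]
    (A : Eucl d →L[ℝ] F) : ‖A‖ ≤ ∑ i, ‖A (EuclideanSpace.single i 1)‖ := by
  refine A.opNorm_le_bound (Finset.sum_nonneg fun _ _ => norm_nonneg _) fun v => ?_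
  conv_lhs => rw [← (EuclideanSpace.basisFun (Fin d) ℝ).sum_repr v]
  rw [map_sum, Finset.sum_mul]
  refine (norm_sum_le _ _).trans (Finset.sum_le_sum fun i _ => ?_)
  rw [map_smul, norm_smul, mul_comm]
  simp only [EuclideanSpace.basisFun_repr, EuclideanSpace.basisFun_apply]
  gcongr
  exact PiLp.norm_apply_le v i

lemma eLpNorm_le_sum_of_norm_le {F : Type*} [NormedAddCommGroup F] {ι : Type*} [Fintype ι]
    {f : Eucl d → F} {g : ι → Eucl d → ℝ} (hg : ∀ i, AEStronglyMeasurable (g i))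
    (h : ∀ x, ‖f x‖ ≤ ∑ i, ‖g i x‖) : eLpNorm f 2 ≤ ∑ i, eLpNorm (g i) 2 := by
  have h1 : eLpNorm f 2 ≤ eLpNorm (∑ i, fun x => ‖g i x‖) 2 := by
    refine eLpNorm_mono fun x => ?_
    rw [Finset.sum_apply, Real.norm_of_nonneg (Finset.sum_nonneg fun _ _ => norm_nonneg _)]
    exact h x
  refine h1.trans ((eLpNorm_sum_le (fun i _ => (hg i).norm) (by norm_num)).trans (le_of_eq ?_))
  exact Finset.sum_congr rfl fun i _ => eLpNorm_norm _

lemma one_le_rpow_weight {r : ℝ} (hr : 0 ≤ r) (ξ : Eucl d) :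
    1 ≤ (1 + ‖ξ‖ ^ 2) ^ (r / 2) :=
  Real.one_le_rpow (by nlinarith [sq_nonneg ‖ξ‖]) (by linarith)

lemma pow_norm_le_weight {r : ℝ} (k : ℕ) (hr : k ≤ r) (ξ : Eucl d) :
    ‖ξ‖ ^ k ≤ (1 + ‖ξ‖ ^ 2) ^ (r / 2) := by
  have h1 : ‖ξ‖ ^ k ≤ (1 + ‖ξ‖ ^ 2) ^ ((k : ℝ) / 2) := by
    have : ‖ξ‖ ^ k = (‖ξ‖ ^ 2) ^ ((k : ℝ) / 2) := by
      rw [← Real.rpow_natCast_mul (norm_nonneg _), ← Real.rpow_natCast]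
      congr 1
      push_cast
      ring
    rw [this]
    exact Real.rpow_le_rpow (by positivity) (by linarith) (by positivity)
  exact h1.trans (Real.rpow_le_rpow_of_exponent_le (by nlinarith [sq_nonneg ‖ξ‖]) (by linarith))

lemma continuous_rpow_weight (r : ℝ) :
    Continuous fun ξ : Eucl d => (1 + ‖ξ‖ ^ 2) ^ (r / 2) :=
  (by fun_prop : Continuous fun ξ : Eucl d => 1 + ‖ξ‖ ^ 2).rpow_const
    fun ξ => Or.inl (by positivity)

/-- A real function in `L²` is the real part of the Fourier transform of the function `g`
whose weighted `L²` norms are its Sobolev norms. -/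
lemma exists_fourier_data {f : Eucl d → ℝ} (hf : MemLp (fun x => (f x : ℂ)) 2) :
    ∃ g : Eucl d → ℂ, MemLp g 2 ∧
      (∀ r, eLpNorm (fun ξ => (((1 + ‖ξ‖ ^ 2) ^ (r / 2) : ℝ) : ℂ) * g ξ) 2 = sobolevENorm r f) ∧
      (Integrable g → f =ᵐ[volume] fun x => (𝓕 g x).re) := by
  set v : Lp ℂ 2 (volume : Measure (Eucl d)) := 𝓕 (hf.toLp _) with hv
  have hmp : MeasurePreserving (fun x : Eucl d => -x) volume volume :=
    Measure.measurePreserving_neg volume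
  -- The reflection of the transform makes `f` a forward transform of `g`, the form in which the
  -- differentiation lemmas apply; the weights are even, so the Sobolev norms are unaffected.
  refine ⟨fun ξ => v (-ξ), (Lp.memLp v).comp_measurePreserving hmp, fun r => ?_, fun hg => ?_⟩
  · rw [sobolevENorm, dif_pos hf]
    have hm : AEStronglyMeasurable (fun ξ : Eucl d =>
        (((1 + ‖ξ‖ ^ 2) ^ (r / 2) : ℝ) : ℂ) * v ξ) :=
      (Complex.continuous_ofReal.comp (continuous_rpow_weight r)).aestronglyMeasurable.mul
        (Lp.memLp v).1
    rw [← eLpNorm_comp_measurePreserving hm hmp]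
    simp [Function.comp_def]
  · have hvi : Integrable v := by simpa using hg.comp_neg
    have h1 := coeFn_fourierInv_ae_eq v hvi
    rw [hv, FourierTransform.fourierInv_fourier_eq] at h1
    have h2 : 𝓕⁻ (v : Eucl d → ℂ) = 𝓕 fun ξ => v (-ξ) :=
      Real.fourierInv_eq_fourier_comp_neg _
    filter_upwards [h1, hf.coeFn_toLp] with x hx hx'
    rw [← h2, ← hx, hx', Complex.ofReal_re]

/-- The Cauchy–Schwarz step of the Sobolev embedding. -/
lemma exists_lintegral_le_weighted (k : ℕ) {r : ℝ} (hr : (d : ℝ) / 2 < r - k) :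
    ∃ K : NNReal, ∀ g : Eucl d → ℂ, AEStronglyMeasurable g →
      ∫⁻ ξ, ‖ξ‖ₑ ^ k * ‖g ξ‖ₑ ≤
        K * eLpNorm (fun ξ => (((1 + ‖ξ‖ ^ 2) ^ (r / 2) : ℝ) : ℂ) * g ξ) 2 := by
  -- Its square is (1 + |ξ|²) to the power −(r − k), integrable because 2(r − k) > d. This weight is
  -- the second Hölder factor, so its L² norm is the constant.
  have hmem : MemLp (fun ξ : Eucl d => (1 + ‖ξ‖ ^ 2) ^ ((k - r) / 2)) 2 := by
    refine (memLp_two_iff_integrable_sq (continuous_rpow_weight _).aestronglyMeasurable).mpr ?_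
    have := integrable_rpow_neg_one_add_norm_sq (E := Eucl d)
      (μ := (volume : Measure (Eucl d))) (r := 2 * (r - k)) (by simp; linarith)
    refine this.congr (Filter.Eventually.of_forall fun ξ => ?_)
    simp only
    rw [← Real.rpow_mul_natCast (by positivity)]
    congr 1
    push_cast
    ring
  refine ⟨(eLpNorm (fun ξ : Eucl d => (1 + ‖ξ‖ ^ 2) ^ ((k - r) / 2)) 2).toNNReal,
    fun g hg => ?_⟩
  rw [ENNReal.coe_toNNReal hmem.2.ne]
  have hm : AEStronglyMeasurable (fun ξ : Eucl d =>
      (((1 + ‖ξ‖ ^ 2) ^ (r / 2) : ℝ) : ℂ) * g ξ) :=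
    (Complex.continuous_ofReal.comp (continuous_rpow_weight r)).aestronglyMeasurable.mul hg
  have holder := eLpNorm_smul_le_mul_eLpNorm (p := 2) (q := 2) (r := 1) hm hmem.1
  refine le_trans ?_ holder
  rw [eLpNorm_one_eq_lintegral_enorm]
  refine lintegral_mono fun ξ => ?_
  rw [← ofReal_norm, ← ofReal_norm, ← ofReal_norm, ← ENNReal.ofReal_pow (norm_nonneg _),
    ← ENNReal.ofReal_mul (by positivity)]
  refine ENNReal.ofReal_le_ofReal ?_
  have hpos : 0 < 1 + ‖ξ‖ ^ 2 := by positivity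
  simp only [Pi.smul_apply', norm_smul, norm_mul, Complex.norm_real]
  rw [Real.norm_of_nonneg (by positivity), Real.norm_of_nonneg (by positivity), ← mul_assoc,
    ← Real.rpow_add hpos]
  gcongr
  refine (pow_norm_le_weight k le_rfl ξ).trans (le_of_eq ?_)
  congr 1
  ring

/-- `h` is a `C²` representative of `f`, bounded with its gradient by `B`, with derivatives up to
order two in `L²`. -/
structure IsRegularRep (B : ℝ) (f h : Eucl d → ℝ) : Prop where
  ae_eq : f =ᵐ[volume] h
  contDiff : ContDiff ℝ 2 h
  memLp : MemLp h 2
  memLp_gradient : MemLp (gradient h) 2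
  memLp_hessian : MemLp (fderiv ℝ (gradient h)) 2
  abs_le : ∀ x, |h x| ≤ B
  norm_gradient_le : ∀ x, ‖gradient h x‖ ≤ B

lemma integrable_pow_mul_of_lintegral_lt_top {g : Eucl d → ℂ} (hg : AEStronglyMeasurable g)
    (k : ℕ) (h : ∫⁻ ξ, ‖ξ‖ₑ ^ k * ‖g ξ‖ₑ < ⊤) : Integrable fun ξ => ‖ξ‖ ^ k * ‖g ξ‖ := by
  refine ⟨(by fun_prop : Continuous fun ξ : Eucl d => ‖ξ‖ ^ k).aestronglyMeasurable.mul hg.norm,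
    ?_⟩
  rw [HasFiniteIntegral]
  simpa using h

lemma eLpNorm_const_mul_le {g g' : Eucl d → ℂ} {c : ℝ}
    (h : ∀ ξ, ‖g ξ‖ ≤ c * ‖g' ξ‖) : eLpNorm g 2 ≤ ENNReal.ofReal c * eLpNorm g' 2 :=
  eLpNorm_le_mul_eLpNorm_of_ae_le_mul (Filter.Eventually.of_forall h) 2

/-- Each derivative costs one moment of `g`; two moments therefore suffice for second derivatives.
-/
lemma integrable_mul_norm_derivSymbol {g : Eucl d → ℂ} (hg : AEStronglyMeasurable g) (k : ℕ)
    (y : Eucl d) (h : Integrable fun ξ => ‖ξ‖ ^ (k + 1) * ‖g ξ‖) :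
    Integrable fun ξ => ‖ξ‖ ^ k * ‖derivSymbol y g ξ‖ := by
  refine (h.const_mul (2 * Real.pi * ‖y‖)).mono'
    ((by fun_prop : Continuous fun ξ : Eucl d => ‖ξ‖ ^ k).aestronglyMeasurable.mul
      (aestronglyMeasurable_derivSymbol y hg).norm) (Filter.Eventually.of_forall fun ξ => ?_)
  rw [Real.norm_of_nonneg (by positivity)]
  calc ‖ξ‖ ^ k * ‖derivSymbol y g ξ‖
      ≤ ‖ξ‖ ^ k * (2 * Real.pi * ‖y‖ * (‖ξ‖ * ‖g ξ‖)) := by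
        gcongr
        exact norm_derivSymbol_le y g ξ
    _ = _ := by ring

lemma memLp_re_fourier {g : Eucl d → ℂ} (hg : Integrable g) (hg2 : MemLp g 2) :
    MemLp (fun x => (𝓕 g x).re) 2 ∧ eLpNorm (fun x => (𝓕 g x).re) 2 ≤ eLpNorm g 2 := by
  obtain ⟨h1, h2⟩ := eLpNorm_fourier_eq hg hg2
  exact ⟨h1.re, h2 ▸ eLpNorm_mono fun x => Complex.abs_re_le_norm _⟩

/-- Sobolev embedding: for `s > d/2 + 1`, a function of finite `H^{s+1}` norm has a `C²`
representative which is bounded together with its gradient by its `H^s` norm. -/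
theorem exists_isRegularRep {s : ℝ} (hs : (d : ℝ) / 2 + 1 < s) :
    ∃ K : NNReal, ∀ (M : ℝ) (f : Eucl d → ℝ), 0 ≤ M → sobolevENorm s f ≤ ENNReal.ofReal M →
      sobolevENorm (s + 1) f < ⊤ →
      ∃ h, IsRegularRep (K * M) f h ∧ eLpNorm h 2 ≤ ENNReal.ofReal M ∧
        eLpNorm (gradient h) 2 ≤ ENNReal.ofReal (K * M) ∧
        eLpNorm (fderiv ℝ (gradient h)) 2 ≤ K * sobolevENorm (s + 1) f := by
  have hd : (0 : ℝ) ≤ d := Nat.cast_nonneg d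
  obtain ⟨K0, hK0⟩ := exists_lintegral_le_weighted (d := d) 0 (r := s) (by simp; linarith)
  obtain ⟨K1, hK1⟩ := exists_lintegral_le_weighted (d := d) 1 (r := s) (by simp; linarith)
  obtain ⟨K2, hK2⟩ := exists_lintegral_le_weighted (d := d) 2 (r := s + 1) (by simp; linarith)
  have hpi := Real.pi_pos
  set p : NNReal := Real.toNNReal (2 * Real.pi) with hp
  have hp' : ENNReal.ofReal (2 * Real.pi) = p := rfl
  -- The four summands serve in turn for the sup of the function, the sup of its gradient, and the
  -- L² norms of gradient and Hessian; `p` is the factor 2π of each derivative, and `d`, `d * d`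
  -- count the entries.
  refine ⟨K0 + p * K1 + d * p + d * d * (p * p), fun M f hM hfs hfs1 => ?_⟩
  have hf : MemLp (fun x => (f x : ℂ)) 2 := by
    by_contra hf
    rw [sobolevENorm, dif_neg hf] at hfs1
    exact lt_irrefl _ hfs1
  obtain ⟨g, hg2, hN, hrep⟩ := exists_fourier_data hf
  have hgm := hg2.1
  have I0 : ∫⁻ ξ, ‖g ξ‖ₑ ≤ K0 * ENNReal.ofReal M := by
    have := hK0 g hgm
    rw [hN] at this
    simpa using this.trans (by gcongr)
  have I1 : ∫⁻ ξ, ‖ξ‖ₑ * ‖g ξ‖ₑ ≤ K1 * ENNReal.ofReal M := by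
    have := hK1 g hgm
    rw [hN] at this
    simpa using this.trans (by gcongr)
  have I2 : ∫⁻ ξ, ‖ξ‖ₑ ^ 2 * ‖g ξ‖ₑ < ⊤ := by
    have := hK2 g hgm
    rw [hN] at this
    exact this.trans_lt (ENNReal.mul_lt_top ENNReal.coe_lt_top hfs1)
  have hgi : Integrable g := ⟨hgm, I0.trans_lt (by finiteness)⟩
  have hgi1 : Integrable fun ξ => ‖ξ‖ * ‖g ξ‖ := by
    simpa using integrable_pow_mul_of_lintegral_lt_top hgm 1
      (by simpa using I1.trans_lt (by finiteness))
  have hgi2 : Integrable fun ξ => ‖ξ‖ ^ 2 * ‖g ξ‖ :=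
    integrable_pow_mul_of_lintegral_lt_top hgm 2 I2
  set h : Eucl d → ℝ := fun x => (𝓕 g x).re with hh
  have hC2 : ContDiff ℝ 2 h := by
    refine Complex.reCLM.contDiff.comp (Real.contDiff_fourier (N := 2) fun n hn => ?_)
    have hn' : n ≤ 2 := by exact_mod_cast hn
    interval_cases n
    · simpa using hgi.norm
    · simpa using hgi1
    · exact hgi2
  -- the partial derivatives
  let e : Fin d → Eucl d := fun i => EuclideanSpace.single i 1
  have he : ∀ i, ‖e i‖ = 1 := fun i => by simp [e]
  have D1 : ∀ i, (fun x => gradient h x i) = fun x => (𝓕 (derivSymbol (e i) g) x).re := fun i => by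
    ext x
    rw [gradient_apply]
    exact fderiv_re_fourier_apply hgi hgi1 x (e i)
  have J0 : ∀ i, Integrable (derivSymbol (e i) g) := fun i => by
    have := integrable_mul_norm_derivSymbol hgm 0 (e i) (by simpa using hgi1)
    simp only [pow_zero, one_mul] at this
    exact (integrable_norm_iff (aestronglyMeasurable_derivSymbol _ hgm)).mp this
  have J1 : ∀ i, Integrable fun ξ => ‖ξ‖ * ‖derivSymbol (e i) g ξ‖ := fun i => by
    simpa using integrable_mul_norm_derivSymbol hgm 1 (e i) (by simpa using hgi2)
  have L0 : ∀ i j, Integrable (derivSymbol (e j) (derivSymbol (e i) g)) := fun i j => by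
    have := integrable_mul_norm_derivSymbol (aestronglyMeasurable_derivSymbol (e i) hgm) 0 (e j)
      (by simpa using J1 i)
    simp only [pow_zero, one_mul] at this
    exact (integrable_norm_iff
      (aestronglyMeasurable_derivSymbol _ (aestronglyMeasurable_derivSymbol _ hgm))).mp this
  have hgrad : ContDiff ℝ 1 (gradient h) := contDiff_gradient hC2 (by norm_num)
  have D2 : ∀ i j, (fun x => (fderiv ℝ (gradient h) x (e j)) i) =
      fun x => (𝓕 (derivSymbol (e j) (derivSymbol (e i) g)) x).re := fun i j => by
    ext x
    rw [← fderiv_apply_coord (hgrad.differentiable (by norm_num) x), D1 i]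
    exact fderiv_re_fourier_apply (J0 i) (J1 i) x (e j)
  -- their `L²` norms
  have N1 : ∀ i, eLpNorm (derivSymbol (e i) g) 2 ≤ p * sobolevENorm s f := fun i => by
    rw [← hN s, ← hp']
    refine eLpNorm_const_mul_le fun ξ => ?_
    refine (norm_derivSymbol_le _ _ _).trans ?_
    rw [he, mul_one, norm_mul, Complex.norm_real, Real.norm_of_nonneg (by positivity)]
    have := pow_norm_le_weight (r := s) 1 (by simp; linarith) ξ
    rw [pow_one] at this
    gcongr
  have N2 : ∀ i j, eLpNorm (derivSymbol (e j) (derivSymbol (e i) g)) 2 ≤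
      p * p * sobolevENorm (s + 1) f := fun i j => by
    rw [← hN (s + 1), ← hp', ← ENNReal.ofReal_mul (by positivity)]
    refine eLpNorm_const_mul_le fun ξ => ?_
    refine (norm_derivSymbol_le _ _ _).trans ?_
    rw [he, mul_one, norm_mul, Complex.norm_real, Real.norm_of_nonneg (by positivity)]
    have h1 := norm_derivSymbol_le (e i) g ξ
    rw [he, mul_one] at h1
    have := pow_norm_le_weight (r := s + 1) 2 (by push_cast; linarith) ξ
    calc 2 * Real.pi * (‖ξ‖ * ‖derivSymbol (e i) g ξ‖)
        ≤ 2 * Real.pi * (‖ξ‖ * (2 * Real.pi * (‖ξ‖ * ‖g ξ‖))) := by gcongr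
      _ = 2 * Real.pi * (2 * Real.pi) * (‖ξ‖ ^ 2 * ‖g ξ‖) := by ring
      _ ≤ _ := by gcongr
  have hNs : sobolevENorm s f < ⊤ := hfs.trans_lt ENNReal.ofReal_lt_top
  have R1 := fun i => memLp_re_fourier (J0 i) ⟨aestronglyMeasurable_derivSymbol _ hgm,
    (N1 i).trans_lt (by finiteness)⟩
  have R2 := fun i j => memLp_re_fourier (L0 i j)
    ⟨(aestronglyMeasurable_derivSymbol _ (aestronglyMeasurable_derivSymbol _ hgm)),
      (N2 i j).trans_lt (by finiteness)⟩
  have G2 : eLpNorm (gradient h) 2 ≤ d * (p * sobolevENorm s f) := by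
    refine (eLpNorm_le_sum_of_norm_le (g := fun i x => gradient h x i) (fun i => ?_)
      fun x => norm_le_sum_abs_coord _).trans ?_
    · rw [D1 i]
      exact (R1 i).1.1
    · refine (Finset.sum_le_sum fun i _ => ?_ : _ ≤ ∑ i : Fin d, p * sobolevENorm s f).trans ?_
      · rw [D1 i]
        exact (R1 i).2.trans (N1 i)
      · simp
  have H2 : eLpNorm (fderiv ℝ (gradient h)) 2 ≤ d * d * (p * p) * sobolevENorm (s + 1) f := by
    refine (eLpNorm_le_sum_of_norm_le
      (g := fun (q : Fin d × Fin d) x => (fderiv ℝ (gradient h) x (e q.2)) q.1) (fun q => ?_)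
      fun x => ?_).trans ?_
    · rw [D2 q.1 q.2]
      exact (R2 _ _).1.1
    · refine (norm_le_sum_norm_single _).trans ?_
      rw [Fintype.sum_prod_type_right]
      exact Finset.sum_le_sum fun j _ => norm_le_sum_abs_coord _
    · refine (Finset.sum_le_sum fun q _ => ?_ :
        _ ≤ ∑ q : Fin d × Fin d, p * p * sobolevENorm (s + 1) f).trans ?_
      · rw [D2 q.1 q.2]
        exact (R2 _ _).2.trans (N2 _ _)
      · simp [mul_assoc]
  have hM' : ENNReal.ofReal M < ⊤ := ENNReal.ofReal_lt_top
  have hKM : ∀ L : NNReal, ENNReal.ofReal (L * M) = L * ENNReal.ofReal M := fun L => by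
    rw [ENNReal.ofReal_mul (NNReal.coe_nonneg L), ENNReal.ofReal_coe_nnreal]
  set K : NNReal := K0 + p * K1 + d * p + d * d * (p * p) with hK
  have le0 : K0 ≤ K := by rw [hK]; exact le_add_right (le_add_right (le_add_right le_rfl))
  have le1 : p * K1 ≤ K := by rw [hK]; exact le_add_right (le_add_right (le_add_left le_rfl))
  have le2 : d * p ≤ K := by rw [hK]; exact le_add_right (le_add_left le_rfl)
  have le3 : d * d * (p * p) ≤ K := by rw [hK]; exact le_add_left le_rfl
  have hmemh := memLp_re_fourier hgi hg2
  refine ⟨h, ⟨hrep hgi, hC2, hmemh.1, ⟨hgrad.continuous.aestronglyMeasurable,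
    G2.trans_lt (by finiteness)⟩,
    ⟨(hgrad.continuous_fderiv (by norm_num)).aestronglyMeasurable, H2.trans_lt (by finiteness)⟩,
    fun x => ?_, fun x => ?_⟩, ?_, ?_, ?_⟩
  · rw [← Real.norm_eq_abs, ← ENNReal.ofReal_le_ofReal_iff (by positivity), ofReal_norm, hKM]
    refine (enorm_le_iff_norm_le.mpr (Complex.abs_re_le_norm (𝓕 g x))).trans
      ((enorm_fourier_le g x).trans (I0.trans ?_))
    gcongr
  · rw [norm_gradient, ← ENNReal.ofReal_le_ofReal_iff (by positivity), ofReal_norm, hKM]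
    refine (enorm_fderiv_re_fourier_le hgi hgi1 x).trans ?_
    calc ENNReal.ofReal (2 * Real.pi) * ∫⁻ ξ, ‖ξ‖ₑ * ‖g ξ‖ₑ
        ≤ p * (K1 * ENNReal.ofReal M) := by rw [hp']; gcongr
      _ = ((p * K1 : NNReal) : ℝ≥0∞) * ENNReal.ofReal M := by push_cast; ring
      _ ≤ _ := by gcongr
  · refine hmemh.2.trans (le_trans ?_ hfs)
    rw [← hN s]
    refine eLpNorm_mono fun ξ => ?_
    rw [norm_mul, Complex.norm_real, Real.norm_of_nonneg (by positivity)]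
    exact le_mul_of_one_le_left (norm_nonneg _) (one_le_rpow_weight (by linarith) ξ)
  · rw [hKM]
    refine G2.trans ?_
    calc (d : ℝ≥0∞) * (p * sobolevENorm s f)
        ≤ d * (p * ENNReal.ofReal M) := by gcongr
      _ = ((d * p : NNReal) : ℝ≥0∞) * ENNReal.ofReal M := by push_cast; ring
      _ ≤ _ := by gcongr
  · refine H2.trans ?_
    have : ((d * d * (p * p) : NNReal) : ℝ≥0∞) ≤ K := by exact_mod_cast le3
    push_cast at this
    gcongr

/-! ### The nonlocal velocity and its distance from the local one. -/

lemma convolution_congr_ae_left {F F' : Type*} [NormedAddCommGroup F] [NormedSpace ℝ F]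
    [NormedAddCommGroup F'] [NormedSpace ℝ F'] (L : ℝ →L[ℝ] F →L[ℝ] F') {f h : Eucl d → ℝ}
    (hf : f =ᵐ[volume] h) (w : Eucl d → F) (x : Eucl d) :
    convolution f w L volume x = convolution h w L volume x := by
  refine integral_congr_ae ?_
  filter_upwards [hf] with y hy
  rw [hy]

/-- Young's inequality for the convolution with a continuous integrable kernel. -/
lemma eLpNorm_le_of_convolution {F F' : Type*} [NormedAddCommGroup F] [NormedSpace ℝ F]
    [NormedAddCommGroup F'] [NormedSpace ℝ F'] (L : ℝ →L[ℝ] F →L[ℝ] F') (hL : ‖L‖ ≤ 1)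
    {h : Eucl d → ℝ} (hh : Continuous h) {w : Eucl d → F} (hw : Continuous w) :
    eLpNorm (convolution h w L volume) 2 ≤ (∫⁻ z, ‖w z‖ₑ) * eLpNorm h 2 := by
  have := eLpNorm_two_le_of_average (volume.withDensity fun z => ‖w z‖ₑ) (y := fun z : Eucl d => z)
    measurable_id hh (P := convolution h w L volume) fun x => ?_
  · simpa using this
  · rw [lintegral_withDensity_eq_lintegral_mul _ hw.enorm.measurable
      (by exact (hh.comp (by fun_prop)).enorm.measurable), convolution_eq_swap]
    refine (enorm_integral_le_lintegral_enorm _).trans (lintegral_mono fun z => ?_)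
    rw [Pi.mul_apply, mul_comm, ← ofReal_norm, ← ofReal_norm, ← ofReal_norm,
      ← ENNReal.ofReal_mul (norm_nonneg _)]
    refine ENNReal.ofReal_le_ofReal ((L.le_opNorm₂ _ _).trans ?_)
    calc ‖L‖ * ‖h (x - z)‖ * ‖w z‖ ≤ 1 * ‖h (x - z)‖ * ‖w z‖ := by gcongr
      _ = _ := by ring

/-- The velocity field `∇W * h` of the non-local problem. -/
abbrev velocity (W h : Eucl d → ℝ) : Eucl d → Eucl d :=
  convolution h (gradient W) (ContinuousLinearMap.lsmul ℝ ℝ) volume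

lemma contDiff_velocity {W h : Eucl d → ℝ} (hW : ContDiff ℝ 2 W) (hc : HasCompactSupport W)
    (hh : Continuous h) : ContDiff ℝ 1 (velocity W h) :=
  (hasCompactSupport_gradient hc).contDiff_convolution_right _ hh.locallyIntegrable
    (contDiff_gradient hW (by norm_num))

lemma norm_lsmul_le : ‖(ContinuousLinearMap.lsmul ℝ ℝ : ℝ →L[ℝ] Eucl d →L[ℝ] Eucl d)‖ ≤ 1 :=
  ContinuousLinearMap.opNorm_lsmul_le

lemma eLpNorm_velocity_le {W h : Eucl d → ℝ} (hW : ContDiff ℝ 2 W) (hh : Continuous h) :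
    eLpNorm (velocity W h) 2 ≤ (∫⁻ z, ‖gradient W z‖ₑ) * eLpNorm h 2 :=
  eLpNorm_le_of_convolution _ norm_lsmul_le hh (continuous_gradient (hW.of_le (by norm_num)))

lemma eLpNorm_fderiv_velocity_le {W h : Eucl d → ℝ} (hW : ContDiff ℝ 2 W)
    (hc : HasCompactSupport W) (hh : Continuous h) :
    eLpNorm (fderiv ℝ (velocity W h)) 2 ≤
      (∫⁻ z, ‖fderiv ℝ (gradient W) z‖ₑ) * eLpNorm h 2 := by
  have hg : ContDiff ℝ 1 (gradient W) := contDiff_gradient hW (by norm_num)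
  have : fderiv ℝ (velocity W h) = convolution h (fderiv ℝ (gradient W))
      (ContinuousLinearMap.precompR (Eucl d) (ContinuousLinearMap.lsmul ℝ ℝ)) volume := by
    ext1 x
    exact ((hasCompactSupport_gradient hc).hasFDerivAt_convolution_right _ hh.locallyIntegrable
      hg x).fderiv
  rw [this]
  refine eLpNorm_le_of_convolution _ ?_ hh (hg.continuous_fderiv (by norm_num))
  exact (ContinuousLinearMap.norm_precompR_le _ _).trans norm_lsmul_le

lemma lintegral_enorm_lt_top_of_compactSupport {F : Type*} [NormedAddCommGroup F]
    {w : Eucl d → F} (hw : Continuous w) (hc : HasCompactSupport w) : ∫⁻ z, ‖w z‖ₑ < ⊤ :=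
  (hw.integrable_of_hasCompactSupport hc).2

lemma memLp_velocity {W h : Eucl d → ℝ} (hW : ContDiff ℝ 2 W) (hc : HasCompactSupport W)
    (hh : Continuous h) (hh2 : MemLp h 2) : MemLp (velocity W h) 2 :=
  ⟨(contDiff_velocity hW hc hh).continuous.aestronglyMeasurable,
    (eLpNorm_velocity_le hW hh).trans_lt (ENNReal.mul_lt_top
      (lintegral_enorm_lt_top_of_compactSupport (continuous_gradient (hW.of_le (by norm_num)))
        (hasCompactSupport_gradient hc)) hh2.2)⟩

lemma lintegral_enorm_hessian_lt_top {W : Eucl d → ℝ} (hW : ContDiff ℝ 2 W)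
    (hc : HasCompactSupport W) : ∫⁻ z, ‖fderiv ℝ (gradient W) z‖ₑ < ⊤ :=
  lintegral_enorm_lt_top_of_compactSupport
    ((contDiff_gradient (m := 1) hW (by norm_num)).continuous_fderiv (by norm_num))
    ((hasCompactSupport_gradient hc).fderiv ℝ)

lemma memLp_fderiv_velocity {W h : Eucl d → ℝ} (hW : ContDiff ℝ 2 W) (hc : HasCompactSupport W)
    (hh : Continuous h) (hh2 : MemLp h 2) : MemLp (fderiv ℝ (velocity W h)) 2 :=
  ⟨((contDiff_velocity hW hc hh).continuous_fderiv (by norm_num)).aestronglyMeasurable,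
    (eLpNorm_fderiv_velocity_le hW hc hh).trans_lt
      (ENNReal.mul_lt_top (lintegral_enorm_hessian_lt_top hW hc) hh2.2)⟩

/-- Integration by parts moves the derivative from the potential, whose gradient grows as ε → 0, to
the function. The sign from the reflection y ↦ x − y cancels the one from the integration by parts.
-/
lemma velocity_eq_integral {W h : Eucl d → ℝ} (hW : ContDiff ℝ 1 W) (hc : HasCompactSupport W)
    (hh : ContDiff ℝ 1 h) (x : Eucl d) : velocity W h x = ∫ z, W z • gradient h (x - z) := by
  have hφ : ContDiff ℝ 1 fun y => W (x - y) := hW.comp (contDiff_const.sub contDiff_id)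
  have hcφ : HasCompactSupport fun y => W (x - y) :=
    hc.comp_homeomorph (Homeomorph.subLeft x)
  have hg : ∀ y, gradient (fun y => W (x - y)) y = -gradient W (x - y) := fun y => by
    ext i
    rw [PiLp.neg_apply, gradient_apply, gradient_apply]
    have : HasFDerivAt (fun y => W (x - y)) ((fderiv ℝ W (x - y)).comp
        (-ContinuousLinearMap.id ℝ (Eucl d))) y :=
      (hW.differentiable (by norm_num) (x - y)).hasFDerivAt.comp y
        ((hasFDerivAt_id y).const_sub x)
    rw [this.fderiv]
    simp
  have key := integral_smul_gradient_eq_neg hh hφ hcφ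
  simp only [hg, smul_neg, integral_neg, neg_inj] at key
  rw [← integral_sub_left_eq_self (fun z => W z • gradient h (x - z)) volume x]
  simp only [sub_sub_cancel]
  exact key

/-- The integral over the segment is kept instead of a supremum, since the Hessian it is applied to
is controlled only in L². -/
lemma enorm_sub_le_lintegral_fderiv {G : Eucl d → Eucl d} (hG : ContDiff ℝ 1 G) (x z : Eucl d) :
    ‖G (x - z) - G x‖ₑ ≤ ∫⁻ r in Ioc (0 : ℝ) 1, ‖fderiv ℝ G (x - r • z)‖ₑ * ‖z‖ₑ := by
  have hd : ∀ r : ℝ, HasDerivAt (fun r : ℝ => G (x - r • z)) (fderiv ℝ G (x - r • z) (-z)) r :=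
    fun r => by
      have h1 : HasDerivAt (fun r : ℝ => x - r • z) (-z) r := by
        simpa using ((hasDerivAt_id r).smul_const z).const_sub x
      exact (hG.differentiable (by norm_num) _).hasFDerivAt.comp_hasDerivAt r h1
  have hcont : Continuous fun r : ℝ => fderiv ℝ G (x - r • z) (-z) :=
    ((hG.continuous_fderiv (by norm_num)).comp (by fun_prop)).clm_apply continuous_const
  have := intervalIntegral.integral_eq_sub_of_hasDerivAt (a := 0) (b := 1)
    (fun r _ => hd r) (hcont.intervalIntegrable _ _)
  simp only [one_smul, zero_smul, sub_zero] at this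
  rw [← this, intervalIntegral.integral_of_le zero_le_one]
  refine (enorm_integral_le_lintegral_enorm _).trans (lintegral_mono fun r => ?_)
  rw [← enorm_neg z]
  exact (fderiv ℝ G (x - r • z)).le_opENorm _

/-- The velocity `∇W * h` is close to `c ∇h` if `W ≥ 0` has integral `c` and small support. -/
lemma eLpNorm_velocity_sub_le {W h : Eucl d → ℝ} {c ε : ℝ} (hW : ContDiff ℝ 1 W)
    (hW0 : ∀ x, 0 ≤ W x) (hsupp : tsupport W ⊆ Metric.closedBall 0 ε) (hint : ∫ x, W x = c)
    (hh : ContDiff ℝ 2 h) :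
    eLpNorm (fun x => velocity W h x - c • gradient h x) 2 ≤
      ENNReal.ofReal (c * ε) * eLpNorm (fderiv ℝ (gradient h)) 2 := by
  have hc : HasCompactSupport W := HasCompactSupport.of_support_subset_isCompact
    (isCompact_closedBall 0 ε) ((subset_tsupport W).trans hsupp)
  have hG : ContDiff ℝ 1 (gradient h) := contDiff_gradient hh (by norm_num)
  have hWi : Integrable W := hW.continuous.integrable_of_hasCompactSupport hc
  have hWl : ∫⁻ z, ENNReal.ofReal (W z) = ENNReal.ofReal c := by
    rw [← hint, ofReal_integral_eq_lintegral_ofReal hWi (Filter.Eventually.of_forall hW0)]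
  have hmW : Measurable fun z => ENNReal.ofReal (W z) := hW.continuous.measurable.ennreal_ofReal
  -- The density carries the factor ε that bounds ‖z‖ on the support of `W`, so the total mass c·ε
  -- is the constant of the estimate. The product with the unit interval below parametrizes the
  -- points x − r z of the mean value formula.
  let μ : Measure (Eucl d) := volume.withDensity fun z => ENNReal.ofReal (W z) * ENNReal.ofReal ε
  have hμ : μ univ = ENNReal.ofReal (c * ε) := by
    simp only [μ, withDensity_apply _ MeasurableSet.univ, Measure.restrict_univ]
    rw [lintegral_mul_const _ hmW, hWl, ENNReal.ofReal_mul]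
    rw [← hint]
    exact integral_nonneg hW0
  let ν : Measure (Eucl d × ℝ) := μ.prod (volume.restrict (Ioc (0 : ℝ) 1))
  have hν : ν univ = ENNReal.ofReal (c * ε) := by
    simp only [ν, ← univ_prod_univ, Measure.prod_prod, hμ]
    simp
  have hDc : Continuous (fderiv ℝ (gradient h)) := hG.continuous_fderiv (by norm_num)
  have := eLpNorm_two_le_of_average ν (y := fun p : Eucl d × ℝ => p.2 • p.1) (by fun_prop) hDc
    (P := fun x => velocity W h x - c • gradient h x) fun x => ?_
  · rwa [hν] at this
  · have hm1 : Measurable fun p : Eucl d × ℝ => ‖fderiv ℝ (gradient h) (x - p.2 • p.1)‖ₑ :=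
      (hDc.comp (by fun_prop)).enorm.measurable
    rw [lintegral_prod _ hm1.aemeasurable,
      lintegral_withDensity_eq_lintegral_mul _ (hmW.mul_const _)
        (Measurable.lintegral_prod_right' hm1)]
    have i1 : Integrable fun z => W z • gradient h (x - z) :=
      (hW.continuous.smul (hG.continuous.comp (by fun_prop))).integrable_of_hasCompactSupport
        (hc.smul_right (f' := fun z => gradient h (x - z)))
    have i2 : Integrable fun z => W z • gradient h x := hWi.smul_const _
    have e : velocity W h x - c • gradient h x =
        ∫ z, W z • (gradient h (x - z) - gradient h x) := by
      simp only [smul_sub]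
      rw [integral_sub i1 i2, velocity_eq_integral hW hc (hh.of_le (by norm_num)),
        integral_smul_const, hint]
    rw [e]
    refine (enorm_integral_le_lintegral_enorm _).trans (lintegral_mono fun z => ?_)
    simp only [Pi.mul_apply]
    by_cases hz : z ∈ Metric.closedBall (0 : Eucl d) ε
    · have hz' : ‖z‖ₑ ≤ ENNReal.ofReal ε := by
        rw [← ofReal_norm]
        exact ENNReal.ofReal_le_ofReal (by simpa using hz)
      have hm2 : Measurable fun r : ℝ => ‖fderiv ℝ (gradient h) (x - r • z)‖ₑ :=
        (hDc.comp (by fun_prop)).enorm.measurable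
      rw [enorm_smul, Real.enorm_of_nonneg (hW0 z), mul_assoc]
      gcongr
      refine (enorm_sub_le_lintegral_fderiv hG x z).trans ?_
      rw [lintegral_mul_const _ hm2, mul_comm]
      gcongr
    · have : W z = 0 := image_eq_zero_of_notMem_tsupport fun h' => hz (hsupp h')
      simp [this]

section scaledPotential

variable {V : Eucl d → ℝ} {ε : ℝ}

lemma contDiff_scaledPotential (hV : ContDiff ℝ 2 V) : ContDiff ℝ 2 (scaledPotential V ε) :=
  contDiff_const.mul (hV.comp (contDiff_const_smul _))

lemma scaledPotential_nonneg (hε : 0 < ε) (hV : ∀ x, 0 ≤ V x) (x : Eucl d) :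
    0 ≤ scaledPotential V ε x :=
  mul_nonneg (by positivity) (hV _)

lemma tsupport_scaledPotential (hε : 0 < ε) (hV : tsupport V ⊆ Metric.closedBall 0 1) :
    tsupport (scaledPotential V ε) ⊆ Metric.closedBall 0 ε := by
  refine closure_minimal (fun x hx => ?_) Metric.isClosed_closedBall
  have h1 : V (ε⁻¹ • x) ≠ 0 := fun h0 => hx (by simp [scaledPotential, h0])
  have h2 := hV (subset_tsupport V h1)
  rw [mem_closedBall_zero_iff, norm_smul, norm_inv, Real.norm_of_nonneg hε.le,
    inv_mul_le_iff₀ hε, mul_one] at h2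
  simpa using h2

lemma integral_scaledPotential (hε : 0 < ε) : ∫ x, scaledPotential V ε x = ∫ x, V x := by
  unfold scaledPotential
  rw [integral_const_mul, Measure.integral_comp_inv_smul_of_nonneg _ _ hε.le]
  simp only [finrank_euclideanSpace, Fintype.card_fin, smul_eq_mul]
  rw [inv_mul_cancel_left₀ (by positivity)]

end scaledPotential

/-! ### Fluxes of regular slices and the inequalities at a fixed time. -/

/-- The flux `a ∇h - h P` with velocity field `P`. -/
def flux (a : ℝ) (h : Eucl d → ℝ) (P : Eucl d → Eucl d) (x : Eucl d) : Eucl d :=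
  a • gradient h x - h x • P x

lemma limitFlux_ae_eq (a b : ℝ) {f h : Eucl d → ℝ} (hf : f =ᵐ[volume] h) (hh : ContDiff ℝ 1 h) :
    limitFlux a b f =ᵐ[volume] flux a h fun x => (2 * b) • gradient h x := by
  filter_upwards [hf, weakGrad_ae_eq hf hh] with x hx hx'
  simp only [limitFlux, flux, hx, hx', smul_smul]
  rw [mul_comm (2 * b)]

lemma nonlocalFlux_ae_eq (a : ℝ) (W : Eucl d → ℝ) {f h : Eucl d → ℝ} (hf : f =ᵐ[volume] h)
    (hh : ContDiff ℝ 1 h) : nonlocalFlux a W f =ᵐ[volume] flux a h (velocity W h) := by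
  filter_upwards [hf, weakGrad_ae_eq hf hh] with x hx hx'
  simp only [nonlocalFlux, flux, hx, hx', velocity]
  rw [convolution_congr_ae_left _ hf]

lemma memLp_smul_of_bounded {F : Type*} [NormedAddCommGroup F] [NormedSpace ℝ F] {B : ℝ}
    {h : Eucl d → ℝ} (hh : Continuous h) (hB : ∀ x, |h x| ≤ B) {P : Eucl d → F}
    (hP : MemLp P 2) : MemLp (fun x => h x • P x) 2 :=
  hP.of_le_mul (hh.aestronglyMeasurable.smul hP.1) (c := B) (Filter.Eventually.of_forall fun x => by
    rw [norm_smul]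
    exact mul_le_mul_of_nonneg_right (hB x) (norm_nonneg _))

namespace IsRegularRep

variable {B a : ℝ} {f h : Eucl d → ℝ} {P : Eucl d → Eucl d}

lemma contDiff_gradient (hh : IsRegularRep B f h) : ContDiff ℝ 1 (gradient h) :=
  DiffusionAggregation.contDiff_gradient hh.contDiff (by norm_num)

lemma differentiable (hh : IsRegularRep B f h) : Differentiable ℝ h :=
  hh.contDiff.differentiable (by norm_num)

lemma contDiff_one (hh : IsRegularRep B f h) : ContDiff ℝ 1 h :=
  hh.contDiff.of_le (by norm_num)

lemma contDiff_flux (hh : IsRegularRep B f h) (hP : ContDiff ℝ 1 P) :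
    ContDiff ℝ 1 (flux a h P) :=
  ContDiff.sub (contDiff_const.fun_smul hh.contDiff_gradient) (hh.contDiff_one.fun_smul hP)

lemma memLp_flux (hh : IsRegularRep B f h) (hP : MemLp P 2) : MemLp (flux a h P) 2 :=
  (hh.memLp_gradient.const_smul a).sub
    (memLp_smul_of_bounded hh.contDiff.continuous hh.abs_le hP)

/-- In the product rule each term pairs one factor bounded by `B` (the function or its gradient)
with one factor in L², so the derivative of the quadratic flux stays in L². -/
lemma norm_fderiv_flux_le (ha : 0 ≤ a) (hh : IsRegularRep B f h) (hP : ContDiff ℝ 1 P)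
    (x : Eucl d) : ‖fderiv ℝ (flux a h P) x‖ ≤
      a * ‖fderiv ℝ (gradient h) x‖ + B * ‖fderiv ℝ P x‖ + B * ‖P x‖ := by
  have h1 := hh.contDiff_gradient.differentiable (by norm_num) x
  have h2 := hP.differentiable (by norm_num) x
  have hd : HasFDerivAt (flux a h P) (a • fderiv ℝ (gradient h) x -
      (h x • fderiv ℝ P x + (fderiv ℝ h x).smulRight (P x))) x :=
    (h1.hasFDerivAt.const_smul a).sub ((hh.differentiable x).hasFDerivAt.smul h2.hasFDerivAt)
  rw [hd.fderiv]
  have hg := hh.norm_gradient_le x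
  rw [norm_gradient] at hg
  have hb := hh.abs_le x
  refine (norm_sub_le _ _).trans ?_
  rw [norm_smul, Real.norm_of_nonneg ha, add_assoc]
  gcongr
  refine (norm_add_le _ _).trans ?_
  rw [norm_smul, ContinuousLinearMap.norm_smulRight_apply, Real.norm_eq_abs]
  gcongr

lemma eLpNorm_fderiv_flux_le (ha : 0 ≤ a) (hh : IsRegularRep B f h) (hP : ContDiff ℝ 1 P) :
    eLpNorm (fderiv ℝ (flux a h P)) 2 ≤ ENNReal.ofReal a * eLpNorm (fderiv ℝ (gradient h)) 2 +
      ENNReal.ofReal B * eLpNorm (fderiv ℝ P) 2 + ENNReal.ofReal B * eLpNorm P 2 := by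
  have hB : 0 ≤ B := (abs_nonneg _).trans (hh.abs_le 0)
  have m1 : AEStronglyMeasurable (fun x => a * ‖fderiv ℝ (gradient h) x‖) :=
    hh.memLp_hessian.1.norm.const_mul a
  have m2 : AEStronglyMeasurable (fun x => B * ‖fderiv ℝ P x‖) :=
    (hP.continuous_fderiv (by norm_num)).norm.aestronglyMeasurable.const_mul B
  have m3 : AEStronglyMeasurable (fun x => B * ‖P x‖) :=
    hP.continuous.norm.aestronglyMeasurable.const_mul B
  have key : ∀ {F : Type _} [NormedAddCommGroup F] (c : ℝ) (G : Eucl d → F), 0 ≤ c →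
      eLpNorm (fun x => c * ‖G x‖) 2 = ENNReal.ofReal c * eLpNorm G 2 := fun c G hc => by
    have := eLpNorm_const_smul c (fun x => ‖G x‖) 2 (volume : Measure (Eucl d))
    rw [eLpNorm_norm, Real.enorm_of_nonneg hc] at this
    exact this
  rw [← key a _ ha, ← key B _ hB, ← key B _ hB]
  refine (eLpNorm_mono_real (hh.norm_fderiv_flux_le ha hP)).trans ?_
  exact (eLpNorm_add_le (m1.add m2) m3 (by norm_num)).trans
    (by gcongr; exact eLpNorm_add_le m1 m2 (by norm_num))

lemma memLp_fderiv_flux (ha : 0 ≤ a) (hh : IsRegularRep B f h) (hP : ContDiff ℝ 1 P)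
    (hP2 : MemLp P 2) (hP' : MemLp (fderiv ℝ P) 2) : MemLp (fderiv ℝ (flux a h P)) 2 := by
  refine ⟨((hh.contDiff_flux hP).continuous_fderiv (by norm_num)).aestronglyMeasurable,
    (hh.eLpNorm_fderiv_flux_le ha hP).trans_lt ?_⟩
  have h1 := hh.memLp_hessian.2
  have h2 := hP2.2
  have h3 := hP'.2
  finiteness

lemma integral_mul_divergence_flux (ha : 0 ≤ a) (hh : IsRegularRep B f h) (hP : ContDiff ℝ 1 P)
    (hP2 : MemLp P 2) (hP' : MemLp (fderiv ℝ P) 2) {φ : Eucl d → ℝ} (hφ : Differentiable ℝ φ)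
    (hφ2 : MemLp φ 2) (hφ' : MemLp (gradient φ) 2) :
    ∫ x, φ x * divergence (flux a h P) x = -∫ x, inner ℝ (flux a h P x) (gradient φ x) :=
  integral_mul_divergence hφ ((hh.contDiff_flux hP).differentiable (by norm_num)) hφ2 hφ'
    (hh.memLp_flux hP2) (hh.memLp_fderiv_flux ha hP hP2 hP')

lemma contDiff_smul_gradient (hh : IsRegularRep B f h) (c : ℝ) :
    ContDiff ℝ 1 fun x => c • gradient h x := contDiff_const.fun_smul hh.contDiff_gradient

lemma memLp_smul_gradient (hh : IsRegularRep B f h) (c : ℝ) :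
    MemLp (fun x => c • gradient h x) 2 := hh.memLp_gradient.const_smul c

lemma fderiv_smul_gradient (hh : IsRegularRep B f h) (c : ℝ) :
    fderiv ℝ (fun x => c • gradient h x) = c • fderiv ℝ (gradient h) := by
  ext1 x
  exact fderiv_const_smul (hh.contDiff_gradient.differentiable (by norm_num) x) c

lemma memLp_fderiv_smul_gradient (hh : IsRegularRep B f h) (c : ℝ) :
    MemLp (fderiv ℝ fun x => c • gradient h x) 2 := by
  rw [hh.fderiv_smul_gradient]
  exact hh.memLp_hessian.const_smul c

end IsRegularRep

lemma gradient_sub {h k : Eucl d → ℝ} (hh : Differentiable ℝ h) (hk : Differentiable ℝ k) :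
    (gradient fun x => k x - h x) = fun x => gradient k x - gradient h x := by
  ext x i
  rw [PiLp.sub_apply, gradient_apply, gradient_apply, gradient_apply,
    fderiv_fun_sub (hk x) (hh x)]
  rfl

lemma gradient_comp_real {β : ℝ → ℝ} {h : Eucl d → ℝ} (hβ : Differentiable ℝ β)
    (hh : Differentiable ℝ h) :
    (gradient fun x => β (h x)) = fun x => deriv β (h x) • gradient h x := by
  ext x i
  have : HasFDerivAt (fun x => β (h x)) (deriv β (h x) • fderiv ℝ h x) x :=
    (hβ (h x)).hasDerivAt.comp_hasFDerivAt x (hh x).hasFDerivAt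
  rw [PiLp.smul_apply, gradient_apply, gradient_apply, this.fderiv]
  rfl

lemma integrable_norm_sq {F : Type*} [NormedAddCommGroup F] {f : Eucl d → F} (hf : MemLp f 2) :
    Integrable fun x => ‖f x‖ ^ 2 := hf.integrable_norm_pow two_ne_zero

/-- Monotone functions of the solution that only see values below `a/(2b)` are dissipated. -/
lemma integral_comp_mul_divergence_nonpos {a b B L : ℝ} (ha : 0 ≤ a) {f h : Eucl d → ℝ}
    (hh : IsRegularRep B f h) {β : ℝ → ℝ} (hβ : ContDiff ℝ 1 β)
    (hL : ∀ y, |deriv β y| ≤ L) (hβL : ∀ y, |β y| ≤ L * |y|)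
    (hsign : ∀ y, 0 ≤ deriv β y * (a - 2 * b * y)) :
    ∫ x, β (h x) * divergence (flux a h fun x => (2 * b) • gradient h x) x ≤ 0 := by
  have hβd := hβ.differentiable (by norm_num)
  have hg := gradient_comp_real hβd hh.differentiable
  have m1 : MemLp (fun x => β (h x)) 2 :=
    hh.memLp.of_le_mul (hβ.continuous.comp hh.contDiff.continuous).aestronglyMeasurable
      (Filter.Eventually.of_forall fun x => hβL (h x))
  have m2 : MemLp (gradient fun x => β (h x)) 2 := by
    rw [hg]
    exact memLp_smul_of_bounded ((hβ.continuous_deriv (by norm_num)).comp hh.contDiff.continuous)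
      (fun x => hL _) hh.memLp_gradient
  rw [hh.integral_mul_divergence_flux ha (hh.contDiff_smul_gradient _) (hh.memLp_smul_gradient _)
    (hh.memLp_fderiv_smul_gradient _) (φ := fun x => β (h x)) (hβd.comp hh.differentiable) m1 m2, neg_nonpos, hg]
  refine integral_nonneg fun x => ?_
  have : inner ℝ (flux a h (fun x => (2 * b) • gradient h x) x) (deriv β (h x) • gradient h x) =
      deriv β (h x) * (a - 2 * b * h x) * ‖gradient h x‖ ^ 2 := by
    simp only [flux, inner_sub_left, inner_smul_left, inner_smul_right, real_inner_self_eq_norm_sq,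
      conj_trivial]
    ring
  simp only [this]
  exact mul_nonneg (hsign _) (by positivity)

/-- The energy inequality for the difference of the two fluxes at a fixed time. -/
lemma integral_sub_mul_divergence_sub_le {a b B κ : ℝ} (ha : 0 < a) (hb : 0 < b)
    (hκ : 0 < a - 2 * b * κ) {f h g k : Eucl d → ℝ} (hh : IsRegularRep B f h)
    (hk : IsRegularRep B g k) (hhκ : ∀ x, h x ≤ κ) {P : Eucl d → Eucl d} (hP : ContDiff ℝ 1 P)
    (hP2 : MemLp P 2) (hP' : MemLp (fderiv ℝ P) 2) :
    ∫ x, (k x - h x) * (divergence (flux a k P) x -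
        divergence (flux a h fun x => (2 * b) • gradient h x) x) ≤
      -((a - 2 * b * κ) / 2) * (∫ x, ‖gradient k x - gradient h x‖ ^ 2) +
      B ^ 2 / (a - 2 * b * κ) * (∫ x, ‖P x - (2 * b) • gradient k x‖ ^ 2) +
      4 * b ^ 2 * B ^ 2 / (a - 2 * b * κ) * (∫ x, ‖k x - h x‖ ^ 2) := by
  set l := a - 2 * b * κ with hl
  have hw : MemLp (fun x => k x - h x) 2 := hk.memLp.sub hh.memLp
  have hwg := gradient_sub hh.differentiable hk.differentiable
  have hw' : MemLp (fun x => gradient k x - gradient h x) 2 :=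
    hk.memLp_gradient.sub hh.memLp_gradient
  have hwd : Differentiable ℝ fun x => k x - h x := hk.differentiable.sub hh.differentiable
  have hR : MemLp (fun x => P x - (2 * b) • gradient k x) 2 := hP2.sub (hk.memLp_smul_gradient _)
  have mk := memLp_divergence (hk.memLp_fderiv_flux ha.le hP hP2 hP')
  have mh := memLp_divergence (hh.memLp_fderiv_flux ha.le (hh.contDiff_smul_gradient (2 * b))
    (hh.memLp_smul_gradient _) (hh.memLp_fderiv_smul_gradient _))
  have ek := hk.integral_mul_divergence_flux ha.le hP hP2 hP' hwd hw (hwg ▸ hw')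
  have eh := hh.integral_mul_divergence_flux ha.le (hh.contDiff_smul_gradient (2 * b))
    (hh.memLp_smul_gradient _) (hh.memLp_fderiv_smul_gradient _) hwd hw (hwg ▸ hw')
  have jk := integrable_inner_of_memLp (hk.memLp_flux (a := a) hP2) hw'
  have jh := integrable_inner_of_memLp
    (hh.memLp_flux (a := a) (hh.memLp_smul_gradient (2 * b))) hw'
  have ik : Integrable fun x => (k x - h x) * divergence (flux a k P) x := hw.integrable_mul mk
  have ih : Integrable fun x => (k x - h x) *
      divergence (flux a h fun x => (2 * b) • gradient h x) x := hw.integrable_mul mh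
  have i12 : Integrable fun x => -(l / 2) * ‖gradient k x - gradient h x‖ ^ 2 +
      B ^ 2 / l * ‖P x - (2 * b) • gradient k x‖ ^ 2 :=
    ((integrable_norm_sq hw').const_mul _).add ((integrable_norm_sq hR).const_mul _)
  simp only [mul_sub]
  rw [integral_sub ik ih, ek, eh, hwg, neg_sub_neg,
    ← integral_sub jh jk, ← integral_const_mul, ← integral_const_mul, ← integral_const_mul,
    ← integral_add ((integrable_norm_sq hw').const_mul _) ((integrable_norm_sq hR).const_mul _),
    ← integral_add i12 ((integrable_norm_sq hw).const_mul _)]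
  refine integral_mono (jh.sub jk) (i12.add ((integrable_norm_sq hw).const_mul _)) fun x => ?_
  simp only
  set D := gradient k x - gradient h x with hD
  set R := P x - (2 * b) • gradient k x with hRx
  -- With P = R + 2b∇k one has kP − 2bh∇h = kR + 2b(k − h)∇k + 2bhD. The last term joins the
  -- diffusion, so its coefficient involves only `h`, which is bounded by κ.
  have e1 : inner ℝ (flux a h (fun x => (2 * b) • gradient h x) x) D - inner ℝ (flux a k P x) D =
      -(a - 2 * b * h x) * ‖D‖ ^ 2 + k x * inner ℝ R D +
        2 * b * (k x - h x) * inner ℝ (gradient k x) D := by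
    have hgk : gradient k x = gradient h x + D := by rw [hD]; abel
    have hPx : P x = R + (2 * b) • (gradient h x + D) := by rw [hRx, ← hgk]; abel
    simp only [flux, hPx, hgk, inner_sub_left, inner_smul_left, inner_add_left,
      real_inner_self_eq_norm_sq, conj_trivial, smul_add]
    ring
  have b1 : k x * inner ℝ R D ≤ B * (‖R‖ * ‖D‖) := by
    refine (le_abs_self _).trans ?_
    rw [abs_mul]
    exact mul_le_mul (hk.abs_le x) (abs_real_inner_le_norm _ _) (abs_nonneg _)
      ((abs_nonneg _).trans (hk.abs_le x))
  have b2 : 2 * b * (k x - h x) * inner ℝ (gradient k x) D ≤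
      2 * b * ‖k x - h x‖ * (B * ‖D‖) := by
    refine (le_abs_self _).trans ?_
    rw [abs_mul, abs_mul, abs_of_pos (by positivity : 0 < 2 * b), Real.norm_eq_abs]
    gcongr
    exact (abs_real_inner_le_norm _ _).trans (by gcongr; exact hk.norm_gradient_le x)
  have b3 : l * ‖D‖ ^ 2 ≤ (a - 2 * b * h x) * ‖D‖ ^ 2 := by
    have := mul_le_mul_of_nonneg_left (hhκ x) (by positivity : 0 ≤ 2 * b)
    exact mul_le_mul_of_nonneg_right (by linarith) (by positivity)
  -- Each of the two error terms takes a quarter of the dissipation, which leaves l/2.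
  have y1 : B * (‖R‖ * ‖D‖) ≤ l / 4 * ‖D‖ ^ 2 + B ^ 2 / l * ‖R‖ ^ 2 := by
    have : 0 ≤ (l / 2 * ‖D‖ - B * ‖R‖) ^ 2 / l := by positivity
    have e : (l / 2 * ‖D‖ - B * ‖R‖) ^ 2 / l =
      l / 4 * ‖D‖ ^ 2 + B ^ 2 / l * ‖R‖ ^ 2 - B * (‖R‖ * ‖D‖) := by field_simp; ring
    linarith
  have y2 : 2 * b * ‖k x - h x‖ * (B * ‖D‖) ≤
      l / 4 * ‖D‖ ^ 2 + 4 * b ^ 2 * B ^ 2 / l * ‖k x - h x‖ ^ 2 := by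
    have : 0 ≤ (l / 2 * ‖D‖ - 2 * b * B * ‖k x - h x‖) ^ 2 / l := by positivity
    have e : (l / 2 * ‖D‖ - 2 * b * B * ‖k x - h x‖) ^ 2 / l =
      l / 4 * ‖D‖ ^ 2 + 4 * b ^ 2 * B ^ 2 / l * ‖k x - h x‖ ^ 2 -
        2 * b * ‖k x - h x‖ * (B * ‖D‖) := by field_simp; ring
    linarith
  rw [e1]
  linarith

/-! ### Absolutely continuous curves in a Hilbert space and Grönwall's inequality. -/

section HilbertValued

variable {H : Type*} [NormedAddCommGroup H] [InnerProductSpace ℝ H]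

/-- Distinct orthonormal vectors are at distance √2, so the balls of radius 1/2 around them are
disjoint, and a separable space holds only countably many disjoint nonempty open sets. Countability
makes a Hilbert basis expansion a limit to which measurability passes. -/
lemma countable_of_orthonormal [TopologicalSpace.SeparableSpace H] {ι : Type*} {v : ι → H}
    (hv : Orthonormal ℝ v) : Countable ι := by
  have hd : ∀ i j, i ≠ j → 1 < ‖v i - v j‖ := fun i j hij => by
    have h1 : ‖v i - v j‖ ^ 2 = 2 := by
      rw [@norm_sub_sq ℝ, hv.1 i, hv.1 j, hv.2 hij]
      norm_num
    nlinarith [norm_nonneg (v i - v j)]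
  have hp : (univ : Set ι).PairwiseDisjoint fun i => Metric.ball (v i) (1 / 2) := by
    intro i _ j _ hij
    refine Metric.ball_disjoint_ball ?_
    rw [dist_eq_norm]
    linarith [hd i j hij]
  exact countable_univ_iff.mp (hp.countable_of_isOpen (fun _ _ => Metric.isOpen_ball)
    fun i _ => ⟨v i, Metric.mem_ball_self (by norm_num)⟩)

variable [CompleteSpace H]

/-- Weakly measurable functions with values in a separable Hilbert space are measurable. -/
lemma aestronglyMeasurable_of_inner [TopologicalSpace.SeparableSpace H] {α : Type*}
    [MeasurableSpace α] {μ : Measure α} {D : Set H} (hD : Dense D) {g : α → H}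
    (hg : ∀ ψ ∈ D, AEStronglyMeasurable (fun t => inner ℝ ψ (g t)) μ) :
    AEStronglyMeasurable g μ := by
  have hall : ∀ c : H, AEStronglyMeasurable (fun t => inner ℝ c (g t)) μ := fun c => by
    obtain ⟨x, hx, hxc⟩ := mem_closure_iff_seq_limit.mp (hD c)
    exact aestronglyMeasurable_of_tendsto_ae Filter.atTop (fun n => hg (x n) (hx n))
      (Filter.Eventually.of_forall fun t => hxc.inner tendsto_const_nhds)
  obtain ⟨w, b, -⟩ := exists_hilbertBasis ℝ H
  have : Countable w := countable_of_orthonormal b.orthonormal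
  refine aestronglyMeasurable_of_tendsto_ae (Filter.atTop : Filter (Finset w))
    (f := fun s t => ∑ i ∈ s, inner ℝ (b i) (g t) • b i)
    (fun s => ?_) (Filter.Eventually.of_forall fun t => ?_)
  · exact Finset.aestronglyMeasurable_fun_sum _ fun i _ => (hall (b i)).smul_const _
  · have := b.hasSum_repr (g t)
    simp only [HilbertBasis.repr_apply_apply] at this
    simpa [HasSum] using this

/-- A test function on `(0,T)` is the derivative, on `(0,T)`, of a test function on `(-∞,T)`. -/
lemma exists_test_primitive {T : ℝ} (hT : 0 < T) {θ : ℝ → ℝ} (hθ : ContDiff ℝ ∞ θ)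
    (hc : HasCompactSupport θ) (hs : tsupport θ ⊆ Ioo 0 T) :
    ∃ η : ℝ → ℝ, ContDiff ℝ ∞ η ∧ HasCompactSupport η ∧ tsupport η ⊆ Iio T ∧
      ∀ t, 0 < t → deriv η t = θ t := by
  -- The compact support stops strictly before `T`, so the primitive based at `T` vanishes beyond
  -- `e`.
  obtain ⟨e, he, hes⟩ : ∃ e < T, ∀ t, e < t → θ t = 0 := by
    rcases (tsupport θ).eq_empty_or_nonempty with h | h
    · exact ⟨0, hT, fun t _ => image_eq_zero_of_notMem_tsupport (by simp [h])⟩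
    · obtain ⟨e, he, hmax⟩ := hc.isCompact.exists_isGreatest h
      exact ⟨e, (hs he).2, fun t ht => image_eq_zero_of_notMem_tsupport
        fun h' => not_lt.mpr (hmax h') ht⟩
  set Θ : ℝ → ℝ := fun t => ∫ τ in T..t, θ τ with hΘ
  have hΘd : ∀ t, HasDerivAt Θ (θ t) t := fun t =>
    intervalIntegral.integral_hasDerivAt_right (hθ.continuous.intervalIntegrable _ _)
      (hθ.continuous.stronglyMeasurableAtFilter _ _) hθ.continuous.continuousAt
  have hΘs : ContDiff ℝ ∞ Θ := by
    rw [contDiff_infty_iff_deriv]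
    refine ⟨fun t => (hΘd t).differentiableAt, ?_⟩
    rwa [show deriv Θ = θ from funext fun t => (hΘd t).deriv]
  have hΘ0 : ∀ t, e < t → Θ t = 0 := fun t ht => by
    refine intervalIntegral.integral_zero_ae (Filter.Eventually.of_forall fun τ hτ => hes τ ?_)
    exact (lt_min he ht).trans hτ.1
  -- For negative times the primitive may be a nonzero constant. The cutoff vanishes for t ≤ −1 and
  -- equals 1 for t ≥ 0, so it restores compact support without changing the derivative at positive
  -- times.
  set χ : ℝ → ℝ := fun t => Real.smoothTransition (t + 1) with hχ
  have hχs : ContDiff ℝ ∞ χ :=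
    Real.smoothTransition.contDiff.comp (contDiff_id.add contDiff_const)
  have hsupp : Function.support (fun t => χ t * Θ t) ⊆ Icc (-1) e := by
    intro t ht
    refine ⟨?_, ?_⟩
    · by_contra h
      exact ht (by simp [hχ, Real.smoothTransition.zero_of_nonpos (x := t + 1) (by linarith)])
    · by_contra h
      exact ht (by simp [hΘ0 t (not_le.mp h)])
  have hts : tsupport (fun t => χ t * Θ t) ⊆ Icc (-1) e := closure_minimal hsupp isClosed_Icc
  refine ⟨fun t => χ t * Θ t, hχs.mul hΘs, HasCompactSupport.of_support_subset_isCompact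
    isCompact_Icc hsupp, fun t ht => (hts ht).2.trans_lt he, fun t ht => ?_⟩
  have : (fun t => χ t * Θ t) =ᶠ[nhds t] Θ := by
    filter_upwards [Ioi_mem_nhds ht] with r hr
    have : χ r = 1 := Real.smoothTransition.one_of_one_le (by linarith [mem_Ioi.mp hr])
    rw [this, one_mul]
  rw [this.deriv_eq, (hΘd t).deriv]

/-- A function whose weak time derivative is integrable is the integral of that derivative. -/
lemma ae_eq_add_integral_of_weak_deriv {T : ℝ} (hT : 0 < T) {D : Set H} (hD : Dense D)
    {U g : ℝ → H} {U₀ : H} (hU : IntegrableOn U (Ioo 0 T)) (hg : Integrable g)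
    (h : ∀ η : ℝ → ℝ, ContDiff ℝ ∞ η → HasCompactSupport η → tsupport η ⊆ Iio T → ∀ ψ ∈ D,
      (∫ t in Ioo 0 T, (deriv η t * inner ℝ ψ (U t) + η t * inner ℝ ψ (g t))) +
        η 0 * inner ℝ ψ U₀ = 0) :
    ∀ᵐ t ∂(volume.restrict (Ioo 0 T)), U t = U₀ + ∫ τ in (0)..t, g τ := by
  have hgi : ∀ x y, IntervalIntegrable g volume x y := fun x y => hg.intervalIntegrable
  set n : ℝ → H := fun t => U₀ + ∫ τ in (0)..t, g τ with hn
  have hnc : Continuous n := continuous_const.add (intervalIntegral.continuous_primitive hgi 0)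
  have hni : IntegrableOn n (Ioo 0 T) :=
    (hnc.integrableOn_Icc (a := 0) (b := T)).mono_set Ioo_subset_Icc_self
  -- The curve `n` satisfies the same weak identity as `U`: integration by parts produces the
  -- initial term η(0)⟨ψ, U₀⟩, and the boundary term at `T` is killed by η(T) = 0.
  have key : ∀ η : ℝ → ℝ, ContDiff ℝ ∞ η → HasCompactSupport η → tsupport η ⊆ Iio T → ∀ ψ ∈ D,
      ∫ t in Ioo 0 T, deriv η t * inner ℝ ψ (U t - n t) = 0 := by
    intro η hη hηc hηs ψ hψ
    have h0 := h η hη hηc hηs ψ hψ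
    have hηT : η T = 0 := image_eq_zero_of_notMem_tsupport fun h' => lt_irrefl T (hηs h')
    have hη1 : ContDiff ℝ 1 η := hη.of_le (by exact_mod_cast le_top)
    have hη' : Continuous (deriv η) := hη.continuous_deriv (by exact_mod_cast le_top)
    have bη' : ∃ C, ∀ t, ‖deriv η t‖ ≤ C := hηc.deriv.exists_bound_of_continuous hη'
    have bη : ∃ C, ∀ t, ‖η t‖ ≤ C := hηc.exists_bound_of_continuous hη.continuous
    obtain ⟨C', hC'⟩ := bη'
    obtain ⟨C, hC⟩ := bη
    set p : ℝ → ℝ := fun t => inner ℝ ψ (g t) with hp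
    have hpi : Integrable p := hg.const_inner ψ
    set q : ℝ → ℝ := fun t => ∫ τ in (0)..t, p τ with hq
    have hqn : ∀ t, inner ℝ ψ (n t) = inner ℝ ψ U₀ + q t := fun t => by
      rw [hn, hq]
      simp only [inner_add_right]
      congr 1
      exact ((innerSL ℝ ψ).intervalIntegral_comp_comm (hgi 0 t)).symm
    have hqac : AbsolutelyContinuousOnInterval q 0 T :=
      hpi.intervalIntegrable.absolutelyContinuousOnInterval_intervalIntegral (by simp)
    have hηac : AbsolutelyContinuousOnInterval η 0 T := by
      obtain ⟨K, hK⟩ := hη1.lipschitzWith_of_hasCompactSupport hηc (by norm_num)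
      exact (hK.lipschitzOnWith).absolutelyContinuousOnInterval
    have ibp := hqac.integral_mul_deriv_eq_deriv_mul hηac
    have hq' : ∫ t in (0)..T, deriv q t * η t = ∫ t in (0)..T, p t * η t := by
      refine intervalIntegral.integral_congr_ae ?_
      filter_upwards [(hpi.intervalIntegrable (a := 0) (b := T)).ae_hasDerivAt_integral] with t ht h'
      rw [(ht (uIoc_subset_uIcc h') 0 left_mem_uIcc).deriv]
    have hη0 : ∫ t in (0)..T, deriv η t = -η 0 := by
      rw [intervalIntegral.integral_deriv_eq_sub
        (fun t _ => hη1.differentiable (by norm_num) t) (hη'.intervalIntegrable _ _), hηT, zero_sub]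
    have hq0 : q 0 = 0 := by simp [hq]
    rw [hηT, hq0, hq', mul_zero, zero_mul, sub_zero, zero_sub] at ibp
    rw [intervalIntegral.integral_of_le hT.le, integral_Ioc_eq_integral_Ioo] at ibp hη0
    rw [intervalIntegral.integral_of_le hT.le, integral_Ioc_eq_integral_Ioo] at ibp
    have bmul : ∀ {F : ℝ → ℝ} {w : ℝ → ℝ} {C : ℝ}, Continuous w → (∀ t, ‖w t‖ ≤ C) →
        IntegrableOn F (Ioo 0 T) → IntegrableOn (fun t => w t * F t) (Ioo 0 T) :=
      fun hw hb hF => hF.bdd_mul hw.aestronglyMeasurable (Filter.Eventually.of_forall hb)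
    have i1 : IntegrableOn (fun t => deriv η t * inner ℝ ψ (U t)) (Ioo 0 T) :=
      bmul hη' hC' (hU.const_inner ψ)
    have i2 : IntegrableOn (fun t => η t * inner ℝ ψ (g t)) (Ioo 0 T) :=
      bmul hη.continuous hC hpi.integrableOn
    have i3 : IntegrableOn (fun t => deriv η t * inner ℝ ψ (n t)) (Ioo 0 T) :=
      bmul hη' hC' (hni.const_inner ψ)
    have hqc : Continuous q := intervalIntegral.continuous_primitive
      (fun x y => hpi.intervalIntegrable) 0
    have i4 : IntegrableOn (fun t => q t * deriv η t) (Ioo 0 T) :=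
      ((hqc.mul hη').integrableOn_Icc (a := 0) (b := T)).mono_set Ioo_subset_Icc_self
    have i5 : IntegrableOn (fun t => inner ℝ ψ U₀ * deriv η t) (Ioo 0 T) :=
      ((continuous_const.mul hη').integrableOn_Icc (a := 0) (b := T)).mono_set Ioo_subset_Icc_self
    rw [integral_add i1 i2] at h0
    simp only [inner_sub_right, mul_sub]
    rw [integral_sub i1 i3]
    have e3 : ∫ t in Ioo 0 T, deriv η t * inner ℝ ψ (n t) =
        inner ℝ ψ U₀ * (-η 0) + -∫ t in Ioo 0 T, p t * η t := by
      rw [← ibp, ← hη0, ← integral_const_mul, ← integral_add i5 i4]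
      refine integral_congr_ae (Filter.Eventually.of_forall fun t => ?_)
      simp only [hqn]
      ring
    rw [e3]
    have e4 : ∫ t in Ioo 0 T, p t * η t = ∫ t in Ioo 0 T, η t * inner ℝ ψ (g t) := by
      simp only [hp, mul_comm]
    rw [e4]
    linarith
  have hall : ∀ᵐ t, t ∈ Ioo 0 T → (U t - n t) = 0 := by
    refine IsOpen.ae_eq_zero_of_integral_contDiff_smul_eq_zero isOpen_Ioo
      (hU.sub hni).locallyIntegrableOn fun θ hθ hθc hθs => ?_
    -- Since η need not vanish at 0, every θ is such a derivative, with no mean-zero condition;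
    -- hence U − n is zero and not merely constant.
    obtain ⟨η, hη, hηc, hηs, hd⟩ := exists_test_primitive hT hθ hθc hθs
    obtain ⟨C, hC⟩ := hθc.exists_bound_of_continuous hθ.continuous
    have hi : IntegrableOn (fun t => θ t • (U t - n t)) (Ioo 0 T) :=
      (hU.sub hni).bdd_smul C hθ.continuous.aestronglyMeasurable (Filter.Eventually.of_forall hC)
    have hz : ∫ t, θ t • (U t - n t) = ∫ t in Ioo 0 T, θ t • (U t - n t) :=
      (setIntegral_eq_integral_of_forall_compl_eq_zero fun t ht => by
        rw [image_eq_zero_of_notMem_tsupport fun h' => ht (hθs h'), zero_smul]).symm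
    change ∫ t, θ t • (U t - n t) = 0
    rw [hz]
    refine hD.eq_zero_of_inner_right ℝ fun ψ hψ => ?_
    rw [← integral_inner hi]
    refine Eq.trans ?_ (key η hη hηc hηs ψ hψ)
    refine setIntegral_congr_fun measurableSet_Ioo fun t ht => ?_
    simp only [hd t ht.1, inner_smul_right]
  rw [ae_restrict_iff' measurableSet_Ioo]
  filter_upwards [hall] with t ht h'
  exact sub_eq_zero.mp (ht h')

end HilbertValued

section HilbertValued

variable {H : Type*} [NormedAddCommGroup H] [InnerProductSpace ℝ H] [CompleteSpace H]

/-- The comparison function `m` will be the primitive of a multiple of ‖g‖, which dominates the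
increments of a functional along the curve with derivative `g`. -/
lemma absolutelyContinuous_of_dist_le {f m : ℝ → ℝ} {a b : ℝ}
    (hm : AbsolutelyContinuousOnInterval m a b)
    (h : ∀ x ∈ uIcc a b, ∀ y ∈ uIcc a b, dist (f x) (f y) ≤ dist (m x) (m y)) :
    AbsolutelyContinuousOnInterval f a b := by
  rw [absolutelyContinuousOnInterval_iff] at hm ⊢
  intro ε hε
  obtain ⟨δ, hδ, hE⟩ := hm ε hε
  refine ⟨δ, hδ, fun E hEd hEs => lt_of_le_of_lt (Finset.sum_le_sum fun i hi => ?_)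
    (hE E hEd hEs)⟩
  exact h _ (hEd.1 i hi).1 _ (hEd.1 i hi).2

/-- The chain rule along an absolutely continuous curve, for a functional with Lipschitz
gradient. -/
lemma comp_sub_eq_integral_inner {F : H → ℝ} {G : H → H} {K : NNReal} (hG : LipschitzWith K G)
    (hF : ∀ v, HasFDerivAt F (innerSL ℝ (G v)) v) {g : ℝ → H} (hg : Integrable g) (U₀ : H)
    (t : ℝ) :
    F (U₀ + ∫ τ in (0)..t, g τ) - F U₀ =
      ∫ r in (0)..t, inner ℝ (G (U₀ + ∫ τ in (0)..r, g τ)) (g r) := by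
  have hgi : ∀ x y, IntervalIntegrable g volume x y := fun x y => hg.intervalIntegrable
  set n : ℝ → H := fun t => U₀ + ∫ τ in (0)..t, g τ with hn
  have hnc : Continuous n := continuous_const.add (intervalIntegral.continuous_primitive hgi 0)
  -- `F` may grow quadratically, so it is Lipschitz only on balls; the curve over the compact time
  -- interval stays in one of them.
  obtain ⟨R, hR⟩ := (isCompact_uIcc (a := (0 : ℝ)) (b := t)).exists_bound_of_continuousOn
    hnc.continuousOn
  have hR0 : 0 ≤ R := (norm_nonneg _).trans (hR 0 left_mem_uIcc)
  set C : ℝ := ‖G 0‖ + K * R with hC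
  have hC0 : 0 ≤ C := by positivity
  have hGb : ∀ v ∈ Metric.closedBall (0 : H) R, ‖innerSL ℝ (G v)‖ ≤ C := fun v hv => by
    rw [innerSL_apply_norm]
    have h1 := hG.dist_le_mul v 0
    rw [dist_eq_norm, dist_eq_norm, sub_zero] at h1
    have h2 : ‖v‖ ≤ R := by simpa using hv
    calc ‖G v‖ = ‖G 0 + (G v - G 0)‖ := by rw [add_sub_cancel]
      _ ≤ ‖G 0‖ + ‖G v - G 0‖ := norm_add_le _ _
      _ ≤ ‖G 0‖ + K * R := by gcongr; exact h1.trans (by gcongr)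
  have hlip : ∀ x ∈ uIcc 0 t, ∀ y ∈ uIcc 0 t, ‖F (n x) - F (n y)‖ ≤ C * ‖n x - n y‖ :=
    fun x hx y hy => (convex_closedBall (0 : H) R).norm_image_sub_le_of_norm_hasFDerivWithin_le
      (fun v _ => (hF v).hasFDerivWithinAt) hGb (by simpa using hR y hy) (by simpa using hR x hx)
  set m : ℝ → ℝ := fun t => ∫ τ in (0)..t, C * ‖g τ‖ with hm
  have hmi : Integrable fun τ => C * ‖g τ‖ := hg.norm.const_mul C
  have hmac : AbsolutelyContinuousOnInterval m 0 t :=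
    hmi.intervalIntegrable.absolutelyContinuousOnInterval_intervalIntegral (by simp)
  have hac : AbsolutelyContinuousOnInterval (fun r => F (n r)) 0 t := by
    refine absolutelyContinuous_of_dist_le hmac fun x hx y hy => ?_
    have e1 : n x - n y = ∫ τ in y..x, g τ := by
      simp only [hn, add_sub_add_left_eq_sub]
      exact intervalIntegral.integral_interval_sub_left (hgi _ _) (hgi _ _)
    have e2 : m x - m y = C * ∫ τ in y..x, ‖g τ‖ := by
      rw [← intervalIntegral.integral_const_mul]
      exact intervalIntegral.integral_interval_sub_left hmi.intervalIntegrable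
        hmi.intervalIntegrable
    rw [dist_eq_norm, dist_eq_norm, e2, norm_mul, Real.norm_of_nonneg hC0, Real.norm_eq_abs]
    refine (hlip x hx y hy).trans ?_
    rw [e1]
    gcongr
    exact intervalIntegral.norm_integral_le_abs_integral_norm
  have hd := hac.integral_deriv_eq_sub
  have hn0 : n 0 = U₀ := by simp [hn]
  rw [hn0] at hd
  rw [← hd]
  refine intervalIntegral.integral_congr_ae ?_
  filter_upwards [(hgi 0 t).ae_hasDerivAt_integral] with r hr hr'
  have h1 : HasDerivAt n (g r) r := (hr (uIoc_subset_uIcc hr') 0 left_mem_uIcc).const_add U₀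
  have h2 := (hF (n r)).comp_hasDerivAt r h1
  simpa [Function.comp_def, hn] using h2.deriv

lemma norm_sq_integral_eq {g : ℝ → H} (hg : Integrable g) (t : ℝ) :
    ‖∫ τ in (0)..t, g τ‖ ^ 2 = ∫ r in (0)..t, 2 * inner ℝ (∫ τ in (0)..r, g τ) (g r) := by
  have hG : LipschitzWith 2 fun v : H => (2 : ℝ) • v := by
    refine LipschitzWith.of_dist_le_mul fun x y => ?_
    rw [dist_eq_norm, dist_eq_norm, ← smul_sub, norm_smul]
    simp
  have hF : ∀ v : H, HasFDerivAt (fun v : H => ‖v‖ ^ 2) (innerSL ℝ ((2 : ℝ) • v)) v := fun v => by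
    have := (hasStrictFDerivAt_norm_sq v).hasFDerivAt
    simpa [ofNat_smul_eq_nsmul] using this
  have := comp_sub_eq_integral_inner hG hF hg 0 t
  simpa [inner_smul_left] using this

end HilbertValued

/-- Grönwall's inequality in integral form. -/
lemma le_mul_exp_of_le_add_integral {E : ℝ → ℝ} {A K T : ℝ} (hK : 0 ≤ K) (hE : Continuous E)
    (h : ∀ t ∈ Icc 0 T, E t ≤ A + K * ∫ τ in (0)..t, E τ) :
    ∀ t ∈ Icc 0 T, E t ≤ A * Real.exp (K * t) := by
  intro t ht
  refine (h t ht).trans ?_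
  have hd : ∀ r, HasDerivAt (fun t => A + K * ∫ τ in (0)..t, E τ) (K * E r) r := fun r =>
    ((intervalIntegral.integral_hasDerivAt_right (hE.intervalIntegrable _ _)
      (hE.stronglyMeasurableAtFilter _ _) hE.continuousAt).const_mul K).const_add A
  have := le_gronwallBound_of_liminf_deriv_right_le (f := fun t => A + K * ∫ τ in (0)..t, E τ)
    (f' := fun r => K * E r) (δ := A) (K := K) (ε := 0) (a := 0) (b := T)
    (fun r _ => (hd r).continuousAt.continuousWithinAt)
    (fun r _ _ hr' => (hd r).hasDerivWithinAt.liminf_right_slope_le hr')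
    (by simp) (fun r hr => by
      have := h r ⟨hr.1, hr.2.le⟩
      simp only [add_zero]
      gcongr) t ht
  simpa [gronwallBound_ε0] using this

/-! ### Test functions and integral functionals on L². -/

/-- The classes of test functions in `L²`. -/
def testSpace (d : ℕ) : Submodule ℝ (Lp ℝ 2 (volume : Measure (Eucl d))) where
  carrier := {z | ∃ ψ : Eucl d → ℝ, ContDiff ℝ ∞ ψ ∧ HasCompactSupport ψ ∧ z =ᵐ[volume] ψ}
  add_mem' := by
    rintro x y ⟨ψ, h1, h2, h3⟩ ⟨φ, k1, k2, k3⟩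
    exact ⟨ψ + φ, h1.add k1, h2.add k2, (Lp.coeFn_add x y).trans (h3.add k3)⟩
  zero_mem' := ⟨0, contDiff_const, HasCompactSupport.zero, Lp.coeFn_zero _ _ _⟩
  smul_mem' := by
    rintro c x ⟨ψ, h1, h2, h3⟩
    exact ⟨c • ψ, contDiff_const.smul h1, h2.smul_left (f := fun _ => c),
      (Lp.coeFn_smul c x).trans (h3.const_smul c)⟩

lemma dense_testSpace : Dense (testSpace d : Set (Lp ℝ 2 (volume : Measure (Eucl d)))) := by
  rw [Submodule.dense_iff_topologicalClosure_eq_top, Submodule.topologicalClosure_eq_top_iff,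
    Submodule.eq_bot_iff]
  intro z hz
  rw [Lp.eq_zero_iff_ae_eq_zero]
  refine ae_eq_zero_of_integral_contDiff_smul_eq_zero
    ((Lp.memLp z).locallyIntegrable (by norm_num)) fun ψ hψ hc => ?_
  have hm : MemLp ψ 2 := memLp_of_continuous_compactSupport hψ.continuous hc 2
  have := (Submodule.mem_orthogonal _ _).mp hz (hm.toLp ψ) ⟨ψ, hψ, hc, hm.coeFn_toLp⟩
  rw [L2.inner_def] at this
  rw [← this]
  refine integral_congr_ae ?_
  filter_upwards [hm.coeFn_toLp] with x hx
  rw [hx]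
  simp [mul_comm]

open Classical in
/-- The class in `L²` of a function, `0` if it is not square integrable. -/
def toL2 (f : Eucl d → ℝ) : Lp ℝ 2 (volume : Measure (Eucl d)) :=
  if h : MemLp f 2 then h.toLp f else 0

lemma coeFn_toL2 {f : Eucl d → ℝ} (hf : MemLp f 2) : toL2 f =ᵐ[volume] f := by
  rw [toL2, dif_pos hf]
  exact hf.coeFn_toLp

lemma inner_eq_integral_of_ae_eq {x y : Lp ℝ 2 (volume : Measure (Eucl d))} {f g : Eucl d → ℝ}
    (hf : x =ᵐ[volume] f) (hg : y =ᵐ[volume] g) : inner ℝ x y = ∫ z, f z * g z := by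
  rw [L2.inner_def]
  refine integral_congr_ae ?_
  filter_upwards [hf, hg] with z h1 h2
  rw [h1, h2]
  simp [mul_comm]

lemma norm_toL2 {f : Eucl d → ℝ} (hf : MemLp f 2) : ‖toL2 f‖ₑ = eLpNorm f 2 := by
  rw [toL2, dif_pos hf, Lp.enorm_toLp]

section Functional

variable {β : ℝ → ℝ} {L : NNReal}

/-- On the interval between y and y + r, of length |r|, β differs from β(y) by at most L|r|. This is
Taylor's formula with a quadratic remainder, where the factor 1/2 is given away. -/
lemma abs_primitive_sub_le (hβ : LipschitzWith L β) (y r : ℝ) :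
    |(∫ τ in (0)..(y + r), β τ) - (∫ τ in (0)..y, β τ) - β y * r| ≤ L * r ^ 2 := by
  have hi : ∀ u v, IntervalIntegrable β volume u v := fun u v =>
    hβ.continuous.intervalIntegrable u v
  have e : (∫ τ in (0)..(y + r), β τ) - (∫ τ in (0)..y, β τ) - β y * r =
      ∫ τ in y..(y + r), (β τ - β y) := by
    rw [intervalIntegral.integral_interval_sub_left (hi _ _) (hi _ _),
      intervalIntegral.integral_sub (hi _ _) (by simp)]
    simp [mul_comm]
  rw [e, ← Real.norm_eq_abs]
  refine (intervalIntegral.norm_integral_le_of_norm_le_const (C := L * |r|) fun τ hτ => ?_).trans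
    (le_of_eq ?_)
  · have h1 := hβ.dist_le_mul τ y
    rw [dist_eq_norm, Real.dist_eq] at h1
    refine h1.trans (mul_le_mul_of_nonneg_left ?_ L.2)
    rcases le_total 0 r with hr | hr
    · rw [uIoc_of_le (by linarith)] at hτ
      rw [abs_of_nonneg hr, abs_of_nonneg (by linarith [hτ.1])]
      linarith [hτ.2]
    · rw [uIoc_of_ge (by linarith)] at hτ
      rw [abs_of_nonpos hr, abs_of_nonpos (by linarith [hτ.2])]
      linarith [hτ.1]
  · rw [add_sub_cancel_left, mul_assoc, ← abs_mul, abs_mul_self, pow_two]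

lemma abs_primitive_le (hβ : LipschitzWith L β) (h0 : β 0 = 0) (y : ℝ) :
    |∫ τ in (0)..y, β τ| ≤ L * y ^ 2 := by
  simpa [h0] using abs_primitive_sub_le hβ 0 y

lemma continuous_primitive (hβ : LipschitzWith L β) : Continuous fun y => ∫ τ in (0)..y, β τ :=
  intervalIntegral.continuous_primitive (fun u v => hβ.continuous.intervalIntegrable u v) 0

lemma integrable_primitive_comp (hβ : LipschitzWith L β) (h0 : β 0 = 0)
    (v : Lp ℝ 2 (volume : Measure (Eucl d))) : Integrable fun x => ∫ τ in (0)..(v x), β τ := by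
  refine ((integrable_norm_sq (Lp.memLp v)).const_mul L).mono'
    ((continuous_primitive hβ).comp_aestronglyMeasurable (Lp.memLp v).1)
    (Filter.Eventually.of_forall fun x => ?_)
  simpa using abs_primitive_le hβ h0 (v x)

/-- The functional `v ↦ ∫ Φ(v)` on `L²`, where `Φ' = β` and `Φ(0) = 0`. -/
def integralFunctional (β : ℝ → ℝ) (v : Lp ℝ 2 (volume : Measure (Eucl d))) : ℝ :=
  ∫ x, ∫ τ in (0)..(v x), β τ

/-- The pointwise Taylor remainder is at most L|w − v|², whose integral is exactly quadratic in the
L² norm. Thus ∫Φ is differentiable on L² with gradient β ∘ v, which is Lipschitz in v, as the chain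
rule requires. -/
lemma hasFDerivAt_integralFunctional (hβ : LipschitzWith L β) (h0 : β 0 = 0)
    (v : Lp ℝ 2 (volume : Measure (Eucl d))) :
    HasFDerivAt (integralFunctional β) (innerSL ℝ (hβ.compLp h0 v)) v := by
  have hbound : ∀ w : Lp ℝ 2 (volume : Measure (Eucl d)),
      ‖integralFunctional β w - integralFunctional β v - inner ℝ (hβ.compLp h0 v) (w - v)‖ ≤
        L * ‖w - v‖ ^ 2 := fun w => by
    have i1 := integrable_primitive_comp hβ h0 w
    have i2 := integrable_primitive_comp hβ h0 v
    have i3 : Integrable fun x => β (v x) * (w x - v x) := by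
      have m1 : MemLp (fun x => β (v x)) 2 :=
        (memLp_congr_ae (hβ.coeFn_compLp h0 v)).mp (Lp.memLp _)
      exact m1.integrable_mul ((Lp.memLp w).sub (Lp.memLp v))
    have e3 : inner ℝ (hβ.compLp h0 v) (w - v) = ∫ x, β (v x) * (w x - v x) :=
      inner_eq_integral_of_ae_eq (hβ.coeFn_compLp h0 v) (Lp.coeFn_sub w v)
    have e4 : ‖w - v‖ ^ 2 = ∫ x, ‖w x - v x‖ ^ 2 := by
      rw [← real_inner_self_eq_norm_sq,
        inner_eq_integral_of_ae_eq (Lp.coeFn_sub w v) (Lp.coeFn_sub w v)]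
      simp [pow_two]
    have i12 : Integrable fun x => (∫ τ in (0)..(w x), β τ) - ∫ τ in (0)..(v x), β τ := i1.sub i2
    rw [e3, e4, integralFunctional, integralFunctional, ← integral_sub i1 i2,
      ← integral_sub i12 i3, ← integral_const_mul]
    refine norm_integral_le_of_norm_le
      ((integrable_norm_sq ((Lp.memLp w).sub (Lp.memLp v))).const_mul L)
      (Filter.Eventually.of_forall fun x => ?_)
    simpa using abs_primitive_sub_le hβ (v x) (w x - v x)
  have hO : (fun w => integralFunctional β w - integralFunctional β v -
      inner ℝ (hβ.compLp h0 v) (w - v)) =O[nhds v] fun w => ‖w - v‖ ^ 2 :=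
    Asymptotics.IsBigO.of_bound L (Filter.Eventually.of_forall fun w => by
      simpa using hbound w)
  rw [hasFDerivAt_iff_isLittleO]
  exact hO.trans_isLittleO (Asymptotics.isLittleO_pow_sub_sub v (by norm_num))

end Functional

/-! ### Measurability in time and the evolution equations in L². -/

/-- The weighted `L²` norm is lower semicontinuous on `L²`. -/
lemma lowerSemicontinuous_weighted_eLpNorm {w : Eucl d → ℂ} (hw : Continuous w) :
    LowerSemicontinuous fun v : Lp ℂ 2 (volume : Measure (Eucl d)) =>
      eLpNorm (fun ξ => w ξ * v ξ) 2 := by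
  rw [lowerSemicontinuous_iff_isClosed_preimage]
  refine fun c => IsSeqClosed.isClosed fun v v₀ hv hlim => ?_
  -- L² convergence gives almost everywhere convergence along a subsequence, and Fatou's lemma then
  -- keeps the sublevel set closed.
  obtain ⟨ns, -, hns⟩ := (tendstoInMeasure_of_tendsto_Lp hlim).exists_seq_tendsto_ae
  have hm : ∀ z : Lp ℂ 2 (volume : Measure (Eucl d)),
      AEStronglyMeasurable (fun ξ => w ξ * z ξ) :=
    fun z => hw.aestronglyMeasurable.mul (Lp.memLp z).1
  have := Lp.eLpNorm_lim_le_liminf_eLpNorm (p := 2) (fun n => hm (v (ns n)))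
    (fun ξ => w ξ * v₀ ξ) (by
      filter_upwards [hns] with ξ hξ using hξ.const_mul (w ξ))
  refine this.trans ?_
  exact (Filter.liminf_le_liminf (Filter.Eventually.of_forall fun n => hv (ns n))).trans
    (by simp)

section Evolution

variable {T : ℝ} {u : ℝ → Eucl d → ℝ}

/-- Joint measurability of a function of space and time on `(0,T) × ℝ^d`. -/
abbrev JointlyMeasurable (T : ℝ) (u : ℝ → Eucl d → ℝ) : Prop :=
  AEStronglyMeasurable (fun p : ℝ × Eucl d => u p.1 p.2)
    ((volume.restrict (Ioo 0 T)).prod volume)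

lemma aestronglyMeasurable_integral_mul (hu : JointlyMeasurable T u) {ψ : Eucl d → ℝ}
    (hψ : Continuous ψ) :
    AEStronglyMeasurable (fun t => ∫ x, ψ x * u t x) (volume.restrict (Ioo 0 T)) := by
  have : AEStronglyMeasurable (fun p : ℝ × Eucl d => ψ p.2 * u p.1 p.2)
      ((volume.restrict (Ioo 0 T)).prod volume) :=
    (hψ.comp continuous_snd).aestronglyMeasurable.mul hu
  exact this.integral_prod_right'

/-- Only integrals against test functions are required to be measurable, because the lemma is also
applied to the divergence of the flux: it is built from representatives chosen separately for each
time and is accessible only through such pairings. -/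
lemma aestronglyMeasurable_toL2 {μ : Measure ℝ} {q : ℝ → Eucl d → ℝ}
    (hq2 : ∀ᵐ t ∂μ, MemLp (q t) 2)
    (hq : ∀ ψ : Eucl d → ℝ, ContDiff ℝ ∞ ψ → HasCompactSupport ψ →
      AEStronglyMeasurable (fun t => ∫ x, ψ x * q t x) μ) :
    AEStronglyMeasurable (fun t => toL2 (q t)) μ := by
  have : Fact ((2 : ℝ≥0∞) ≠ ⊤) := ⟨by norm_num⟩
  refine aestronglyMeasurable_of_inner dense_testSpace fun z hz => ?_
  obtain ⟨ψ, hψ, hc, hzψ⟩ := hz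
  refine (hq ψ hψ hc).congr ?_
  filter_upwards [hq2] with t ht
  exact (inner_eq_integral_of_ae_eq hzψ (coeFn_toL2 ht)).symm

lemma aestronglyMeasurable_toL2_of_joint (hu : JointlyMeasurable T u)
    (hu2 : ∀ᵐ t ∂(volume.restrict (Ioo 0 T)), MemLp (u t) 2) :
    AEStronglyMeasurable (fun t => toL2 (u t)) (volume.restrict (Ioo 0 T)) :=
  aestronglyMeasurable_toL2 hu2 fun _ hψ _ => aestronglyMeasurable_integral_mul hu hψ.continuous

/-- The Sobolev norm is a lower semicontinuous function of the Fourier transform, evaluated along a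
measurable curve in L². Measurability is what allows finiteness at almost every time to be deduced
from a finite time integral. -/
lemma aemeasurable_sobolevENorm (hu : JointlyMeasurable T u)
    (hu2 : ∀ᵐ t ∂(volume.restrict (Ioo 0 T)), MemLp (u t) 2) (r : ℝ) :
    AEMeasurable (fun t => sobolevENorm r (u t)) (volume.restrict (Ioo 0 T)) := by
  have h1 := aestronglyMeasurable_toL2_of_joint hu hu2
  have hw : Continuous fun ξ : Eucl d => (((1 + ‖ξ‖ ^ 2) ^ (r / 2) : ℝ) : ℂ) :=
    Complex.continuous_ofReal.comp (continuous_rpow_weight r)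
  have hcont : Continuous fun z : Lp ℝ 2 (volume : Measure (Eucl d)) =>
      (𝓕 (Complex.ofRealCLM.compLp z) : Lp ℂ 2 (volume : Measure (Eucl d))) :=
    (Lp.fourierTransformₗᵢ (Eucl d) ℂ).continuous.comp
      (Complex.ofRealCLM.compLpL 2 (volume : Measure (Eucl d))).continuous
  borelize ↥(Lp ℂ 2 (volume : Measure (Eucl d)))
  refine ((lowerSemicontinuous_weighted_eLpNorm hw).measurable.comp_aemeasurable
    (hcont.comp_aestronglyMeasurable h1).aemeasurable).congr ?_
  filter_upwards [hu2] with t ht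
  have hc : MemLp (fun x => (u t x : ℂ)) 2 := ht.ofReal
  have e : Complex.ofRealCLM.compLp (toL2 (u t)) = hc.toLp (fun x => (u t x : ℂ)) := by
    refine Lp.ext ?_
    filter_upwards [Complex.ofRealCLM.coeFn_compLp (toL2 (u t)), hc.coeFn_toLp, coeFn_toL2 ht]
      with x h1 h2 h3
    rw [h1, h2, h3]
    rfl
  simp only [Function.comp_apply, e]
  rw [sobolevENorm, dif_pos hc]

lemma memLp_of_sobolevENorm_lt_top {r : ℝ} {f : Eucl d → ℝ} (h : sobolevENorm r f < ⊤) :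
    MemLp f 2 := by
  by_cases hf : MemLp (fun x => (f x : ℂ)) 2
  · exact hf.re
  · rw [sobolevENorm, dif_neg hf] at h
    exact absurd h (lt_irrefl _)

lemma ae_sobolevENorm_le {r M : ℝ} (h : timeENorm ⊤ T (sobolevENorm r) u ≤ ENNReal.ofReal M) :
    ∀ᵐ t ∂(volume.restrict (Ioo 0 T)), sobolevENorm r (u t) ≤ ENNReal.ofReal M := by
  rw [timeENorm, eLpNorm_exponent_top] at h
  filter_upwards [enorm_ae_le_eLpNormEssSup (fun t => sobolevENorm r (u t))
    (volume.restrict (Ioo 0 T))] with t ht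
  exact (enorm_eq_self (sobolevENorm r (u t)) ▸ ht).trans h

lemma lintegral_sq_le_of_timeENorm {N : (Eucl d → ℝ) → ℝ≥0∞} {C : ℝ≥0∞}
    (h : timeENorm 2 T N u ≤ C) : ∫⁻ t in Ioo 0 T, N (u t) ^ 2 ≤ C ^ 2 := by
  have e := eLpNorm_nnreal_pow_eq_lintegral (f := fun t => N (u t))
    (μ := volume.restrict (Ioo 0 T)) (p := 2) (by norm_num)
  simp only [enorm_eq_self, ENNReal.coe_ofNat, NNReal.coe_ofNat, ENNReal.rpow_ofNat] at e
  rw [← e]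
  exact pow_le_pow_left' h 2

/-- Almost every time slice of a function in `L^∞(0,T;H^s) ∩ L²(0,T;H^{s+1})` has finite
`H^{s+1}` norm. -/
lemma ae_sobolevENorm_lt_top {s M : ℝ} (hu : JointlyMeasurable T u)
    (h1 : timeENorm ⊤ T (sobolevENorm s) u ≤ ENNReal.ofReal M)
    (h2 : timeENorm 2 T (sobolevENorm (s + 1)) u ≤ ENNReal.ofReal M) :
    ∀ᵐ t ∂(volume.restrict (Ioo 0 T)), sobolevENorm (s + 1) (u t) < ⊤ := by
  have hu2 : ∀ᵐ t ∂(volume.restrict (Ioo 0 T)), MemLp (u t) 2 := by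
    filter_upwards [ae_sobolevENorm_le h1] with t ht
    exact memLp_of_sobolevENorm_lt_top (ht.trans_lt ENNReal.ofReal_lt_top)
  have hm := aemeasurable_sobolevENorm hu hu2 (s + 1)
  have hfin : ∫⁻ t in Ioo 0 T, sobolevENorm (s + 1) (u t) ^ 2 ≠ ⊤ :=
    ((lintegral_sq_le_of_timeENorm h2).trans_lt (by finiteness)).ne
  filter_upwards [ae_lt_top' (hm.pow_const 2) hfin] with t ht
  by_contra h
  rw [not_lt_top_iff.mp h] at ht
  simp at ht

lemma gradient_const_mul {c : ℝ} {ψ : Eucl d → ℝ} (hψ : Differentiable ℝ ψ) (x : Eucl d) :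
    gradient (fun y => c * ψ y) x = c • gradient ψ x := by
  ext i
  rw [PiLp.smul_apply, gradient_apply, gradient_apply, fderiv_const_mul (hψ x)]
  rfl

/-- A weak solution whose flux has a square integrable divergence `q` is the time integral
of `q`, as a curve in `L²`. -/
theorem IsWeakSolution.exists_integral_eq
    {J : (Eucl d → ℝ) → Eucl d → Eucl d} {u₀ : Eucl d → ℝ} (hT : 0 < T)
    (hw : IsWeakSolution T J u₀ u) (hu₀ : MemLp u₀ 2) {A B : ℝ≥0∞} (hA : A ≠ ⊤) (hB : B ≠ ⊤)
    {q : ℝ → Eucl d → ℝ} {N : ℝ → ℝ≥0∞} (hN : ∫⁻ t in Ioo 0 T, N t ^ 2 < ⊤)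
    (hu2 : ∀ᵐ t ∂(volume.restrict (Ioo 0 T)), MemLp (u t) 2 ∧ eLpNorm (u t) 2 ≤ A)
    (hq2 : ∀ᵐ t ∂(volume.restrict (Ioo 0 T)), MemLp (q t) 2 ∧
      eLpNorm (q t) 2 ≤ A + B * N t)
    (hJ : ∀ᵐ t ∂(volume.restrict (Ioo 0 T)), ∀ ψ : Eucl d → ℝ, ContDiff ℝ ∞ ψ →
      HasCompactSupport ψ → Integrable (fun x => inner ℝ (J (u t) x) (gradient ψ x)) ∧
        ∫ x, inner ℝ (J (u t) x) (gradient ψ x) = -∫ x, ψ x * q t x)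
    (hm : ∀ ψ : Eucl d → ℝ, ContDiff ℝ ∞ ψ → HasCompactSupport ψ → AEStronglyMeasurable
      (fun t => ∫ x, inner ℝ (J (u t) x) (gradient ψ x)) (volume.restrict (Ioo 0 T))) :
    ∃ g : ℝ → Lp ℝ 2 (volume : Measure (Eucl d)), Integrable g ∧
      (∀ᵐ t ∂(volume.restrict (Ioo 0 T)), g t = toL2 (q t)) ∧
      ∀ᵐ t ∂(volume.restrict (Ioo 0 T)), toL2 (u t) = toL2 u₀ + ∫ τ in (0)..t, g τ := by
  set μ : Measure ℝ := volume.restrict (Ioo 0 T) with hμ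
  have : IsFiniteMeasure μ := by rw [hμ]; infer_instance
  have hUm : AEStronglyMeasurable (fun t => toL2 (u t)) μ :=
    aestronglyMeasurable_toL2_of_joint hw.measurable (hu2.mono fun t h => h.1)
  have hqm : AEStronglyMeasurable (fun t => toL2 (q t)) μ := by
    refine aestronglyMeasurable_toL2 (hq2.mono fun t h => h.1) fun ψ hψ hc => ?_
    refine (hm ψ hψ hc).neg.congr ?_
    filter_upwards [hJ] with t ht
    rw [Pi.neg_apply, (ht ψ hψ hc).2, neg_neg]
  have hUi : IntegrableOn (fun t => toL2 (u t)) (Ioo 0 T) := by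
    refine ⟨hUm, ?_⟩
    calc ∫⁻ t, ‖toL2 (u t)‖ₑ ∂μ ≤ ∫⁻ t, A ∂μ := by
          refine lintegral_mono_ae ?_
          filter_upwards [hu2] with t ht
          rw [norm_toL2 ht.1]
          exact ht.2
      _ < ⊤ := by
          rw [lintegral_const]
          finiteness
  have hqi : IntegrableOn (fun t => toL2 (q t)) (Ioo 0 T) := by
    refine ⟨hqm, ?_⟩
    -- On the bounded time interval this turns square integrability of `N` into integrability of the
    -- time derivative.
    have hb : ∀ x : ℝ≥0∞, x ≤ 1 + x ^ 2 := fun x => by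
      rcases le_total x 1 with h | h
      · exact h.trans le_self_add
      · exact (le_self_pow₀ h two_ne_zero).trans le_add_self
    calc ∫⁻ t, ‖toL2 (q t)‖ₑ ∂μ
        ≤ ∫⁻ t, (A + B) + B * N t ^ 2 ∂μ := by
          refine lintegral_mono_ae ?_
          filter_upwards [hq2] with t ht
          rw [norm_toL2 ht.1]
          refine ht.2.trans ?_
          calc A + B * N t
              ≤ A + B * (1 + N t ^ 2) := by gcongr; exact hb _
            _ = _ := by ring
      _ = (A + B) * μ univ +
            B * ∫⁻ t, N t ^ 2 ∂μ := by
          rw [lintegral_add_left measurable_const, lintegral_const,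
            lintegral_const_mul' _ _ hB]
      _ < ⊤ := by finiteness
  refine ⟨(Ioo 0 T).indicator fun t => toL2 (q t), hqi.integrable_indicator measurableSet_Ioo,
    ?_, ?_⟩
  · rw [hμ, ae_restrict_iff' measurableSet_Ioo]
    exact Filter.Eventually.of_forall fun t ht => indicator_of_mem ht _
  refine ae_eq_add_integral_of_weak_deriv hT dense_testSpace hUi
    (hqi.integrable_indicator measurableSet_Ioo) fun η hη hηc hηs z hz => ?_
  obtain ⟨ψ, hψ, hc, hzψ⟩ := hz
  have hη1 : Differentiable ℝ η := hη.differentiable (by norm_num)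
  have hψ1 : Differentiable ℝ ψ := hψ.differentiable (by norm_num)
  have hts : tsupport (fun p : ℝ × Eucl d => η p.1 * ψ p.2) ⊆ tsupport η ×ˢ tsupport ψ := by
    refine closure_minimal (fun p hp => ?_) ((isClosed_tsupport η).prod (isClosed_tsupport ψ))
    exact ⟨subset_tsupport _ (left_ne_zero_of_mul hp), subset_tsupport _ (right_ne_zero_of_mul hp)⟩
  have hweak := hw.weak_form (fun p => η p.1 * ψ p.2)
    ((hη.comp contDiff_fst).mul (hψ.comp contDiff_snd))
    (HasCompactSupport.of_support_subset_isCompact (hηc.isCompact.prod hc.isCompact)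
      ((subset_tsupport _).trans hts))
    (hts.trans (prod_mono hηs (subset_univ _)))
  have e0 : inner ℝ z (toL2 u₀) = ∫ x, ψ x * u₀ x :=
    inner_eq_integral_of_ae_eq hzψ (coeFn_toL2 hu₀)
  have e1 : ∫ x, u₀ x * (η 0 * ψ x) = η 0 * inner ℝ z (toL2 u₀) := by
    rw [e0, ← integral_const_mul]
    congr 1
    ext x
    ring
  simp only [e1] at hweak
  refine Eq.trans ?_ hweak
  congr 1
  refine integral_congr_ae ?_
  filter_upwards [hu2, hq2, hJ, ae_restrict_mem measurableSet_Ioo] with t h2 h3 h4 ht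
  obtain ⟨hJi, hJe⟩ := h4 ψ hψ hc
  have hψ2 : MemLp ψ 2 := memLp_of_continuous_compactSupport hψ.continuous hc 2
  have iu : Integrable fun x => ψ x * u t x := hψ2.integrable_mul h2.1
  rw [indicator_of_mem ht, inner_eq_integral_of_ae_eq hzψ (coeFn_toL2 h2.1),
    inner_eq_integral_of_ae_eq hzψ (coeFn_toL2 h3.1)]
  have hd : ∀ x, deriv (fun τ => η τ * ψ x) t = deriv η t * ψ x := fun x =>
    deriv_mul_const (hη1 t) _
  simp only [hd, gradient_const_mul hψ1, inner_smul_right]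
  have e2 : ∀ x, u t x * (deriv η t * ψ x) = deriv η t * (ψ x * u t x) := fun x => by ring
  simp only [e2]
  rw [integral_sub (iu.const_mul _) (hJi.const_mul _), integral_const_mul, integral_const_mul, hJe]
  ring

end Evolution

/-- A regular representative with quantitative bounds on its `L²` norms. -/
structure IsSobolevRep (B : ℝ) (N : ℝ≥0∞) (f h : Eucl d → ℝ) : Prop
    extends IsRegularRep B f h where
  eLpNorm_le : eLpNorm h 2 ≤ ENNReal.ofReal B
  eLpNorm_gradient_le : eLpNorm (gradient h) 2 ≤ ENNReal.ofReal B
  eLpNorm_hessian_le : eLpNorm (fderiv ℝ (gradient h)) 2 ≤ N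

lemma IsRegularRep.mono {B B' : ℝ} {f h : Eucl d → ℝ} (hh : IsRegularRep B f h) (hB : B ≤ B') :
    IsRegularRep B' f h :=
  { hh with
    abs_le := fun x => (hh.abs_le x).trans hB
    norm_gradient_le := fun x => (hh.norm_gradient_le x).trans hB }

/-- The time slices of a function in `L^∞(0,T;H^s) ∩ L²(0,T;H^{s+1})` have regular
representatives. -/
theorem exists_slices {s : ℝ} (hs : (d : ℝ) / 2 + 1 < s) :
    ∃ K : NNReal, ∀ (M T : ℝ) (u : ℝ → Eucl d → ℝ), JointlyMeasurable T u →
      timeENorm ⊤ T (sobolevENorm s) u ≤ ENNReal.ofReal M →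
      timeENorm 2 T (sobolevENorm (s + 1)) u ≤ ENNReal.ofReal M →
      ∃ h : ℝ → Eucl d → ℝ, ∀ᵐ t ∂(volume.restrict (Ioo 0 T)),
        IsSobolevRep ((K + 1) * max M 0) (K * sobolevENorm (s + 1) (u t)) (u t) (h t) := by
  obtain ⟨K, hK⟩ := exists_isRegularRep (d := d) hs
  refine ⟨K, fun M T u hu h1 h2 => ?_⟩
  -- Nothing is asked at the exceptional times, where 0 is taken; this lets one representative be
  -- chosen for every `t`.
  have hex : ∀ t, ∃ h : Eucl d → ℝ, sobolevENorm s (u t) ≤ ENNReal.ofReal M →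
      sobolevENorm (s + 1) (u t) < ⊤ →
        IsSobolevRep ((K + 1) * max M 0) (K * sobolevENorm (s + 1) (u t)) (u t) h := fun t => by
    by_cases hc : sobolevENorm s (u t) ≤ ENNReal.ofReal M ∧ sobolevENorm (s + 1) (u t) < ⊤
    · have hM : ENNReal.ofReal M ≤ ENNReal.ofReal (max M 0) :=
        ENNReal.ofReal_le_ofReal (le_max_left _ _)
      obtain ⟨h, r1, r2, r3, r4⟩ := hK (max M 0) (u t) (le_max_right _ _) (hc.1.trans hM) hc.2
      have hK0 : (0 : ℝ) ≤ K := K.2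
      have hM0 : 0 ≤ max M 0 := le_max_right _ _
      have l1 : K * max M 0 ≤ (K + 1) * max M 0 := by nlinarith
      have l2 : max M 0 ≤ (K + 1) * max M 0 := by nlinarith
      exact ⟨h, fun _ _ => ⟨r1.mono l1, r2.trans (ENNReal.ofReal_le_ofReal l2),
        r3.trans (ENNReal.ofReal_le_ofReal l1), r4⟩⟩
    · exact ⟨0, fun c1 c2 => absurd ⟨c1, c2⟩ hc⟩
  choose h hh using hex
  refine ⟨h, ?_⟩
  filter_upwards [ae_sobolevENorm_le h1, ae_sobolevENorm_lt_top hu h1 h2] with t t1 t2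
  exact hh t t1 t2

lemma eLpNorm_divergence_le (J : Eucl d → Eucl d) :
    eLpNorm (divergence J) 2 ≤ d * eLpNorm (fderiv ℝ J) 2 := by
  have := eLpNorm_le_mul_eLpNorm_of_ae_le_mul (μ := (volume : Measure (Eucl d)))
    (Filter.Eventually.of_forall (abs_divergence_le J)) 2
  simpa using this

/-- This is the form in which the weak formulation is turned into an equation with right-hand side
in L²: the test gradient is traded for the divergence of the regular flux. -/
lemma IsRegularRep.integrable_inner_flux {a B : ℝ} {f h : Eucl d → ℝ} {P J : Eucl d → Eucl d}
    (ha : 0 ≤ a) (hh : IsRegularRep B f h) (hP : ContDiff ℝ 1 P) (hP2 : MemLp P 2)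
    (hP' : MemLp (fderiv ℝ P) 2) (hJ : J =ᵐ[volume] flux a h P) {ψ : Eucl d → ℝ}
    (hψ : ContDiff ℝ ∞ ψ) (hc : HasCompactSupport ψ) :
    Integrable (fun x => inner ℝ (J x) (gradient ψ x)) ∧
      ∫ x, inner ℝ (J x) (gradient ψ x) = -∫ x, ψ x * divergence (flux a h P) x := by
  have hψ1 : ContDiff ℝ 1 ψ := hψ.of_le (by exact_mod_cast le_top)
  have hψ2 : MemLp ψ 2 := memLp_of_continuous_compactSupport hψ.continuous hc 2
  have hψ' : MemLp (gradient ψ) 2 :=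
    memLp_of_continuous_compactSupport (continuous_gradient hψ1) (hasCompactSupport_gradient hc) 2
  have e : (fun x => inner ℝ (J x) (gradient ψ x)) =ᵐ[volume]
      fun x => inner ℝ (flux a h P x) (gradient ψ x) := by
    filter_upwards [hJ] with x hx
    rw [hx]
  refine ⟨(integrable_inner_of_memLp (hh.memLp_flux hP2) hψ').congr e.symm, ?_⟩
  rw [integral_congr_ae e, hh.integral_mul_divergence_flux ha hP hP2 hP'
    (hψ1.differentiable (by norm_num)) hψ2 hψ', neg_neg]

lemma contDiff_gradient_of_smooth {ψ : Eucl d → ℝ} (hψ : ContDiff ℝ ∞ ψ) :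
    ContDiff ℝ 1 (gradient ψ) :=
  contDiff_gradient (n := 2) (contDiff_infty.mp hψ 2) (by norm_num)

section Evolution

variable {T a B : ℝ} {u h : ℝ → Eucl d → ℝ} {u₀ : Eucl d → ℝ} {N : ℝ → ℝ≥0∞}

/-- The evolution equation in `L²` of a weak solution with a regular flux. -/
theorem IsWeakSolution.exists_integral_eq_flux {J : (Eucl d → ℝ) → Eucl d → Eucl d} (hT : 0 < T)
    (ha : 0 ≤ a) (hw : IsWeakSolution T J u₀ u) (hu₀ : MemLp u₀ 2)
    (hN : ∫⁻ t in Ioo 0 T, N t ^ 2 < ⊤)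
    (hh : ∀ᵐ t ∂(volume.restrict (Ioo 0 T)), IsSobolevRep B (N t) (u t) (h t))
    {P : ℝ → Eucl d → Eucl d} {α γ : ℝ≥0∞} (hα : α ≠ ⊤) (hγ : γ ≠ ⊤)
    (hP : ∀ᵐ t ∂(volume.restrict (Ioo 0 T)), ContDiff ℝ 1 (P t) ∧ MemLp (P t) 2 ∧
      MemLp (fderiv ℝ (P t)) 2)
    (hPα : ∀ᵐ t ∂(volume.restrict (Ioo 0 T)), eLpNorm (P t) 2 ≤ α ∧
      eLpNorm (fderiv ℝ (P t)) 2 ≤ α + γ * N t)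
    (hJ : ∀ᵐ t ∂(volume.restrict (Ioo 0 T)), J (u t) =ᵐ[volume] flux a (h t) (P t))
    (hm : ∀ ψ : Eucl d → ℝ, ContDiff ℝ ∞ ψ → HasCompactSupport ψ → AEStronglyMeasurable
      (fun t => ∫ x, inner ℝ (J (u t) x) (gradient ψ x)) (volume.restrict (Ioo 0 T))) :
    ∃ g : ℝ → Lp ℝ 2 (volume : Measure (Eucl d)), Integrable g ∧
      (∀ᵐ t ∂(volume.restrict (Ioo 0 T)), g t = toL2 (divergence (flux a (h t) (P t)))) ∧
      ∀ᵐ t ∂(volume.restrict (Ioo 0 T)), toL2 (u t) = toL2 u₀ + ∫ τ in (0)..t, g τ := by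
  -- The terms free of `N t` and, next, the coefficient of `N t` in the bound for the divergence.
  -- The additional first summand lets the same constant bound the L² norm of the solution.
  have hA : ENNReal.ofReal B + d * (ENNReal.ofReal B * α + ENNReal.ofReal B * α) ≠ ⊤ := by
    finiteness
  have hA' : d * (ENNReal.ofReal a + ENNReal.ofReal B * γ) ≠ ⊤ := by finiteness
  refine hw.exists_integral_eq (q := fun t => divergence (flux a (h t) (P t))) (N := N) hT hu₀ hA
    hA' hN ?_ ?_ ?_ hm
  · filter_upwards [hh] with t ht
    refine ⟨ht.memLp.ae_eq ht.ae_eq.symm, ?_⟩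
    rw [eLpNorm_congr_ae ht.ae_eq]
    exact ht.eLpNorm_le.trans le_self_add
  · filter_upwards [hh, hP, hPα] with t ht h1 h2
    refine ⟨memLp_divergence (ht.memLp_fderiv_flux ha h1.1 h1.2.1 h1.2.2), ?_⟩
    have key : eLpNorm (fderiv ℝ (flux a (h t) (P t))) 2 ≤ ENNReal.ofReal a * N t +
        ENNReal.ofReal B * (α + γ * N t) + ENNReal.ofReal B * α := by
      refine (ht.eLpNorm_fderiv_flux_le ha h1.1).trans ?_
      gcongr
      exacts [ht.eLpNorm_hessian_le, h2.2, h2.1]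
    refine (eLpNorm_divergence_le _).trans ((mul_le_mul_right key _).trans ?_)
    have e : (d : ℝ≥0∞) * (ENNReal.ofReal a * N t + ENNReal.ofReal B * (α + γ * N t) +
        ENNReal.ofReal B * α) = d * (ENNReal.ofReal B * α + ENNReal.ofReal B * α) +
          d * (ENNReal.ofReal a + ENNReal.ofReal B * γ) * N t := by ring
    rw [e, add_assoc]
    exact le_add_self
  · filter_upwards [hh, hP, hJ] with t ht h1 h2 ψ hψ hc
    exact ht.integrable_inner_flux ha h1.1 h1.2.1 h1.2.2 h2 hψ hc

/-- The limiting flux is the gradient of `a h - b h²`. -/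
lemma IsRegularRep.integral_inner_limitFlux {b : ℝ} {f h : Eucl d → ℝ} (hh : IsRegularRep B f h)
    {ψ : Eucl d → ℝ} (hψ : ContDiff ℝ ∞ ψ) (hc : HasCompactSupport ψ) :
    ∫ x, inner ℝ (limitFlux a b f x) (gradient ψ x) =
      -∫ x, divergence (gradient ψ) x * (a * f x - b * f x ^ 2) := by
  have hg := contDiff_gradient_of_smooth hψ
  have hgc := hasCompactSupport_gradient hc
  have hΘ : (gradient fun x => a * h x - b * h x ^ 2) =
      flux a h fun x => (2 * b) • gradient h x := by
    have hβ : ∀ y : ℝ, HasDerivAt (fun y => a * y - b * y ^ 2) (a - 2 * b * y) y := fun y => by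
      have := ((hasDerivAt_id y).const_mul a).sub ((hasDerivAt_pow 2 y).const_mul b)
      refine this.congr_deriv ?_
      simp only [Nat.cast_ofNat, Nat.reduceSub, pow_one, mul_one]
      ring
    rw [gradient_comp_real (β := fun y => a * y - b * y ^ 2) (fun y => (hβ y).differentiableAt)
      hh.differentiable]
    ext1 x
    simp only [flux, (hβ _).deriv, smul_smul, sub_smul]
    ring_nf
  have hΘ2 : MemLp (fun x => a * h x - b * h x ^ 2) 2 := by
    simp only [sq]
    exact (hh.memLp.const_mul a).sub
      ((memLp_smul_of_bounded hh.contDiff.continuous hh.abs_le hh.memLp).const_mul b)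
  have key := integral_mul_divergence (φ := fun x => a * h x - b * h x ^ 2) (J := gradient ψ)
    (((hh.differentiable.const_mul a)).sub ((hh.differentiable.pow 2).const_mul b))
    (hg.differentiable (by norm_num)) hΘ2
    (hΘ ▸ hh.memLp_flux (hh.memLp_smul_gradient (2 * b)))
    (memLp_of_continuous_compactSupport hg.continuous hgc 2)
    (memLp_of_continuous_compactSupport (hg.continuous_fderiv (by norm_num)) (hgc.fderiv ℝ) 2)
  have e1 : ∫ x, inner ℝ (limitFlux a b f x) (gradient ψ x) =
      ∫ x, inner ℝ (gradient ψ x) (gradient (fun x => a * h x - b * h x ^ 2) x) := by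
    refine integral_congr_ae ?_
    filter_upwards [limitFlux_ae_eq a b hh.ae_eq hh.contDiff_one] with x hx
    rw [hx, hΘ, real_inner_comm]
  have e2 : ∫ x, divergence (gradient ψ) x * (a * f x - b * f x ^ 2) =
      ∫ x, (a * h x - b * h x ^ 2) * divergence (gradient ψ) x := by
    refine integral_congr_ae ?_
    filter_upwards [hh.ae_eq] with x hx
    rw [hx, mul_comm]
  rw [e1, e2, key, neg_neg]

lemma continuous_divergence {J : Eucl d → Eucl d} (hJ : ContDiff ℝ 1 J) :
    Continuous (divergence J) := by
  have := hJ.continuous_fderiv (by norm_num)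
  unfold divergence
  fun_prop

/-- The evolution equation in `L²` of a solution of the limiting problem. -/
theorem IsWeakSolution.exists_integral_eq_limit {b : ℝ} (hT : 0 < T) (ha : 0 ≤ a)
    (hw : IsWeakSolution T (limitFlux a b) u₀ u) (hu₀ : MemLp u₀ 2)
    (hN : ∫⁻ t in Ioo 0 T, N t ^ 2 < ⊤)
    (hh : ∀ᵐ t ∂(volume.restrict (Ioo 0 T)), IsSobolevRep B (N t) (u t) (h t)) :
    ∃ g : ℝ → Lp ℝ 2 (volume : Measure (Eucl d)), Integrable g ∧
      (∀ᵐ t ∂(volume.restrict (Ioo 0 T)), g t =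
        toL2 (divergence (flux a (h t) fun x => (2 * b) • gradient (h t) x))) ∧
      ∀ᵐ t ∂(volume.restrict (Ioo 0 T)), toL2 (u t) = toL2 u₀ + ∫ τ in (0)..t, g τ := by
  refine hw.exists_integral_eq_flux (P := fun t x => (2 * b) • gradient (h t) x) hT ha hu₀ hN hh
    (α := ‖2 * b‖ₑ * ENNReal.ofReal B) (γ := ‖2 * b‖ₑ) (by finiteness) (by finiteness) ?_ ?_ ?_
    fun ψ hψ hc => ?_
  · filter_upwards [hh] with t ht
    exact ⟨ht.contDiff_smul_gradient _, ht.memLp_smul_gradient _, ht.memLp_fderiv_smul_gradient _⟩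
  · filter_upwards [hh] with t ht
    constructor
    · refine (eLpNorm_const_smul (2 * b) (gradient (h t)) 2 volume).trans_le ?_
      gcongr
      exact ht.eLpNorm_gradient_le
    · rw [ht.fderiv_smul_gradient]
      refine (eLpNorm_const_smul (2 * b) (fderiv ℝ (gradient (h t))) 2 volume).trans_le ?_
      exact le_add_left (by gcongr; exact ht.eLpNorm_hessian_le)
  · filter_upwards [hh] with t ht
    exact limitFlux_ae_eq a b ht.ae_eq ht.contDiff_one
  -- The weak gradient is chosen separately at each time, so its measurability in time is not
  -- available. Two integrations by parts express the pairing as −∫ Δψ (au − bu²), which involves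
  -- only the jointly measurable `u`.
  · have hu' : JointlyMeasurable T fun t x => a * u t x - b * u t x ^ 2 :=
      (by fun_prop : Continuous fun y : ℝ => a * y - b * y ^ 2).comp_aestronglyMeasurable
        hw.measurable
    have hg := contDiff_gradient_of_smooth hψ
    refine (aestronglyMeasurable_integral_mul hu' (continuous_divergence hg)).neg.congr ?_
    filter_upwards [hh] with t ht
    rw [Pi.neg_apply, ht.integral_inner_limitFlux hψ hc]

/-- The strongly measurable version `v` of `u` makes the convolution jointly measurable at every
point; for almost every time its slice agrees with that of `u` almost everywhere, and the integrals
see no difference. -/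
lemma aestronglyMeasurable_integral_inner_velocity (hu : JointlyMeasurable T u) {W : Eucl d → ℝ}
    (hW : ContDiff ℝ 2 W) {G : Eucl d → Eucl d} (hG : Continuous G) :
    AEStronglyMeasurable (fun t => ∫ x, u t x * inner ℝ (velocity W (u t) x) (G x))
      (volume.restrict (Ioo 0 T)) := by
  have hWg : Continuous (gradient W) := continuous_gradient (hW.of_le (by norm_num))
  set v : ℝ × Eucl d → ℝ := hu.mk _
  have hvm : StronglyMeasurable v := hu.stronglyMeasurable_mk
  have hvel : StronglyMeasurable fun p : ℝ × Eucl d => ∫ y, v (p.1, y) • gradient W (p.2 - y) := by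
    have : StronglyMeasurable fun p : (ℝ × Eucl d) × Eucl d =>
        v (p.1.1, p.2) • gradient W (p.1.2 - p.2) :=
      (hvm.comp_measurable (by fun_prop)).smul
        (hWg.comp (by fun_prop : Continuous fun p : (ℝ × Eucl d) × Eucl d =>
          p.1.2 - p.2)).stronglyMeasurable
    exact this.integral_prod_right
  have hmeas : StronglyMeasurable fun t =>
      ∫ x, v (t, x) * inner ℝ (∫ y, v (t, y) • gradient W (x - y)) (G x) := by
    have : StronglyMeasurable fun p : ℝ × Eucl d =>
        v p * inner ℝ (∫ y, v (p.1, y) • gradient W (p.2 - y)) (G p.2) :=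
      hvm.mul (hvel.inner (hG.comp continuous_snd).stronglyMeasurable)
    exact this.integral_prod_right
  refine ⟨_, hmeas, ?_⟩
  filter_upwards [Measure.ae_ae_of_ae_prod hu.ae_eq_mk] with t ht
  have hvt : ∀ x, velocity W (u t) x = ∫ y, v (t, y) • gradient W (x - y) := fun x =>
    convolution_congr_ae_left _ ht _ x
  refine integral_congr_ae ?_
  filter_upwards [ht] with x hx
  have hx' : u t x = v (t, x) := hx
  rw [hvt, hx']

/-- The evolution equation in `L²` of a solution of the nonlocal problem. -/
theorem IsWeakSolution.exists_integral_eq_nonlocal {W : Eucl d → ℝ} (hT : 0 < T) (ha : 0 ≤ a)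
    (hW : ContDiff ℝ 2 W) (hWc : HasCompactSupport W)
    (hw : IsWeakSolution T (nonlocalFlux a W) u₀ u) (hu₀ : MemLp u₀ 2)
    (hN : ∫⁻ t in Ioo 0 T, N t ^ 2 < ⊤)
    (hh : ∀ᵐ t ∂(volume.restrict (Ioo 0 T)), IsSobolevRep B (N t) (u t) (h t)) :
    ∃ g : ℝ → Lp ℝ 2 (volume : Measure (Eucl d)), Integrable g ∧
      (∀ᵐ t ∂(volume.restrict (Ioo 0 T)), g t =
        toL2 (divergence (flux a (h t) (velocity W (h t))))) ∧
      ∀ᵐ t ∂(volume.restrict (Ioo 0 T)), toL2 (u t) = toL2 u₀ + ∫ τ in (0)..t, g τ := by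
  set I₁ := ∫⁻ z, ‖gradient W z‖ₑ
  set I₂ := ∫⁻ z, ‖fderiv ℝ (gradient W) z‖ₑ
  have hI₁ : I₁ < ⊤ := lintegral_enorm_lt_top_of_compactSupport
    (continuous_gradient (hW.of_le (by norm_num))) (hasCompactSupport_gradient hWc)
  have hI₂ : I₂ < ⊤ := lintegral_enorm_hessian_lt_top hW hWc
  refine hw.exists_integral_eq_flux (P := fun t => velocity W (h t)) hT ha hu₀ hN hh
    (α := (I₁ + I₂) * ENNReal.ofReal B) (γ := 0) (by finiteness) (by finiteness) ?_ ?_ ?_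
    fun ψ hψ hc => ?_
  · filter_upwards [hh] with t ht
    exact ⟨contDiff_velocity hW hWc ht.contDiff.continuous,
      memLp_velocity hW hWc ht.contDiff.continuous ht.memLp,
      memLp_fderiv_velocity hW hWc ht.contDiff.continuous ht.memLp⟩
  · filter_upwards [hh] with t ht
    rw [zero_mul, add_zero]
    constructor
    · refine (eLpNorm_velocity_le hW ht.contDiff.continuous).trans ?_
      gcongr
      exacts [le_self_add, ht.eLpNorm_le]
    · refine (eLpNorm_fderiv_velocity_le hW hWc ht.contDiff.continuous).trans ?_
      gcongr
      exacts [le_add_self, ht.eLpNorm_le]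
  · filter_upwards [hh] with t ht
    exact nonlocalFlux_ae_eq a W ht.ae_eq ht.contDiff_one
  · have hg := contDiff_gradient_of_smooth hψ
    have hgc := hasCompactSupport_gradient hc
    have hg2 := memLp_of_continuous_compactSupport hg.continuous hgc 2
    -- The pairing is −a∫uΔψ − ∫u(∇W * u)·∇ψ, free of weak gradients: the drift already has its
    -- derivative on the smooth kernel.
    refine (((aestronglyMeasurable_integral_mul hw.measurable
      (continuous_divergence hg)).const_mul (-a)).sub
      (aestronglyMeasurable_integral_inner_velocity hw.measurable hW hg.continuous)).congr ?_
    filter_upwards [hh] with t ht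
    have hv : ∀ x, velocity W (u t) x = velocity W (h t) x := fun x =>
      convolution_congr_ae_left _ ht.ae_eq _ x
    have e1 : ∫ x, divergence (gradient ψ) x * u t x =
        -∫ x, inner ℝ (gradient (h t) x) (gradient ψ x) := by
      have e := integral_mul_divergence (φ := h t) (J := gradient ψ) ht.differentiable
        (hg.differentiable (by norm_num)) ht.memLp ht.memLp_gradient hg2
        (memLp_of_continuous_compactSupport (hg.continuous_fderiv (by norm_num)) (hgc.fderiv ℝ) 2)
      simp only [real_inner_comm (gradient ψ _)]
      rw [← e]
      refine integral_congr_ae ?_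
      filter_upwards [ht.ae_eq] with x hx
      rw [hx, mul_comm]
    have e2 : ∫ x, u t x * inner ℝ (velocity W (u t) x) (gradient ψ x) =
        ∫ x, inner ℝ (h t x • velocity W (h t) x) (gradient ψ x) := by
      refine integral_congr_ae ?_
      filter_upwards [ht.ae_eq] with x hx
      rw [hx, hv, real_inner_smul_left]
    have e3 : ∫ x, inner ℝ (nonlocalFlux a W (u t) x) (gradient ψ x) =
        ∫ x, (a * inner ℝ (gradient (h t) x) (gradient ψ x) -
          inner ℝ (h t x • velocity W (h t) x) (gradient ψ x)) := by
      refine integral_congr_ae ?_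
      filter_upwards [nonlocalFlux_ae_eq a W ht.ae_eq ht.contDiff_one] with x hx
      rw [hx, flux, inner_sub_left, real_inner_smul_left]
    rw [Pi.sub_apply, e1, e2, e3, integral_sub, integral_const_mul, neg_mul_neg]
    · exact (integrable_inner_of_memLp ht.memLp_gradient hg2).const_mul a
    · exact integrable_inner_of_memLp (memLp_smul_of_bounded ht.contDiff.continuous ht.abs_le
        (memLp_velocity hW hWc ht.contDiff.continuous ht.memLp)) hg2

end Evolution

/-! ### The maximum principle for the limiting problem. -/

/-- A smooth monotone step between `κ` and `m`. -/
lemma exists_smooth_step {κ m : ℝ} (hκm : κ < m) :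
    ∃ (β : ℝ → ℝ) (L : NNReal), ContDiff ℝ 1 β ∧ LipschitzWith L β ∧ (∀ y, |deriv β y| ≤ L) ∧
      (∀ y, 0 ≤ deriv β y) ∧ (∀ y, m < y → deriv β y = 0) ∧ (∀ y, y ≤ κ → β y = 0) ∧
      ∀ y, κ < y → 0 < β y := by
  have hpos : 0 < m - κ := sub_pos.mpr hκm
  set β : ℝ → ℝ := fun y => Real.smoothTransition ((y - κ) / (m - κ)) with hβ
  have hC : ContDiff ℝ 1 β := Real.smoothTransition.contDiff.comp
    ((contDiff_id.sub contDiff_const).div_const _)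
  have hd1 : ∀ y, m < y → deriv β y = 0 := fun y hy => by
    have : β =ᶠ[nhds y] fun _ => 1 := by
      filter_upwards [Ioi_mem_nhds hy] with z hz
      exact Real.smoothTransition.one_of_one_le
        ((one_le_div hpos).mpr (sub_le_sub_right (le_of_lt hz) κ))
    rw [this.deriv_eq, deriv_const]
  have h0 : ∀ y, y ≤ κ → β y = 0 := fun y hy =>
    Real.smoothTransition.zero_of_nonpos (div_nonpos_of_nonpos_of_nonneg (by linarith) hpos.le)
  have hd0 : ∀ y, y < κ → deriv β y = 0 := fun y hy => by
    have : β =ᶠ[nhds y] fun _ => 0 := by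
      filter_upwards [Iio_mem_nhds hy] with z hz using h0 z (le_of_lt hz)
    rw [this.deriv_eq, deriv_const]
  have hmono : Monotone β := fun y z hyz => Real.smoothTransition.monotone (by gcongr)
  obtain ⟨L, hL⟩ := (isCompact_Icc (a := κ) (b := m)).exists_bound_of_continuousOn
    (hC.continuous_deriv (by norm_num)).continuousOn
  have hbound : ∀ y, ‖deriv β y‖ ≤ (L.toNNReal : ℝ) := fun y => by
    rcases lt_or_ge y κ with h | h
    · simp [hd0 y h]
    rcases lt_or_ge m y with h' | h'
    · simp [hd1 y h']
    · exact (hL y ⟨h, h'⟩).trans (Real.le_coe_toNNReal L)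
  exact ⟨β, L.toNNReal, hC, lipschitzWith_of_nnnorm_deriv_le (hC.differentiable (by norm_num))
    fun y => hbound y, hbound, fun y => hmono.deriv_nonneg, hd1, h0,
    fun y hy => Real.smoothTransition.pos_of_pos (div_pos (by linarith) hpos)⟩

section Step

variable {β : ℝ → ℝ} {κ : ℝ}

lemma primitive_eq_zero_of_le (hκ : 0 ≤ κ) (h0 : ∀ y, y ≤ κ → β y = 0) {y : ℝ} (hy : y ≤ κ) :
    ∫ τ in (0)..y, β τ = 0 := by
  refine intervalIntegral.integral_zero_ae (Filter.Eventually.of_forall fun τ hτ => h0 τ ?_)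
  exact hτ.2.trans (max_le hκ hy)

lemma primitive_pos_of_lt (hβ : Continuous β) (hκ : 0 ≤ κ) (h0 : ∀ y, y ≤ κ → β y = 0)
    (hpos : ∀ y, κ < y → 0 < β y) {y : ℝ} (hy : κ < y) : 0 < ∫ τ in (0)..y, β τ := by
  rw [← intervalIntegral.integral_add_adjacent_intervals (hβ.intervalIntegrable 0 κ)
    (hβ.intervalIntegrable κ y), primitive_eq_zero_of_le hκ h0 le_rfl, zero_add]
  exact intervalIntegral.intervalIntegral_pos_of_pos_on (hβ.intervalIntegrable κ y)
    (fun x hx => hpos x hx.1) hy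

end Step

/-- The maximum principle for the limiting problem. -/
theorem ae_forall_le_of_limit {T a b B κ : ℝ} {u h : ℝ → Eucl d → ℝ} {u₀ : Eucl d → ℝ}
    {N : ℝ → ℝ≥0∞} (ha : 0 ≤ a) (hb : 0 < b) (hκ0 : 0 ≤ κ) (hκ : κ < a / (2 * b))
    (hu₀ : MemLp u₀ 2) (hu₀κ : ∀ᵐ x, u₀ x ≤ κ)
    (hh : ∀ᵐ t ∂(volume.restrict (Ioo 0 T)), IsSobolevRep B (N t) (u t) (h t))
    {g : ℝ → Lp ℝ 2 (volume : Measure (Eucl d))} (hg : Integrable g)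
    (hgq : ∀ᵐ t ∂(volume.restrict (Ioo 0 T)), g t =
      toL2 (divergence (flux a (h t) fun x => (2 * b) • gradient (h t) x)))
    (hgu : ∀ᵐ t ∂(volume.restrict (Ioo 0 T)), toL2 (u t) = toL2 u₀ + ∫ τ in (0)..t, g τ) :
    ∀ᵐ t ∂(volume.restrict (Ioo 0 T)), ∀ x, h t x ≤ κ := by
  -- The step is complete exactly at a/(2b), where the diffusion coefficient a − 2by changes sign;
  -- beyond it β' = 0, so the backward parabolic region does not contribute.
  obtain ⟨β, L, hC, hLip, hL, hd0, hd1, hzero, hpos⟩ := exists_smooth_step hκ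
  have h00 : β 0 = 0 := hzero 0 hκ0
  have hβL : ∀ y, |β y| ≤ L * |y| := fun y => by
    simpa [h00, Real.dist_eq] using hLip.dist_le_mul y 0
  have hsign : ∀ y, 0 ≤ deriv β y * (a - 2 * b * y) := fun y => by
    rcases le_or_gt y (a / (2 * b)) with hy | hy
    · refine mul_nonneg (hd0 y) ?_
      rw [le_div_iff₀ (by positivity)] at hy
      linarith
    · rw [hd1 y hy, zero_mul]
  have hΦ0 : ∀ y, 0 ≤ ∫ τ in (0)..y, β τ := fun y => by
    rcases le_or_gt y κ with hy | hy
    · rw [primitive_eq_zero_of_le hκ0 hzero hy]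
    · exact (primitive_pos_of_lt hLip.continuous hκ0 hzero hpos hy).le
  have hF0 : integralFunctional β (toL2 u₀) = 0 := by
    refine integral_eq_zero_of_ae ?_
    filter_upwards [coeFn_toL2 hu₀, hu₀κ] with x hx hx'
    rw [hx, primitive_eq_zero_of_le hκ0 hzero hx', Pi.zero_apply]
  have hdiss : ∀ᵐ t ∂(volume.restrict (Ioo 0 T)),
      inner ℝ (hLip.compLp h00 (toL2 u₀ + ∫ τ in (0)..t, g τ)) (g t) ≤ 0 := by
    filter_upwards [hh, hgq, hgu] with t ht h1 h2
    have hu : MemLp (u t) 2 := ht.memLp.ae_eq ht.ae_eq.symm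
    have hq := memLp_divergence (ht.memLp_fderiv_flux ha (ht.contDiff_smul_gradient (2 * b))
      (ht.memLp_smul_gradient _) (ht.memLp_fderiv_smul_gradient _))
    have hcomp : hLip.compLp h00 (toL2 (u t)) =ᵐ[volume] fun x => β (h t x) := by
      filter_upwards [hLip.coeFn_compLp h00 (toL2 (u t)), coeFn_toL2 hu, ht.ae_eq] with x e1 e2 e3
      rw [e1, Function.comp_apply, e2, e3]
    rw [← h2, h1, inner_eq_integral_of_ae_eq hcomp (coeFn_toL2 hq)]
    exact integral_comp_mul_divergence_nonpos ha ht.toIsRegularRep hC hL hβL hsign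
  filter_upwards [hh, hgu, ae_restrict_mem measurableSet_Ioo] with t ht h2 htT
  have hu : MemLp (u t) 2 := ht.memLp.ae_eq ht.ae_eq.symm
  have key := comp_sub_eq_integral_inner (hLip.lipschitzWith_compLp h00)
    (hasFDerivAt_integralFunctional hLip h00) hg (toL2 u₀) t
  have hle : integralFunctional β (toL2 (u t)) ≤ 0 := by
    rw [hF0, sub_zero, ← h2] at key
    rw [key, intervalIntegral.integral_of_le htT.1.le]
    refine integral_nonpos_of_ae ?_
    exact ae_restrict_of_ae_restrict_of_subset (Ioc_subset_Ioo_right htT.2) hdiss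
  -- A nonnegative function with nonpositive integral vanishes almost everywhere, and Φ vanishes
  -- only on values at most κ.
  have hz : (fun x => ∫ τ in (0)..(toL2 (u t) x), β τ) =ᵐ[volume] 0 :=
    (integral_eq_zero_iff_of_nonneg (fun x => hΦ0 _)
      (integrable_primitive_comp hLip h00 _)).mp (le_antisymm hle (integral_nonneg fun x => hΦ0 _))
  have hae : ∀ᵐ x, h t x ≤ κ := by
    filter_upwards [hz, coeFn_toL2 hu, ht.ae_eq] with x e1 e2 e3
    by_contra hx
    rw [e2, e3] at e1
    exact (primitive_pos_of_lt hLip.continuous hκ0 hzero hpos (not_le.mp hx)).ne' e1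
  -- A set of full Lebesgue measure is dense, so for the continuous representative the bound holds
  -- at every point.
  have hdense := Measure.dense_of_ae hae
  have hcl : IsClosed {x | h t x ≤ κ} := isClosed_le ht.contDiff.continuous continuous_const
  intro x
  have := hdense x
  rwa [hcl.closure_eq] at this

/-! ### Energy estimate and comparison of the two solutions. -/

section Energy

variable {H : Type*} [NormedAddCommGroup H] [InnerProductSpace ℝ H] [CompleteSpace H]

/-- Grönwall's inequality in energy form, for the primitive of an integrable function. -/
theorem energy_estimate {T l c A : ℝ} (hl : 0 < l) (hc : 0 ≤ c) {g : ℝ → H} (hg : Integrable g)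
    {D ν : ℝ → ℝ} (hD : ∀ t, 0 ≤ D t) (hν0 : ∀ t, 0 ≤ ν t) (hν : IntegrableOn ν (Ioo 0 T))
    (hA : ∫ t in Ioo 0 T, ν t ≤ A)
    (hineq : ∀ᵐ t ∂(volume.restrict (Ioo 0 T)), 2 * inner ℝ (∫ τ in (0)..t, g τ) (g t) +
      l * D t ≤ ν t + c * ‖∫ τ in (0)..t, g τ‖ ^ 2) (hT : 0 ≤ T) :
    (∀ t ∈ Icc 0 T, ‖∫ τ in (0)..t, g τ‖ ^ 2 ≤ A * Real.exp (c * T)) ∧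
      ∫⁻ t in Ioo 0 T, ENNReal.ofReal (D t) ≤
        ENNReal.ofReal ((A + c * T * (A * Real.exp (c * T))) / l) := by
  have hgi : ∀ x y, IntervalIntegrable g volume x y := fun x y => hg.intervalIntegrable
  have hWc : Continuous fun t => ∫ τ in (0)..t, g τ :=
    intervalIntegral.continuous_primitive hgi 0
  have hEc : Continuous fun t => ‖∫ τ in (0)..t, g τ‖ ^ 2 := hWc.norm.pow 2
  have hA0 : 0 ≤ A := (integral_nonneg hν0).trans hA
  obtain ⟨R, hR⟩ := (isCompact_Icc (a := (0 : ℝ)) (b := T)).exists_bound_of_continuousOn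
    hWc.continuousOn
  have hpi : IntegrableOn (fun t => 2 * inner ℝ (∫ τ in (0)..t, g τ) (g t)) (Ioo 0 T) := by
    refine Integrable.const_mul ?_ 2
    refine (hg.norm.integrableOn.const_mul R).mono'
      (hWc.aestronglyMeasurable.inner hg.1.restrict) ?_
    filter_upwards [ae_restrict_mem measurableSet_Ioo] with t ht
    exact (norm_inner_le_norm _ _).trans
      (mul_le_mul_of_nonneg_right (hR t (Ioo_subset_Icc_self ht)) (norm_nonneg _))
  have hEi : IntegrableOn (fun t => c * ‖∫ τ in (0)..t, g τ‖ ^ 2) (Ioo 0 T) :=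
    ((hEc.continuousOn.integrableOn_Icc (a := 0) (b := T)).mono_set Ioo_subset_Icc_self).const_mul c
  have hνE : IntegrableOn (fun t => ν t + c * ‖∫ τ in (0)..t, g τ‖ ^ 2) (Ioo 0 T) := hν.add hEi
  have hsub : ∀ t ∈ Icc 0 T, Ioo 0 t ⊆ Ioo 0 T := fun t ht => Ioo_subset_Ioo_right ht.2
  have hEeq : ∀ t, 0 ≤ t → ‖∫ τ in (0)..t, g τ‖ ^ 2 =
      ∫ r in Ioo 0 t, 2 * inner ℝ (∫ τ in (0)..r, g τ) (g r) := fun t ht => by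
    rw [norm_sq_integral_eq hg t, intervalIntegral.integral_of_le ht,
      integral_Ioc_eq_integral_Ioo]
  have hgron : ∀ t ∈ Icc 0 T, ‖∫ τ in (0)..t, g τ‖ ^ 2 ≤ A * Real.exp (c * t) := by
    refine le_mul_exp_of_le_add_integral hc hEc fun t ht => ?_
    calc ‖∫ τ in (0)..t, g τ‖ ^ 2
        ≤ ∫ r in Ioo 0 t, (ν r + c * ‖∫ τ in (0)..r, g τ‖ ^ 2) := by
          rw [hEeq t ht.1]
          refine integral_mono_ae (hpi.mono_set (hsub t ht))
            (hνE.mono_set (hsub t ht)) ?_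
          filter_upwards [ae_restrict_of_ae_restrict_of_subset (hsub t ht) hineq] with r hr
          linarith [mul_nonneg hl.le (hD r)]
      _ = (∫ r in Ioo 0 t, ν r) + c * ∫ r in (0)..t, ‖∫ τ in (0)..r, g τ‖ ^ 2 := by
          rw [integral_add (hν.mono_set (hsub t ht)) (hEi.mono_set (hsub t ht)),
            integral_const_mul, intervalIntegral.integral_of_le ht.1,
            integral_Ioc_eq_integral_Ioo]
      _ ≤ A + c * ∫ r in (0)..t, ‖∫ τ in (0)..r, g τ‖ ^ 2 := by
          gcongr
          exact (setIntegral_mono_set hν (Filter.Eventually.of_forall hν0)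
            (Filter.Eventually.of_forall (hsub t ht))).trans hA
  have hbd : ∀ t ∈ Icc 0 T, ‖∫ τ in (0)..t, g τ‖ ^ 2 ≤ A * Real.exp (c * T) := fun t ht =>
    (hgron t ht).trans (by gcongr; exact ht.2)
  refine ⟨hbd, ?_⟩
  -- No measurability of `D` is assumed, so its lower integral is bounded through this integrable
  -- majorant. In the integral of `Q` the last term gives minus the final energy, which is dropped.
  set Q : ℝ → ℝ := fun t => (ν t + c * ‖∫ τ in (0)..t, g τ‖ ^ 2 -
    2 * inner ℝ (∫ τ in (0)..t, g τ) (g t)) / l with hQ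
  have hQi : IntegrableOn Q (Ioo 0 T) := (hνE.sub hpi).div_const l
  have hDQ : ∀ᵐ t ∂(volume.restrict (Ioo 0 T)), D t ≤ Q t := by
    filter_upwards [hineq] with t ht
    rw [hQ, le_div_iff₀ hl]
    linarith
  have hQ0 : ∀ᵐ t ∂(volume.restrict (Ioo 0 T)), 0 ≤ Q t := by
    filter_upwards [hDQ] with t ht using (hD t).trans ht
  calc ∫⁻ t in Ioo 0 T, ENNReal.ofReal (D t)
      ≤ ∫⁻ t in Ioo 0 T, ENNReal.ofReal (Q t) := by
        refine lintegral_mono_ae ?_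
        filter_upwards [hDQ] with t ht using ENNReal.ofReal_le_ofReal ht
    _ = ENNReal.ofReal (∫ t in Ioo 0 T, Q t) :=
        (ofReal_integral_eq_lintegral_ofReal hQi hQ0).symm
    _ ≤ _ := by
        refine ENNReal.ofReal_le_ofReal ?_
        rw [hQ, integral_div, integral_sub hνE hpi, integral_add hν hEi, ← hEeq T hT]
        have : ∫ t in Ioo 0 T, c * ‖∫ τ in (0)..t, g τ‖ ^ 2 ≤
            c * T * (A * Real.exp (c * T)) := by
          calc ∫ t in Ioo 0 T, c * ‖∫ τ in (0)..t, g τ‖ ^ 2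
              ≤ ∫ t in Ioo 0 T, c * (A * Real.exp (c * T)) := by
                refine setIntegral_mono_on hEi (integrable_const _) measurableSet_Ioo fun t ht => ?_
                exact mul_le_mul_of_nonneg_left (hbd t (Ioo_subset_Icc_self ht)) hc
            _ = c * T * (A * Real.exp (c * T)) := by
                simp [hT]
                ring
        gcongr
        linarith [sq_nonneg ‖∫ τ in (0)..T, g τ‖]

end Energy

lemma ofReal_integral_norm_sq {F : Type*} [NormedAddCommGroup F] {f : Eucl d → F}
    (hf : MemLp f 2) : ENNReal.ofReal (∫ x, ‖f x‖ ^ 2) = eLpNorm f 2 ^ 2 := by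
  rw [ofReal_integral_eq_lintegral_ofReal (integrable_norm_sq hf)
    (Filter.Eventually.of_forall fun x => by positivity), eLpNorm_two_sq]
  refine lintegral_congr fun x => ?_
  rw [ENNReal.ofReal_pow (norm_nonneg _), ofReal_norm]

lemma timeENorm_top_le {T : ℝ} {N : (Eucl d → ℝ) → ℝ≥0∞} {u : ℝ → Eucl d → ℝ} {C : ℝ≥0∞}
    (h : ∀ᵐ t ∂(volume.restrict (Ioo 0 T)), N (u t) ≤ C) : timeENorm ⊤ T N u ≤ C := by
  rw [timeENorm, eLpNorm_exponent_top]
  simp only [eLpNormEssSup, enorm_eq_self]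
  exact essSup_le_of_ae_le C h

lemma timeENorm_two_le {T : ℝ} {N : (Eucl d → ℝ) → ℝ≥0∞} {u : ℝ → Eucl d → ℝ} {C : ℝ≥0∞}
    (h : ∫⁻ t in Ioo 0 T, N (u t) ^ 2 ≤ C ^ 2) : timeENorm 2 T N u ≤ C := by
  have e := eLpNorm_nnreal_pow_eq_lintegral (f := fun t => N (u t))
    (μ := volume.restrict (Ioo 0 T)) (p := 2) (by norm_num)
  simp only [enorm_eq_self, ENNReal.coe_ofNat, NNReal.coe_ofNat, ENNReal.rpow_ofNat] at e
  rw [timeENorm, ← ENNReal.pow_le_pow_left_iff two_ne_zero, e]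
  exact h

section Comparison

variable {T a b B κ ε : ℝ} {u v h k : ℝ → Eucl d → ℝ} {N N' : ℝ → ℝ≥0∞} {W : Eucl d → ℝ}
  {u₀ : Eucl d → ℝ}

/-- The energy inequality for two regular slices, with the rate of convergence of the
nonlocal velocity. -/
lemma slice_energy_inequality {N : ℝ≥0∞} {f g h k : Eucl d → ℝ} (ha : 0 < a) (hb : 0 < b)
    (hW : ContDiff ℝ 2 W) (hW0 : ∀ x, 0 ≤ W x) (hsupp : tsupport W ⊆ Metric.closedBall 0 ε)
    (hint : ∫ x, W x = 2 * b) (hε : 0 < ε) (hh : IsRegularRep B f h) (hk : IsSobolevRep B N g k)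
    (hhκ : ∀ x, h x ≤ κ) (hN : N ^ 2 < ⊤) {l c₂ : ℝ} (hl : l = a - 2 * b * κ) (hl0 : 0 < l)
    (hc₂ : c₂ = 8 * b ^ 2 * B ^ 2 / l) :
    2 * (∫ x, (k x - h x) * (divergence (flux a k (velocity W k)) x -
        divergence (flux a h fun x => (2 * b) • gradient h x) x)) +
      l * (∫ x, ‖gradient k x - gradient h x‖ ^ 2) ≤
    c₂ * ε ^ 2 * (N ^ 2).toReal + c₂ * ∫ x, ‖k x - h x‖ ^ 2 := by
  have hWc : HasCompactSupport W := HasCompactSupport.of_support_subset_isCompact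
    (isCompact_closedBall 0 ε) ((subset_tsupport W).trans hsupp)
  have hP := contDiff_velocity hW hWc hk.contDiff.continuous
  have hP2 := memLp_velocity hW hWc hk.contDiff.continuous hk.memLp
  have hP' := memLp_fderiv_velocity hW hWc hk.contDiff.continuous hk.memLp
  have key := integral_sub_mul_divergence_sub_le ha hb (hl ▸ hl0) hh
    hk.toIsRegularRep hhκ hP hP2 hP'
  have hRem : ∫ x, ‖velocity W k x - (2 * b) • gradient k x‖ ^ 2 ≤
      4 * b ^ 2 * ε ^ 2 * (N ^ 2).toReal := by
    have hm : MemLp (fun x => velocity W k x - (2 * b) • gradient k x) 2 :=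
      hP2.sub (hk.memLp_smul_gradient _)
    have h1 := (eLpNorm_velocity_sub_le (hW.of_le (by norm_num)) hW0 hsupp hint
      hk.contDiff).trans (mul_le_mul_right hk.eLpNorm_hessian_le _)
    have h2 : ENNReal.ofReal (∫ x, ‖velocity W k x - (2 * b) • gradient k x‖ ^ 2) ≤
        ENNReal.ofReal (4 * b ^ 2 * ε ^ 2 * (N ^ 2).toReal) := by
      rw [ofReal_integral_norm_sq hm, ENNReal.ofReal_mul (by positivity),
        ENNReal.ofReal_toReal hN.ne]
      refine (pow_le_pow_left' h1 2).trans_eq ?_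
      rw [mul_pow, ← ENNReal.ofReal_pow (by positivity)]
      congr 2
      ring
    exact (ENNReal.ofReal_le_ofReal_iff (by positivity)).mp h2
  rw [← hl] at key
  have hm2 := mul_le_mul_of_nonneg_left hRem (by positivity : 0 ≤ B ^ 2 / l)
  -- The fixed-time inequality is doubled to match the derivative of ‖w‖², so `c₂` is twice the
  -- constant 4b²B²/l; this also turns the dissipation l/2 into l.
  have e2 : B ^ 2 / l * (4 * b ^ 2 * ε ^ 2 * (N ^ 2).toReal) = c₂ * ε ^ 2 * (N ^ 2).toReal / 2 := by
    rw [hc₂]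
    ring
  have e3 : c₂ * (∫ x, ‖k x - h x‖ ^ 2) =
      2 * (4 * b ^ 2 * B ^ 2 / l * ∫ x, ‖k x - h x‖ ^ 2) := by
    rw [hc₂]
    ring
  linarith

/-- The energy estimate for the difference of a nonlocal solution `v` and a limiting
solution `u`. -/
theorem comparison_estimate (hT : 0 < T) (ha : 0 < a) (hb : 0 < b) (hκ0 : 0 ≤ κ)
    (hκ : κ < a / (2 * b)) (hW : ContDiff ℝ 2 W) (hW0 : ∀ x, 0 ≤ W x)
    (hsupp : tsupport W ⊆ Metric.closedBall 0 ε) (hint : ∫ x, W x = 2 * b) (hε : 0 < ε)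
    (hu₀ : MemLp u₀ 2) (hu₀κ : ∀ᵐ x, u₀ x ≤ κ)
    (hu : IsWeakSolution T (limitFlux a b) u₀ u) (hv : IsWeakSolution T (nonlocalFlux a W) u₀ v)
    (hN : ∫⁻ t in Ioo 0 T, N t ^ 2 < ⊤)
    (hh : ∀ᵐ t ∂(volume.restrict (Ioo 0 T)), IsSobolevRep B (N t) (u t) (h t))
    (hN'm : AEMeasurable N' (volume.restrict (Ioo 0 T)))
    {R : ℝ} (hR : 0 ≤ R) (hN' : ∫⁻ t in Ioo 0 T, N' t ^ 2 ≤ ENNReal.ofReal R)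
    (hk : ∀ᵐ t ∂(volume.restrict (Ioo 0 T)), IsSobolevRep B (N' t) (v t) (k t)) {l c₁ c₂ : ℝ}
    (hl : l = a - 2 * b * κ) (hc₁ : c₁ = 8 * b ^ 2 * B ^ 2 / l * R)
    (hc₂ : c₂ = 8 * b ^ 2 * B ^ 2 / l) :
    (∀ᵐ t ∂(volume.restrict (Ioo 0 T)),
      eLpNorm (v t - u t) 2 ^ 2 ≤ ENNReal.ofReal (c₁ * Real.exp (c₂ * T) * ε ^ 2)) ∧
    ∫⁻ t in Ioo 0 T, eLpNorm (weakGrad (v t - u t)) 2 ^ 2 ≤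
      ENNReal.ofReal ((c₁ + c₂ * T * (c₁ * Real.exp (c₂ * T))) / l * ε ^ 2) := by
  have hl0 : 0 < l := by
    rw [lt_div_iff₀ (by positivity)] at hκ
    linarith
  have hWc : HasCompactSupport W := HasCompactSupport.of_support_subset_isCompact
    (isCompact_closedBall 0 ε) ((subset_tsupport W).trans hsupp)
  have hN'top : ∫⁻ t in Ioo 0 T, N' t ^ 2 < ⊤ := hN'.trans_lt ENNReal.ofReal_lt_top
  obtain ⟨g, hg, hgq, hgu⟩ := hu.exists_integral_eq_limit hT ha.le hu₀ hN hh
  obtain ⟨f, hf, hfq, hfv⟩ := hv.exists_integral_eq_nonlocal hT ha.le hW hWc hu₀ hN'top hk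
  have hmax := ae_forall_le_of_limit ha.le hb hκ0 hκ hu₀ hu₀κ hh hg hgq hgu
  have hfin : ∀ᵐ t ∂(volume.restrict (Ioo 0 T)), N' t ^ 2 < ⊤ :=
    ae_lt_top' (hN'm.pow_const 2) hN'top.ne
  -- The common initial datum cancels, so the difference is a primitive starting at 0, and the
  -- energy bound contains only the source of order ε².
  have hdiff : ∀ᵐ t ∂(volume.restrict (Ioo 0 T)),
      ∫ τ in (0)..t, (f - g) τ = toL2 (v t) - toL2 (u t) := by
    filter_upwards [hgu, hfv] with t e1 e2
    simp only [Pi.sub_apply]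
    rw [intervalIntegral.integral_sub hf.intervalIntegrable hg.intervalIntegrable, e1, e2]
    abel
  have hrep : ∀ᵐ t ∂(volume.restrict (Ioo 0 T)),
      (∫ τ in (0)..t, (f - g) τ : Lp ℝ 2 (volume : Measure (Eucl d))) =ᵐ[volume]
        fun x => k t x - h t x := by
    filter_upwards [hh, hk, hdiff] with t ht kt et
    rw [et]
    filter_upwards [Lp.coeFn_sub (toL2 (v t)) (toL2 (u t)),
      coeFn_toL2 (kt.memLp.ae_eq kt.ae_eq.symm), coeFn_toL2 (ht.memLp.ae_eq ht.ae_eq.symm),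
      kt.ae_eq, ht.ae_eq] with x e1 e2 e3 e4 e5
    rw [e1, Pi.sub_apply, e2, e3, e4, e5]
  set D : ℝ → ℝ := fun t => ∫ x, ‖gradient (k t) x - gradient (h t) x‖ ^ 2
  set ν : ℝ → ℝ := fun t => c₂ * ε ^ 2 * (N' t ^ 2).toReal
  have hc₂0 : 0 ≤ c₂ := by rw [hc₂]; positivity
  have hνi : IntegrableOn ν (Ioo 0 T) :=
    (integrable_toReal_of_lintegral_ne_top (hN'm.pow_const 2) hN'top.ne).const_mul _
  have hνA : ∫ t in Ioo 0 T, ν t ≤ c₁ * ε ^ 2 := by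
    rw [integral_const_mul, integral_toReal (hN'm.pow_const 2) hfin]
    have := ENNReal.toReal_le_of_le_ofReal hR hN'
    calc c₂ * ε ^ 2 * (∫⁻ t in Ioo 0 T, N' t ^ 2).toReal ≤ c₂ * ε ^ 2 * R := by gcongr
      _ = c₁ * ε ^ 2 := by rw [hc₁, hc₂]; ring
  have hineq : ∀ᵐ t ∂(volume.restrict (Ioo 0 T)),
      2 * inner ℝ (∫ τ in (0)..t, (f - g) τ) ((f - g) t) + l * D t ≤
        ν t + c₂ * ‖∫ τ in (0)..t, (f - g) τ‖ ^ 2 := by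
    filter_upwards [hh, hk, hrep, hmax, hgq, hfq, hfin] with t ht kt et hκt egt eft hft
    have hP := contDiff_velocity hW hWc kt.contDiff.continuous
    have hP2 := memLp_velocity hW hWc kt.contDiff.continuous kt.memLp
    have hP' := memLp_fderiv_velocity hW hWc kt.contDiff.continuous kt.memLp
    have qk := memLp_divergence (kt.memLp_fderiv_flux ha.le hP hP2 hP')
    have qh := memLp_divergence (ht.memLp_fderiv_flux ha.le (ht.contDiff_smul_gradient (2 * b))
      (ht.memLp_smul_gradient _) (ht.memLp_fderiv_smul_gradient _))
    have e1 : (f - g) t =ᵐ[volume] fun x => divergence (flux a (k t) (velocity W (k t))) x -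
        divergence (flux a (h t) fun x => (2 * b) • gradient (h t) x) x := by
      rw [Pi.sub_apply, egt, eft]
      filter_upwards [Lp.coeFn_sub (toL2 (divergence (flux a (k t) (velocity W (k t)))))
        (toL2 (divergence (flux a (h t) fun x => (2 * b) • gradient (h t) x))), coeFn_toL2 qk,
        coeFn_toL2 qh] with x e1 e2 e3
      rw [e1, Pi.sub_apply, e2, e3]
    have en : ‖∫ τ in (0)..t, (f - g) τ‖ ^ 2 = ∫ x, ‖k t x - h t x‖ ^ 2 := by
      rw [← real_inner_self_eq_norm_sq, inner_eq_integral_of_ae_eq et et]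
      simp only [Real.norm_eq_abs, sq_abs]
      simp only [sq]
    rw [inner_eq_integral_of_ae_eq et e1, en]
    exact slice_energy_inequality ha hb hW hW0 hsupp hint hε ht.toIsRegularRep kt hκt hft hl hl0 hc₂
  obtain ⟨r1, r2⟩ := energy_estimate (D := D) (ν := ν) hl0 hc₂0 (hf.sub hg)
    (fun t => integral_nonneg fun x => by positivity)
    (fun t => by positivity) hνi hνA hineq hT.le
  constructor
  · filter_upwards [hh, hk, hrep, ae_restrict_mem measurableSet_Ioo] with t ht kt et htT
    have e : eLpNorm (v t - u t) 2 = ‖∫ τ in (0)..t, (f - g) τ‖ₑ := by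
      rw [Lp.enorm_def]
      refine eLpNorm_congr_ae ?_
      filter_upwards [et, kt.ae_eq, ht.ae_eq] with x e1 e2 e3
      rw [e1, Pi.sub_apply, e2, e3]
    rw [e, ← ofReal_norm, ← ENNReal.ofReal_pow (norm_nonneg _)]
    refine ENNReal.ofReal_le_ofReal ((r1 t (Ioo_subset_Icc_self htT)).trans_eq ?_)
    ring
  · have hD : ∀ᵐ t ∂(volume.restrict (Ioo 0 T)),
        eLpNorm (weakGrad (v t - u t)) 2 ^ 2 = ENNReal.ofReal (D t) := by
      filter_upwards [hh, hk] with t ht kt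
      -- The difference has its own C¹ representative, so no linearity of the choice `weakGrad` is
      -- needed.
      have e : weakGrad (v t - u t) =ᵐ[volume] fun x => gradient (k t) x - gradient (h t) x := by
        rw [← gradient_sub ht.differentiable kt.differentiable]
        exact weakGrad_ae_eq (kt.ae_eq.sub ht.ae_eq) (kt.contDiff_one.sub ht.contDiff_one)
      rw [eLpNorm_congr_ae e,
        ofReal_integral_norm_sq (f := fun x => gradient (k t) x - gradient (h t) x)
          (kt.memLp_gradient.sub ht.memLp_gradient)]
    rw [lintegral_congr_ae hD]
    refine r2.trans_eq (congrArg ENNReal.ofReal ?_)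
    ring

end Comparison

end DiffusionAggregation

end

/-! ### The convergence rate. -/

theorem mainTheorem4 (d : ℕ) (hd : 1 ≤ d) (s : ℝ) (hs : (d : ℝ) / 2 + 1 < s)
    (a b : ℝ) (ha : 0 < a) (hb : 0 < b) (κ : ℝ) (hκ : κ < a / (2 * b))
    (T : ℝ) (hT : 0 < T) (M : ℝ) :
    ∃ C : ℝ,
      ∀ V : EuclideanSpace ℝ (Fin d) → ℝ, ContDiff ℝ 2 V →
        tsupport V ⊆ Metric.closedBall 0 1 → (∀ x, 0 ≤ V x) → ∫ x, V x = 2 * b →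
      ∀ u₀ : EuclideanSpace ℝ (Fin d) → ℝ,
        DiffusionAggregation.sobolevENorm s u₀ < ⊤ → (∀ᵐ x, 0 ≤ u₀ x) → (∀ᵐ x, u₀ x ≤ κ) →
      ∀ u : ℝ → EuclideanSpace ℝ (Fin d) → ℝ,
        DiffusionAggregation.IsWeakSolution T (DiffusionAggregation.limitFlux a b) u₀ u →
        DiffusionAggregation.timeENorm ⊤ T (DiffusionAggregation.sobolevENorm s) u
          ≤ ENNReal.ofReal M →
        DiffusionAggregation.timeENorm 2 T (DiffusionAggregation.sobolevENorm (s + 1)) u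
          ≤ ENNReal.ofReal M →
      ∀ ε : ℝ, 0 < ε → ∀ uε : ℝ → EuclideanSpace ℝ (Fin d) → ℝ,
        DiffusionAggregation.IsWeakSolution T
          (DiffusionAggregation.nonlocalFlux a (DiffusionAggregation.scaledPotential V ε)) u₀ uε →
        DiffusionAggregation.timeENorm ⊤ T (DiffusionAggregation.sobolevENorm s) uε
          ≤ ENNReal.ofReal M →
        DiffusionAggregation.timeENorm 2 T (DiffusionAggregation.sobolevENorm (s + 1)) uε
          ≤ ENNReal.ofReal M →
        (∀ᵐ t ∂(volume.restrict (Ioo 0 T)),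
          ∃ G, DiffusionAggregation.HasWeakGradient (uε t - u t) G) ∧
        DiffusionAggregation.timeENorm ⊤ T (fun f => eLpNorm f 2 volume) (uε - u) +
          DiffusionAggregation.timeENorm 2 T
            (fun f => eLpNorm (DiffusionAggregation.weakGrad f) 2 volume) (uε - u)
          ≤ ENNReal.ofReal (C * ε) := by
  obtain ⟨K, hK⟩ := DiffusionAggregation.exists_slices (d := d) hs
  -- K + 1 dominates both K, for the sup and gradient bounds, and 1, for the L² bound; `max M 0`
  -- covers negative `M`, for which `ENNReal.ofReal M` is 0.
  set B := (K + 1) * max M 0 with hB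
  obtain ⟨l, hl⟩ : ∃ l, l = a - 2 * b * κ := ⟨_, rfl⟩
  obtain ⟨c₂, hc₂⟩ : ∃ c₂, c₂ = 8 * b ^ 2 * B ^ 2 / l := ⟨_, rfl⟩
  obtain ⟨R, hR⟩ : ∃ R, R = (K * max M 0) ^ 2 := ⟨_, rfl⟩
  obtain ⟨c₁, hc₁⟩ : ∃ c₁, c₁ = 8 * b ^ 2 * B ^ 2 / l * R := ⟨_, rfl⟩
  -- The energy estimate bounds squared norms by multiples of ε²; the two roots belong to the
  -- L^∞(L²) norm and to the gradient norm.
  refine ⟨√(c₁ * Real.exp (c₂ * T)) + √((c₁ + c₂ * T * (c₁ * Real.exp (c₂ * T))) / l), ?_⟩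
  intro V hV hVs hV0 hVi u₀ hu₀ hu₀0 hu₀κ u hu hu1 hu2 ε hε v hv hv1 hv2
  obtain ⟨h, hh⟩ := hK M T u hu.measurable hu1 hu2
  obtain ⟨k, hk⟩ := hK M T v hv.measurable hv1 hv2
  -- The bounds 0 ≤ u₀ ≤ κ hold together at some point. Nonnegativity of κ gives β(0) = 0, without
  -- which Φ(u) would not be controlled by u².
  have hκ0 : 0 ≤ κ := by
    obtain ⟨x, hx, hx'⟩ := (hu₀0.and hu₀κ).exists
    exact hx.trans hx'
  have hl0 : 0 < l := by
    rw [lt_div_iff₀ (by positivity)] at hκ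
    linarith
  have hR0 : 0 ≤ R := hR ▸ sq_nonneg _
  have hint : ∀ w : ℝ → EuclideanSpace ℝ (Fin d) → ℝ,
      DiffusionAggregation.timeENorm 2 T (DiffusionAggregation.sobolevENorm (s + 1)) w
        ≤ ENNReal.ofReal M →
      ∫⁻ t in Ioo 0 T, (K * DiffusionAggregation.sobolevENorm (s + 1) (w t)) ^ 2 ≤
        ENNReal.ofReal R := fun w hw => by
    have hw' := hw.trans (ENNReal.ofReal_le_ofReal (le_max_left M 0))
    simp only [mul_pow]
    rw [lintegral_const_mul' _ _ (by finiteness), hR, mul_pow, ENNReal.ofReal_mul (by positivity),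
      ENNReal.ofReal_pow NNReal.zero_le_coe, ENNReal.ofReal_pow (le_max_right _ _), ENNReal.ofReal_coe_nnreal]
    exact mul_le_mul_right (DiffusionAggregation.lintegral_sq_le_of_timeENorm hw') _
  have hv2' : ∀ᵐ t ∂(volume.restrict (Ioo 0 T)), MemLp (v t) 2 := by
    filter_upwards [hk] with t kt using kt.memLp.ae_eq kt.ae_eq.symm
  obtain ⟨r1, r2⟩ := DiffusionAggregation.comparison_estimate hT ha hb hκ0 hκ
    (DiffusionAggregation.contDiff_scaledPotential hV)
    (DiffusionAggregation.scaledPotential_nonneg hε hV0)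
    (DiffusionAggregation.tsupport_scaledPotential hε hVs)
    ((DiffusionAggregation.integral_scaledPotential hε).trans hVi) hε
    (DiffusionAggregation.memLp_of_sobolevENorm_lt_top hu₀) hu₀κ hu hv
    ((hint u hu2).trans_lt ENNReal.ofReal_lt_top) hh
    ((DiffusionAggregation.aemeasurable_sobolevENorm hv.measurable hv2' (s + 1)).const_mul _)
    hR0 (hint v hv2) hk hl hc₁ hc₂
  have hc₂0 : 0 ≤ c₂ := by rw [hc₂]; positivity
  have hc₁0 : 0 ≤ c₁ := by rw [hc₁]; positivity
  have hsq : ∀ y : ℝ, 0 ≤ y → ENNReal.ofReal (y * ε ^ 2) = ENNReal.ofReal (√y * ε) ^ 2 :=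
    fun y hy => by rw [← ENNReal.ofReal_pow (by positivity), mul_pow, Real.sq_sqrt hy]
  rw [hsq _ (by positivity)] at r2
  refine ⟨?_, ?_⟩
  · filter_upwards [hh, hk] with t ht kt
    exact ⟨_, (DiffusionAggregation.hasWeakGradient_gradient
      (kt.contDiff_one.sub ht.contDiff_one)).congr (kt.ae_eq.sub ht.ae_eq).symm⟩
  · rw [add_mul, ENNReal.ofReal_add (by positivity) (by positivity)]
    refine add_le_add (DiffusionAggregation.timeENorm_top_le ?_)
      (DiffusionAggregation.timeENorm_two_le r2)
    filter_upwards [r1] with t ht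
    rw [hsq _ (by positivity)] at ht
    exact (ENNReal.pow_le_pow_left_iff two_ne_zero).mp ht
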